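/- Let $G$ be a simply connected semisimple complex Lie group (for instance a simple simply connected algebraic group over $\mathbb C$) with Lie algebra $\mathfrak g$, let $e\in\mathfrak g$ be nilpotent (i.e. $\operatorname{ad}e$ is nilpotent), let $H=\{g\in G:\operatorname{Ad}(g)e=e\}$ with identity component $H^0$ and $\mathfrak h=\{\gamma\in\mathfrak g:[\gamma,e]=0\}$. Let $X=G/H\cong\operatorname{Ad}(G)e$ be the orbit of $e$ and $\widetilde X=G/H^0$ its universal covering, with base point $o$. Write $\bar\xi=\xi+\mathfrak h\in\mathfrak g/\mathfrak h$ and let $\xi^*$ be the vector field $\xi^*(x)=\frac{d}{dt}\big|_{t=0}\exp(t\xi)x$ induced by $\xi\in\mathfrak g$; $\mathfrak g/\mathfrak h$ is identified with $T_o\widetilde X$ by $\bar\xi\mapsto\xi^*(o)$. Connections and isomorphisms are holomorphic. Suppose that $\widetilde X$ admits a $G$-invariant linear connection. Then $e$ belongs to an $\mathfrak{sl}_2$-triple $(f,h,e)$ in $\mathfrak g$ (that is, $[h,e]=2e$, $[h,f]=-2f$, $[e,f]=h$; for $e=0$ the triple is zero), and for every such triple there is a $G$-invariant linear connection $\nabla$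 on $\widetilde X$ with the following properties. 1. $\nabla$ is locally flat: its torsion and its curvature vanish. 2. There is a linear map $\Gamma:\mathfrak g\to\operatorname{End}(\mathfrak g/\mathfrak h)$ with $\Gamma_\xi\bar\eta=\nabla_{\xi^*}\eta^*(o)+\overline{[\xi,\eta]}$ for all $\xi,\eta\in\mathfrak g$ (the map corresponding to $\nabla$). It is a representation of $\mathfrak g$ on $\mathfrak g/\mathfrak h$, it is transitive (there is $v\in\mathfrak g/\mathfrak h$ with $\Gamma_{\mathfrak g}v=\mathfrak g/\mathfrak h$), and $\Gamma_\xi\bar h=\bar\xi$ for all $\xi\in\mathfrak g$. 3. $\Gamma$ is the differential of a holomorphic representation of $G$ on $V=\mathfrak g/\mathfrak h$, the orbit $G\bar h\subset V$ is open, and both $X$ and $\widetilde X$ are locally $G$-equivariantly isomorphic to this orbit: each of their points has an open neighbourhood $U$ with a biholomorphic map $\Phi$ from $U$ onto an open subset of $G\bar h$ such that for every $y\in U$ one has $\Phi(gy)=g\,\Phi(y)$ for all $g\in G$ sufficiently close to $1$. -/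

import Mathlib

open scoped Manifold ContDiff Topology

noncomputable section

namespace InvConn

/-! Everything is complex: over `ℂ` and in finite dimension, "of class `∞`" means holomorphic. -/

section LieGroups

variable {E : Type*} [NormedAddCommGroup E] [NormedSpace ℂ E]
  {G : Type*} [TopologicalSpace G] [ChartedSpace E G] [Group G]

/-- A complex Lie group has the smoothness that Mathlib asks for to give `T₁G` its bracket. -/
instance lieGroup_minSmoothness [LieGroup 𝓘(ℂ, E) ∞ G] :
    LieGroup 𝓘(ℂ, E) (minSmoothness ℂ 3) G :=
  LieGroup.of_le (m := minSmoothness ℂ 3) (n := ∞)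
    (by rw [minSmoothness_of_isRCLikeNormedField]; exact ENat.LEInfty.out)

/-- The adjoint action `Ad(g)` on the Lie algebra: the derivative at `1` of `x ↦ g x g⁻¹`. -/
def Ad (g : G) : GroupLieAlgebra 𝓘(ℂ, E) G →L[ℂ] GroupLieAlgebra 𝓘(ℂ, E) G :=
  mfderiv 𝓘(ℂ, E) 𝓘(ℂ, E) (fun x : G ↦ g * x * g⁻¹) 1

/-- The stabilizer `H = {g | Ad(g) e = e}` of `e` in `G`. -/
def centralizer (e : GroupLieAlgebra 𝓘(ℂ, E) G) : Set G :=
  {g | Ad g e = e}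

/-- The identity component `H⁰` of the stabilizer of `e`. -/
def centralizerComponent (e : GroupLieAlgebra 𝓘(ℂ, E) G) : Set G :=
  connectedComponentIn (centralizer e) 1

/-- The Lie algebra `𝔥 = 𝔷(e) = {γ | [e, γ] = 0}` of the stabilizer of `e`, as a subspace. -/
abbrev stabAlg [CompleteSpace E] [LieGroup 𝓘(ℂ, E) ∞ G] (e : GroupLieAlgebra 𝓘(ℂ, E) G) :
    Submodule ℂ (GroupLieAlgebra 𝓘(ℂ, E) G) :=
  LinearMap.ker (LieAlgebra.ad ℂ (GroupLieAlgebra 𝓘(ℂ, E) G) e : Module.End ℂ _)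

/-- `(f, h, e)` satisfies the `𝔰𝔩₂`-relations. (For `e = 0` this forces `f = h = 0`.) -/
structure IsTriple [CompleteSpace E] [LieGroup 𝓘(ℂ, E) ∞ G]
    (f h e : GroupLieAlgebra 𝓘(ℂ, E) G) : Prop where
  lie_h_e : ⁅h, e⁆ = (2 : ℂ) • e
  lie_h_f : ⁅h, f⁆ = -((2 : ℂ) • f)
  lie_e_f : ⁅e, f⁆ = h

end LieGroups

section HomogeneousSpaces

variable {E : Type*} [NormedAddCommGroup E] [NormedSpace ℂ E]
  {G : Type*} [TopologicalSpace G] [ChartedSpace E G] [Group G]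
  {F : Type*} [NormedAddCommGroup F] [NormedSpace ℂ F]
  {M : Type*} [TopologicalSpace M] [ChartedSpace F M] [MulAction G M]

/-- The complex manifold `M` with its `G`-action and the base point `o` is the homogeneous space
`G/K`: the action is holomorphic and transitive, the stabilizer of `o` is `K`, and the orbit map
`g ↦ g • o` is a submersion (by homogeneity it is enough to ask this at `1`). -/
structure IsHomogeneousSpace (K : Set G) (o : M) : Prop where
  smooth : ContMDiffSMul 𝓘(ℂ, E) 𝓘(ℂ, F) ∞ G M
  transitive : MulAction.IsPretransitive G M
  stabilizer_eq : (MulAction.stabilizer G o : Set G) = K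
  submersion : Function.Surjective (mfderiv 𝓘(ℂ, E) 𝓘(ℂ, F) (fun g : G ↦ g • o) 1)

/-- The vector field `ξ*` on `M` induced by `ξ ∈ 𝔤`: `ξ*(x)` is the derivative of
`g ↦ g • x` at `1` in the direction `ξ`. -/
def fundField (ξ : GroupLieAlgebra 𝓘(ℂ, E) G) (x : M) : TangentSpace 𝓘(ℂ, F) x :=
  mfderiv 𝓘(ℂ, E) 𝓘(ℂ, F) (fun g : G ↦ g • x) 1 ξ

end HomogeneousSpaces

section Connections

variable {F : Type*} [NormedAddCommGroup F] [NormedSpace ℂ F]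
  {M : Type*} [TopologicalSpace M] [ChartedSpace F M] [IsManifold 𝓘(ℂ, F) ∞ M]

/-- Linear connections on `M`, that is, covariant derivatives on the tangent bundle.
`nabla Y x (X x)` is `(∇_X Y)(x)`. -/
abbrev LinearConnection (F : Type*) [NormedAddCommGroup F] [NormedSpace ℂ F]
    (M : Type*) [TopologicalSpace M] [ChartedSpace F M] [IsManifold 𝓘(ℂ, F) ∞ M] : Type _ :=
  CovariantDerivative 𝓘(ℂ, F) F (TangentSpace 𝓘(ℂ, F) : M → Type _)

/-- `∇` is holomorphic: for every open `U`, it sends vector fields that are holomorphic on `U`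
to sections of `Hom(TM, TM)` that are holomorphic on `U`. -/
def IsHolomorphic (nabla : LinearConnection F M) : Prop :=
  ∀ U : Set M, IsOpen U → ContMDiffCovariantDerivativeOn F ∞ (⇑nabla) U

/-- `∇` is invariant under `G`: it commutes with the pullback of vector fields by each `g`,
`dg ((∇_v (g^*Y))(x)) = (∇_{dg v} Y)(g x)`. -/
def IsInvariant (G : Type*) [Group G] [MulAction G M] (nabla : LinearConnection F M) : Prop :=
  ∀ (g : G) (x : M) (Y : Π y : M, TangentSpace 𝓘(ℂ, F) y) (v : TangentSpace 𝓘(ℂ, F) x),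
    MDiffAt (T% Y) (g • x) →
    mfderiv 𝓘(ℂ, F) 𝓘(ℂ, F) (fun y : M ↦ g • y) x
        (nabla (VectorField.mpullback 𝓘(ℂ, F) 𝓘(ℂ, F) (fun y : M ↦ g • y) Y) x v) =
      nabla Y (g • x) (mfderiv 𝓘(ℂ, F) 𝓘(ℂ, F) (fun y : M ↦ g • y) x v)

/-- `R(X, Y) Z = ∇_X ∇_Y Z - ∇_Y ∇_X Z - ∇_[X, Y] Z`. -/
def curvature (nabla : LinearConnection F M) (X Y Z : Π x : M, TangentSpace 𝓘(ℂ, F) x) (x : M) :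
    TangentSpace 𝓘(ℂ, F) x :=
  nabla (fun y ↦ nabla Z y (Y y)) x (X x) - nabla (fun y ↦ nabla Z y (X y)) x (Y x)
    - nabla Z x (VectorField.mlieBracket 𝓘(ℂ, F) X Y x)

/-- `∇` is locally flat: its torsion and its curvature vanish. -/
structure IsLocallyFlat [FiniteDimensional ℂ F] [CompleteSpace F]
    (nabla : LinearConnection F M) : Prop where
  torsion_eq_zero : nabla.torsion = 0
  curvature_eq_zero : ∀ (U : Set M), IsOpen U →
    ∀ X Y Z : Π x : M, TangentSpace 𝓘(ℂ, F) x,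
      CMDiff[U] ∞ (T% X) → CMDiff[U] ∞ (T% Y) → CMDiff[U] ∞ (T% Z) →
        ∀ x ∈ U, curvature nabla X Y Z x = 0

end Connections

/-- The linear map `Γ : L → End V` is a transitive representation: it respects brackets, and
`Γ_L v = V` for some `v ∈ V`. -/
structure IsTransitiveRep {L V : Type*} [LieRing L] [LieAlgebra ℂ L] [AddCommGroup V] [Module ℂ V]
    (Γ : L →ₗ[ℂ] Module.End ℂ V) : Prop where
  map_lie : ∀ ξ η : L, Γ ⁅ξ, η⁆ = Γ ξ * Γ η - Γ η * Γ ξ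
  transitive : ∃ v : V, ∀ w : V, ∃ ξ : L, Γ ξ v = w

/-- The `G`-manifold `X` is locally `G`-equivariantly isomorphic to the orbit of `v` under the
linear action `ρ`, and this orbit is open: around each point of `X` there is a biholomorphic map
from an open subset of `X` onto an open subset of the orbit that commutes with all elements of `G`
sufficiently close to `1`. -/
def IsLocallyOpenOrbit {G : Type*} [TopologicalSpace G] [Group G]
    {F' : Type*} [NormedAddCommGroup F'] [NormedSpace ℂ F']
    (X : Type*) [TopologicalSpace X] [ChartedSpace F' X] [MulAction G X]
    {V : Type*} [NormedAddCommGroup V] [NormedSpace ℂ V]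
    (ρ : G →* (V →L[ℂ] V)) (v : V) : Prop :=
  IsOpen (Set.range fun g : G ↦ ρ g v) ∧
    ∀ x : X, ∃ Φ : PartialDiffeomorph 𝓘(ℂ, F') 𝓘(ℂ, V) X V ∞,
      x ∈ Φ.source ∧ Φ.target ⊆ Set.range (fun g : G ↦ ρ g v) ∧
        ∀ y ∈ Φ.source, ∀ᶠ g in 𝓝 (1 : G), Φ (g • y) = ρ g (Φ y)

end InvConn

end

/-! Put V = 𝔤/𝔷(e). An invariant connection on G/H⁰ gives a linear map Λ : 𝔤 → End V that extends
the isotropy representation of 𝔷(e) and is equivariant under 𝔷(e)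
(`IsHomogeneousSpace.exists_isEquivariantExtension`). Its torsion and curvature are tensors on V,
and the 𝔰𝔩₂-triple forces them to vanish after one correction of Λ.

Since ad h is semisimple, Λ can be replaced by an ad h-invariant extension
(`IsEquivariantExtension.exists_weight_zero`). Then Λ_e and Λ_h belong to an 𝔰𝔩₂-triple on V, and D
= Λ_h - ad h commutes with Λ_e and ad h. The projection 𝔤 → V and the embedding V → 𝔤, x̄ ↦ [e, x],
are vectors killed by e in spaces of linear maps; their weights exclude every eigenvalue of D except
1, so Λ_h = ad h + 1 (`IsEquivariantExtension.apply_h`). Torsion and curvature are killed by e and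
are ad h-invariant, hence have weights 1 - 2 = -1 and 1 - 3 = -2 for the triple on V. A vector
killed by e has no negative weight in finite dimension, so both vanish. Thus Λ is a representation
Γ, and zero torsion gives Γ_ξ h̄ = Γ_h ξ̄ + [ξ, h] = ξ̄ modulo 𝔷(e)
(`IsEquivariantExtension.exists_representation`).

The analytic half goes back from Γ to geometry. As every derivation of 𝔤 is inner, automorphisms
close to 1 are exponentials of inner derivations, which gives logarithmic coordinates on G with Ad g
= exp(ad l(g)). The formula exp(Γ(l(g))) integrates Γ near 1, and simple connectedness makes the
result global (`IsLogChart.exists_representation`). The orbit of h̄ is open and its stabilizer has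
Lie algebra 𝔷(e), so G/H⁰ develops equivariantly and locally biholomorphically into V
(`IsOpenOrbitModel.exists_dev`). The connection sought is the pullback of the flat connection of V;
on G/H the same map exists locally. -/

noncomputable section

namespace InvConn

/-! ### Weights in finite-dimensional 𝔰𝔩₂-modules, without complete reducibility. -/

section SlTwo

open Polynomial Module

variable {U : Type*} [AddCommGroup U] [Module ℂ U]

/-- An operator that is an eigenvector of a commutator map for a non-zero eigenvalue is
nilpotent. -/
theorem isNilpotent_of_commutator_eq_smul [FiniteDimensional ℂ U] {h e : End ℂ U} {c : ℂ}
    (hc : c ≠ 0) (he : h * e - e * h = c • e) : IsNilpotent e := by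
  by_contra hn
  have hne : ∀ k : ℕ, e ^ k ≠ 0 := fun k hk ↦ hn ⟨k, hk⟩
  have hpow : ∀ k : ℕ, h * e ^ k - e ^ k * h = (k * c) • e ^ k := by
    intro k
    induction k with
    | zero => simp
    | succ k ih =>
      have h1 : h * e ^ (k + 1) - e ^ (k + 1) * h
          = (h * e ^ k - e ^ k * h) * e + e ^ k * (h * e - e * h) := by
        rw [pow_succ]; noncomm_ring
      rw [h1, ih, he, smul_mul_assoc, mul_smul_comm, ← pow_succ, ← add_smul]
      push_cast
      congr 1
      ring
  -- If no power of `e` vanished, the powers would be eigenvectors of the commutator with `h` for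
  -- the infinitely many eigenvalues `k * c`.
  let T : End ℂ (End ℂ U) := LinearMap.mulLeft ℂ h - LinearMap.mulRight ℂ h
  have hT : ∀ k : ℕ, T.HasEigenvalue (k * c) := fun k ↦
    End.hasEigenvalue_of_hasEigenvector (x := e ^ k)
      (End.hasEigenvector_iff.2 ⟨End.mem_eigenspace_iff.2 (by simpa [T] using hpow k), hne k⟩)
  have hinf : (Set.range fun k : ℕ ↦ (k * c : ℂ)).Infinite :=
    Set.infinite_range_of_injective fun a b hab ↦ by simpa [hc] using hab
  exact hinf ((End.finite_hasEigenvalue T).subset (by rintro _ ⟨k, rfl⟩; exact hT k))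

/-- The polynomial `X (X - 1) ⋯ (X - N + 1)`. -/
def fallingPoly (N : ℕ) : ℂ[X] := ∏ i ∈ Finset.range N, (X - C (i : ℂ))

theorem pow_mul_sub_mul_pow {A B h : End ℂ U} (hA : h * A - A * h = (2 : ℂ) • A)
    (hB : A * B - B * A = h) (i : ℕ) :
    A ^ (i + 1) * B - B * A ^ (i + 1) = ((i + 1 : ℕ) : ℂ) • (h * A ^ i - (i : ℂ) • A ^ i) := by
  have hpow : ∀ k : ℕ, A ^ k * h = h * A ^ k - (2 * k : ℂ) • A ^ k := by
    intro k
    induction k with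
    | zero => simp
    | succ k ih =>
      have hA' : A * h = h * A - (2 : ℂ) • A := by rw [← hA]; abel
      rw [pow_succ, mul_assoc, hA', mul_sub, ← mul_assoc, ih, sub_mul, mul_smul_comm,
        smul_mul_assoc, mul_assoc, ← pow_succ, sub_sub, ← add_smul]
      push_cast
      congr 2
      ring
  induction i with
  | zero => simp [hB]
  | succ i ih =>
    have h1 : A ^ (i + 1 + 1) * B - B * A ^ (i + 1 + 1)
        = A ^ (i + 1) * (A * B - B * A) + (A ^ (i + 1) * B - B * A ^ (i + 1)) * A := by
      rw [pow_succ _ (i + 1)]; noncomm_ring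
    rw [h1, ih, hB, hpow, smul_mul_assoc, sub_mul, smul_mul_assoc, mul_assoc, ← pow_succ]
    push_cast
    module

/-- By induction h(h-1)⋯(h-N+1)v lies in ker A and in the image of A^N: if it equals A^N w, then
A^(N+1) w = 0 and `pow_mul_sub_mul_pow` turns (h - N)A^N w into a multiple of A^(N+1) B w. So on ker
A the operator h is diagonalizable with weights in ℕ. The relation for [h, B] does not enter, which
allows an application before B has been completed to a triple. -/
theorem exists_fallingPoly_apply_eq_zero {A B h : End ℂ U} (hnil : IsNilpotent A)
    (hA : h * A - A * h = (2 : ℂ) • A) (hB : A * B - B * A = h) :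
    ∃ N, ∀ v, A v = 0 → aeval h (fallingPoly N) v = 0 := by
  have key : ∀ N v, A v = 0 → A (aeval h (fallingPoly N) v) = 0 ∧
      ∃ w, aeval h (fallingPoly N) v = (A ^ N) w := by
    intro N v hv
    induction N with
    | zero => simp [fallingPoly, hv]
    | succ N ih =>
      obtain ⟨h0, w, hw⟩ := ih
      have hstep : aeval h (fallingPoly (N + 1)) v
          = h (aeval h (fallingPoly N) v) - (N : ℂ) • aeval h (fallingPoly N) v := by
        rw [fallingPoly, Finset.prod_range_succ_comm, map_mul]
        simp [fallingPoly, Nat.cast_smul_eq_nsmul]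
      rw [hstep]
      constructor
      · have := LinearMap.congr_fun hA (aeval h (fallingPoly N) v)
        simp only [LinearMap.sub_apply, End.mul_apply, LinearMap.smul_apply, h0, map_zero,
          smul_zero, zero_sub, neg_eq_zero] at this
        simp [this, h0]
      · have h1 := LinearMap.congr_fun (pow_mul_sub_mul_pow hA hB N) w
        have h2 : (A ^ (N + 1)) w = 0 := by rw [pow_succ', End.mul_apply, ← hw, h0]
        simp only [LinearMap.sub_apply, End.mul_apply, LinearMap.smul_apply, h2, map_zero,
          sub_zero, ← hw] at h1
        refine ⟨((N + 1 : ℕ) : ℂ)⁻¹ • B w, ?_⟩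
        rw [map_smul, h1, smul_smul, inv_mul_cancel₀ (by exact_mod_cast N.succ_ne_zero), one_smul]
  obtain ⟨N, hN⟩ := hnil
  refine ⟨N, fun v hv ↦ ?_⟩
  obtain ⟨-, w, hw⟩ := key N v hv
  rw [hw, hN, LinearMap.zero_apply]

theorem eval_fallingPoly_eq_zero_iff {N : ℕ} {μ : ℂ} :
    (fallingPoly N).eval μ = 0 ↔ ∃ n < N, μ = n := by
  simp [fallingPoly, eval_prod, Finset.prod_eq_zero_iff, sub_eq_zero]

theorem aeval_apply_of_apply_eq_smul {h : End ℂ U} {μ : ℂ} {v : U} (hv : h v = μ • v) (p : ℂ[X]) :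
    aeval h p v = p.eval μ • v := by
  by_cases h0 : v = 0
  · simp [h0]
  · exact End.aeval_apply_of_hasEigenvector (End.hasEigenvector_iff.2
      ⟨End.mem_eigenspace_iff.2 hv, h0⟩)

theorem exists_nat_eq_of_apply_eq_smul {A B h : End ℂ U} (hnil : IsNilpotent A)
    (hA : h * A - A * h = (2 : ℂ) • A) (hB : A * B - B * A = h) {v : U} {μ : ℂ}
    (hv : A v = 0) (hμ : h v = μ • v) (h0 : v ≠ 0) : ∃ n : ℕ, μ = n := by
  obtain ⟨N, hN⟩ := exists_fallingPoly_apply_eq_zero hnil hA hB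
  have := hN v hv
  rw [aeval_apply_of_apply_eq_smul hμ, smul_eq_zero] at this
  obtain ⟨n, -, hn⟩ := eval_fallingPoly_eq_zero_iff.1 (this.resolve_right h0)
  exact ⟨n, hn⟩

/-- Three operators on a vector space satisfying the relations of `𝔰𝔩₂`. -/
structure SlTwoRep (e h f : End ℂ U) : Prop where
  e_f : e * f - f * e = h
  h_e : h * e - e * h = (2 : ℂ) • e
  h_f : h * f - f * h = -((2 : ℂ) • f)

namespace SlTwoRep

variable {W : Type*} [AddCommGroup W] [Module ℂ W] {e h f : End ℂ U} {e' h' f' : End ℂ W}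

theorem isNilpotent_e [FiniteDimensional ℂ U] (t : SlTwoRep e h f) : IsNilpotent e :=
  isNilpotent_of_commutator_eq_smul two_ne_zero t.h_e

theorem isNilpotent_f [FiniteDimensional ℂ U] (t : SlTwoRep e h f) : IsNilpotent f :=
  isNilpotent_of_commutator_eq_smul (c := -2) (by norm_num) (by rw [t.h_f, neg_smul])

theorem exists_nat [FiniteDimensional ℂ U] (t : SlTwoRep e h f) {v : U} {μ : ℂ} (hv : e v = 0)
    (hμ : h v = μ • v) (h0 : v ≠ 0) : ∃ n : ℕ, μ = n :=
  exists_nat_eq_of_apply_eq_smul t.isNilpotent_e t.h_e t.e_f hv hμ h0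

theorem eq_zero_of_neg [FiniteDimensional ℂ U] (t : SlTwoRep e h f) {v : U} {n : ℕ} (hn : n ≠ 0)
    (hv : e v = 0) (hμ : h v = (-(n : ℂ)) • v) : v = 0 := by
  by_contra h0
  obtain ⟨m, hm⟩ := t.exists_nat hv hμ h0
  have : ((m + n : ℕ) : ℂ) = 0 := by push_cast; rw [← hm]; ring
  rw [Nat.cast_eq_zero] at this
  omega

/-- The vector f v is killed by e, because e f v = h v = 0, and has the negative weight -2. -/
theorem apply_f_eq_zero [FiniteDimensional ℂ U] (t : SlTwoRep e h f) {v : U} (hv : e v = 0)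
    (hμ : h v = 0) : f v = 0 := by
  have h1 := LinearMap.congr_fun t.e_f v
  have h2 := LinearMap.congr_fun t.h_f v
  simp only [LinearMap.sub_apply, End.mul_apply, hv, hμ, map_zero, sub_zero, LinearMap.neg_apply,
    LinearMap.smul_apply] at h1 h2
  exact t.eq_zero_of_neg two_ne_zero h1 (by rw [h2]; push_cast; rw [neg_smul])

/-- An invariant vector in the image of `e` vanishes. -/
theorem eq_zero_of_mem_range [FiniteDimensional ℂ U] (t : SlTwoRep e h f) {v u : U} (hv : e v = 0)
    (hμ : h v = 0) (hu : e u = v) : v = 0 := by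
  have hf := t.apply_f_eq_zero hv hμ
  have hfp : ∀ k, 0 < k → (f ^ k) v = 0 := by
    intro k hk
    obtain ⟨k, rfl⟩ := Nat.exists_eq_succ_of_ne_zero hk.ne'
    rw [pow_succ, End.mul_apply, hf, map_zero]
  have hcomm : ∀ k : ℕ, e * f ^ (k + 1) - f ^ (k + 1) * e
      = ((k + 1 : ℕ) : ℂ) • (f ^ k * h - (k : ℂ) • f ^ k) := by
    intro k
    have hfh : ∀ k : ℕ, h * f ^ k = f ^ k * h - (2 * k : ℂ) • f ^ k := by
      intro k
      induction k with
      | zero => simp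
      | succ k ih =>
        have h1 : h * f = f * h - (2 : ℂ) • f := by
          rw [sub_eq_add_neg, ← t.h_f]; abel
        rw [pow_succ, ← mul_assoc, ih, sub_mul, mul_assoc, h1, mul_sub, smul_mul_assoc,
          mul_smul_comm, ← pow_succ, ← mul_assoc, ← pow_succ, sub_sub, ← add_smul]
        push_cast
        congr 2
        ring
    induction k with
    | zero => simp [t.e_f]
    | succ k ih =>
      have h1 : e * f ^ (k + 1 + 1) - f ^ (k + 1 + 1) * e
          = (e * f - f * e) * f ^ (k + 1) + f * (e * f ^ (k + 1) - f ^ (k + 1) * e) := by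
        rw [pow_succ' _ (k + 1)]; noncomm_ring
      rw [h1, ih, t.e_f, hfh, mul_smul_comm, mul_sub, ← mul_assoc, mul_smul_comm, ← pow_succ']
      push_cast
      module
  -- If e u = v, then e^(k+1) f^k u is a non-zero multiple of v for every k, the factor changing by
  -- -(k+1)(k+2) at each step. Nilpotency of `f` then kills v.
  have key : ∀ k : ℕ, ∃ c : ℂ, c ≠ 0 ∧ ∀ (u : U) (a : ℂ), e u = a • v →
      (e ^ (k + 1)) ((f ^ k) u) = (c * a) • v := by
    intro k
    induction k with
    | zero => exact ⟨1, one_ne_zero, fun u a hu ↦ by simp [hu]⟩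
    | succ k ih =>
      obtain ⟨c, hc, ih⟩ := ih
      refine ⟨-((k + 1 : ℕ) * (k + 2 : ℕ) * c), neg_ne_zero.2 (mul_ne_zero (mul_ne_zero
        (Nat.cast_ne_zero.2 (by omega)) (Nat.cast_ne_zero.2 (by omega))) hc), fun u a hu ↦ ?_⟩
      have h1 := LinearMap.congr_fun (hcomm k) u
      simp only [LinearMap.sub_apply, End.mul_apply, LinearMap.smul_apply, hu, map_smul,
        hfp _ k.succ_pos, smul_zero, sub_zero] at h1
      have h2 : e (h u - (k : ℂ) • u) = (-(k + 2 : ℂ) * a) • v := by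
        have := LinearMap.congr_fun t.h_e u
        simp only [LinearMap.sub_apply, End.mul_apply, LinearMap.smul_apply, hu, map_smul, hμ,
          smul_zero, zero_sub] at this
        rw [map_sub, map_smul, hu, ← neg_neg (e (h u)), this]
        module
      rw [pow_succ, End.mul_apply, h1, map_smul, ← map_smul (f ^ k), ← map_sub, ih _ _ h2,
        smul_smul]
      push_cast
      congr 1
      ring
  obtain ⟨k, hk⟩ := t.isNilpotent_f
  obtain ⟨c, hc, hkey⟩ := key k
  have := hkey u 1 (by rw [hu, one_smul])
  rw [hk, LinearMap.zero_apply, map_zero, mul_one] at this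
  exact (smul_eq_zero.1 this.symm).resolve_left hc

end SlTwoRep

/-- The operator `X ↦ T X - X S` on linear maps. -/
def homAct {W : Type*} [AddCommGroup W] [Module ℂ W] (S : End ℂ U) (T : End ℂ W) :
    End ℂ (U →ₗ[ℂ] W) where
  toFun X := T ∘ₗ X - X ∘ₗ S
  map_add' X Y := by ext; simp; abel
  map_smul' c X := by ext; simp [smul_sub]

section

variable {W : Type*} [AddCommGroup W] [Module ℂ W]

@[simp]
theorem homAct_apply_apply (S : End ℂ U) (T : End ℂ W) (X : U →ₗ[ℂ] W) (u : U) :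
    homAct S T X u = T (X u) - X (S u) := rfl

theorem homAct_commutator (S S' : End ℂ U) (T T' : End ℂ W) :
    homAct S T * homAct S' T' - homAct S' T' * homAct S T
      = homAct (S * S' - S' * S) (T * T' - T' * T) := by
  ext X u
  simp
  abel

theorem homAct_smul (c : ℂ) (S : End ℂ U) (T : End ℂ W) :
    homAct (c • S) (c • T) = c • homAct S T := by
  ext X u
  simp [smul_sub]

theorem homAct_neg (S : End ℂ U) (T : End ℂ W) : homAct (-S) (-T) = -homAct S T := by
  ext X u
  simp
  abel

theorem SlTwoRep.hom {e h f : End ℂ U} {e' h' f' : End ℂ W} (t : SlTwoRep e h f)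
    (t' : SlTwoRep e' h' f') : SlTwoRep (homAct e e') (homAct h h') (homAct f f') where
  e_f := by rw [homAct_commutator, t.e_f, t'.e_f]
  h_e := by rw [homAct_commutator, t.h_e, t'.h_e, homAct_smul]
  h_f := by rw [homAct_commutator, t.h_f, t'.h_f, homAct_neg, homAct_smul]

theorem eq_zero_of_forall_trace_comp_eq_zero [FiniteDimensional ℂ U] [FiniteDimensional ℂ W]
    {B : W →ₗ[ℂ] U} (hB : ∀ X : U →ₗ[ℂ] W, LinearMap.trace ℂ W (X ∘ₗ B) = 0) : B = 0 := by
  ext w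
  refine (Module.forall_dual_apply_eq_zero_iff ℂ _).1 fun g ↦ ?_
  have h1 : (g.smulRight w) ∘ₗ B = (g ∘ₗ B).smulRight w := by ext; simp
  have h2 := hB (g.smulRight w)
  rwa [h1, LinearMap.trace_smulRight] at h2

/-- A linear map which is orthogonal, for the trace pairing, to all maps commuting with
`S` and `T` is in the image of `X ↦ T X - X S`. -/
theorem mem_range_homAct [FiniteDimensional ℂ U] [FiniteDimensional ℂ W] {S : End ℂ U}
    {T : End ℂ W} {φ : U →ₗ[ℂ] W}
    (hφ : ∀ B : W →ₗ[ℂ] U, S ∘ₗ B = B ∘ₗ T → LinearMap.trace ℂ W (φ ∘ₗ B) = 0) :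
    φ ∈ LinearMap.range (homAct S T) := by
  by_contra hn
  obtain ⟨l, hl, hl0⟩ := Submodule.exists_le_ker_of_notMem hn
  -- The trace pairing identifies Hom(W, U) with the dual of Hom(U, W). A functional that vanishes
  -- on the range of `homAct S T` then corresponds to a map `B` intertwining `T` and `S`.
  obtain ⟨B, hB⟩ : ∃ B : W →ₗ[ℂ] U, ∀ X : U →ₗ[ℂ] W, LinearMap.trace ℂ W (X ∘ₗ B) = l X := by
    let τ : (W →ₗ[ℂ] U) →ₗ[ℂ] Dual ℂ (U →ₗ[ℂ] W) :=
      { toFun := fun B ↦ (LinearMap.trace ℂ W) ∘ₗ (LinearMap.lcomp ℂ W B)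
        map_add' := fun B B' ↦ by
          ext X
          change LinearMap.trace ℂ W (X ∘ₗ (B + B')) = _
          rw [LinearMap.comp_add, map_add]
          rfl
        map_smul' := fun a B ↦ by
          ext X
          change LinearMap.trace ℂ W (X ∘ₗ (a • B)) = _
          rw [LinearMap.comp_smul, map_smul]
          rfl }
    have hinj : Function.Injective τ := by
      rw [injective_iff_map_eq_zero]
      exact fun B hB ↦ eq_zero_of_forall_trace_comp_eq_zero fun X ↦ LinearMap.congr_fun hB X
    have hsurj : Function.Surjective τ := by
      refine (LinearMap.injective_iff_surjective_of_finrank_eq_finrank ?_).1 hinj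
      rw [Subspace.dual_finrank_eq, Module.finrank_linearMap, Module.finrank_linearMap, mul_comm]
    obtain ⟨B, hB⟩ := hsurj l
    exact ⟨B, fun X ↦ by rw [← hB]; rfl⟩
  refine hl ?_
  rw [← hB]
  refine hφ B (sub_eq_zero.1 (eq_zero_of_forall_trace_comp_eq_zero fun X ↦ ?_))
  have h1 : l (homAct S T X) = 0 := hl0 ⟨X, rfl⟩
  rw [← hB] at h1
  have h2 : homAct S T X ∘ₗ B = T ∘ₗ (X ∘ₗ B) - X ∘ₗ (S ∘ₗ B) := by ext; simp
  rw [h2, map_sub, sub_eq_zero, LinearMap.trace_comp_comm'] at h1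
  rw [LinearMap.comp_sub, map_sub, ← h1, sub_eq_zero]
  rfl

/-- A homomorphism of `𝔰𝔩₂`-modules which kills the highest weight vectors vanishes. -/
theorem SlTwoRep.eq_zero_of_ker_le [FiniteDimensional ℂ U] [FiniteDimensional ℂ W]
    {e h f : End ℂ U} {e' h' f' : End ℂ W} (t : SlTwoRep e h f) (t' : SlTwoRep e' h' f')
    {φ : U →ₗ[ℂ] W} (he : homAct e e' φ = 0) (hh : homAct h h' φ = 0)
    (hker : ∀ u, e u = 0 → φ u = 0) : φ = 0 := by
  -- An invariant vector in the image of e vanishes, so it suffices to solve e · ψ = φ. The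
  -- obstruction is the trace of φ B for B intertwining e' and e; φ B maps ker e'^(k+1) into ker
  -- e'^k, so it is nilpotent.
  obtain ⟨ψ, hψ⟩ : φ ∈ LinearMap.range (homAct e e') := by
    refine mem_range_homAct fun B hB ↦ ?_
    have hB' : ∀ w, e (B w) = B (e' w) := fun w ↦ LinearMap.congr_fun hB w
    have he' : ∀ u, e' (φ u) = φ (e u) := fun u ↦ sub_eq_zero.1 (LinearMap.congr_fun he u)
    have hpow : ∀ k w, (e' ^ k) w = 0 → ((φ ∘ₗ B) ^ k) w = 0 := by
      intro k
      induction k with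
      | zero => intro w hw; simpa using hw
      | succ k ih =>
        intro w hw
        rw [pow_succ, End.mul_apply]
        refine ih _ ?_
        have hit : ∀ j w, (e' ^ j) ((φ ∘ₗ B) w) = φ (B ((e' ^ j) w)) := by
          intro j
          induction j with
          | zero => intro w; rfl
          | succ j ihj =>
            intro w
            rw [pow_succ, End.mul_apply, End.mul_apply, ← ihj]
            simp [he', hB']
        rw [hit]
        refine hker _ ?_
        rw [hB', ← End.mul_apply, ← pow_succ', hw, map_zero]
    obtain ⟨k, hk⟩ := t'.isNilpotent_e
    refine (LinearMap.isNilpotent_trace_of_isNilpotent (f := φ ∘ₗ B) ⟨k, ?_⟩).eq_zero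
    ext w
    exact hpow k w (by rw [hk]; rfl)
  exact (t.hom t').eq_zero_of_mem_range he hh hψ

/-- A homomorphism of `𝔰𝔩₂`-modules with image in the image of `e` vanishes. -/
theorem SlTwoRep.eq_zero_of_le_range [FiniteDimensional ℂ U] [FiniteDimensional ℂ W]
    {e h f : End ℂ U} {e' h' f' : End ℂ W} (t : SlTwoRep e h f) (t' : SlTwoRep e' h' f')
    {φ : U →ₗ[ℂ] W} (he : homAct e e' φ = 0) (hh : homAct h h' φ = 0)
    (hrange : ∀ u, ∃ w, φ u = e' w) : φ = 0 := by
  -- Dual argument: φ B maps the image of e'^k into the image of e'^(k+1), so it is again nilpotent.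
  obtain ⟨ψ, hψ⟩ : φ ∈ LinearMap.range (homAct e e') := by
    refine mem_range_homAct fun B hB ↦ ?_
    have hB' : ∀ w, e (B w) = B (e' w) := fun w ↦ LinearMap.congr_fun hB w
    have he' : ∀ u, e' (φ u) = φ (e u) := fun u ↦ sub_eq_zero.1 (LinearMap.congr_fun he u)
    have hit : ∀ j w, φ (B ((e' ^ j) w)) = (e' ^ j) (φ (B w)) := by
      intro j
      induction j with
      | zero => intro w; rfl
      | succ j ihj =>
        intro w
        rw [pow_succ', End.mul_apply, End.mul_apply, ← ihj, ← hB', he']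
    have hpow : ∀ k w, ∃ w', ((φ ∘ₗ B) ^ k) w = (e' ^ k) w' := by
      intro k
      induction k with
      | zero => intro w; exact ⟨w, rfl⟩
      | succ k ih =>
        intro w
        obtain ⟨w', hw'⟩ := ih w
        obtain ⟨w'', hw''⟩ := hrange (B w')
        refine ⟨w'', ?_⟩
        rw [pow_succ', End.mul_apply, hw', LinearMap.comp_apply, hit, hw'', ← End.mul_apply,
          ← pow_succ]
    obtain ⟨k, hk⟩ := t'.isNilpotent_e
    refine (LinearMap.isNilpotent_trace_of_isNilpotent (f := φ ∘ₗ B) ⟨k, ?_⟩).eq_zero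
    ext w
    obtain ⟨w', hw'⟩ := hpow k w
    rw [hw', hk]
    rfl
  exact (t.hom t').eq_zero_of_mem_range he hh hψ

end

end SlTwo

/-! ### Semisimplicity of h, and a trace lemma for nilpotent operators. -/

section Semisimplicity

attribute [local instance] LieRing.ofAssociativeRing

open Polynomial Module

variable {U : Type*} [AddCommGroup U] [Module ℂ U] {W : Type*} [AddCommGroup W] [Module ℂ W]

/-- All generalized eigenvectors of `T` are eigenvectors. -/
def NoJordanBlocks (T : End ℂ U) : Prop :=
  ∀ (μ : ℂ) (v w : U), T v - μ • v = w → T w = μ • w → w = 0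

theorem _root_.Module.End.IsSemisimple.noJordanBlocks [FiniteDimensional ℂ U] {T : End ℂ U}
    (hT : T.IsSemisimple) : NoJordanBlocks T := by
  rintro μ v w hw hTw
  have h1 : v ∈ T.genEigenspace μ 2 := by
    refine End.mem_genEigenspace_nat (k := 2) |>.2 ?_
    rw [LinearMap.mem_ker, pow_two, End.mul_apply]
    have : (T - μ • (1 : End ℂ U)) v = w := by simpa using hw
    rw [this]
    simp [hTw]
  rw [hT.isFinitelySemisimple.genEigenspace_eq_eigenspace μ (by norm_num),
    End.mem_eigenspace_iff] at h1
  rw [← hw, h1, sub_self]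

/-- On the ν-eigenspace of S the operator X ↦ T X - X S acts on values as T - ν, so a Jordan block
would produce one of T. These eigenspaces span U. -/
theorem NoJordanBlocks.homAct [FiniteDimensional ℂ U] {S : End ℂ U} {T : End ℂ W}
    (hS : S.IsSemisimple) (hT : NoJordanBlocks T) : NoJordanBlocks (homAct S T) := by
  intro μ X Y hY hTY
  have hle : (⨆ ν, S.eigenspace ν) ≤ LinearMap.ker Y := by
    refine iSup_le fun ν u hu ↦ ?_
    rw [End.mem_eigenspace_iff] at hu
    have h1 := LinearMap.congr_fun hY u
    have h2 := LinearMap.congr_fun hTY u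
    simp only [LinearMap.sub_apply, homAct_apply_apply, LinearMap.smul_apply, hu, map_smul] at h1 h2
    refine hT (ν + μ) (X u) (Y u) ?_ ?_
    · rw [← h1]; module
    · rw [sub_eq_iff_eq_add] at h2; rw [h2]; module
  rw [hS.iSup_eigenspace_eq_top] at hle
  ext u
  exact hle trivial

/-- The element `h` of an `𝔰𝔩₂`-triple acts semisimply on finite-dimensional modules. -/
theorem SlTwoRep.isSemisimple_h [FiniteDimensional ℂ U] {e h f : End ℂ U} (t : SlTwoRep e h f) :
    h.IsSemisimple := by
  -- Jordan–Chevalley decomposition h = n + s. The nilpotent part will be an endomorphism of the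
  -- 𝔰𝔩₂-module that kills ker e, hence zero by `SlTwoRep.eq_zero_of_ker_le`.
  obtain ⟨n, hn, s, hs, hnil, hss, hsum⟩ := h.exists_isNilpotent_isSemisimple
  have hcomm : ∀ a ∈ Algebra.adjoin ℂ {h}, Commute h a := fun a ha ↦
    Algebra.commute_of_mem_adjoin_self ha
  have hhn : Commute h n := hcomm n hn
  have hsn : Commute s n := by
    have : s = h - n := by rw [hsum]; abel
    rw [this]
    exact hhn.sub_left (Commute.refl n)
  -- `n` commutes with `e`
  have hdnil : IsNilpotent (InvConn.homAct n n) := by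
    have h1 := LieAlgebra.ad_nilpotent_of_nilpotent (R := ℂ) hnil
    have h2 : InvConn.homAct n n = LieAlgebra.ad ℂ (End ℂ U) n := by ext X u; rfl
    rwa [h2]
  have hss' := NoJordanBlocks.homAct hss hss.noJordanBlocks
  have hds : ∀ X, InvConn.homAct s s X = InvConn.homAct h h X - InvConn.homAct n n X := by
    intro X
    ext u
    simp [hsum]
    abel
  have hdcomm : ∀ X, InvConn.homAct h h (InvConn.homAct n n X)
      = InvConn.homAct n n (InvConn.homAct h h X) := by
    intro X
    have h1 := LinearMap.congr_fun (homAct_commutator h n h n) X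
    rw [hhn.eq, sub_self] at h1
    have h2 : InvConn.homAct (0 : End ℂ U) (0 : End ℂ U) X = 0 := by ext; simp
    rw [h2] at h1
    exact sub_eq_zero.1 h1
  have hne : InvConn.homAct n n e = 0 := by
    -- All iterates of [n, ·] on e stay in the 2-eigenspace of [h, ·], where [s, ·] acts as 2 - [n,
    -- ·]. As [s, ·] has no Jordan blocks, the last non-zero iterate must be e itself.
    have hpow : ∀ j, InvConn.homAct h h (((InvConn.homAct n n) ^ j) e)
        = (2 : ℂ) • ((InvConn.homAct n n) ^ j) e := by
      intro j
      induction j with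
      | zero => exact t.h_e
      | succ j ih => rw [pow_succ', End.mul_apply, hdcomm, ih, map_smul]
    have hdown : ∀ j, ((InvConn.homAct n n) ^ (j + 1)) e = 0 → InvConn.homAct n n e = 0 := by
      intro j
      induction j with
      | zero => intro hj; simpa using hj
      | succ j ih =>
        intro hj
        refine ih (neg_eq_zero.1 (hss' 2 (((InvConn.homAct n n) ^ j) e) _ ?_ ?_))
        · rw [hds, hpow, pow_succ', End.mul_apply]; abel
        · rw [map_neg, hds, hpow, ← End.mul_apply, ← pow_succ', hj]; simp
    obtain ⟨k, hk⟩ := hdnil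
    refine hdown k ?_
    rw [pow_succ, hk, zero_mul, LinearMap.zero_apply]
  have hne' : ∀ u, n (e u) = e (n u) := fun u ↦ sub_eq_zero.1 (LinearMap.congr_fun hne u)
  -- `n` vanishes on the kernel of `e`
  have hK : ∀ v ∈ LinearMap.ker e, h v ∈ LinearMap.ker e := by
    intro v hv
    have := LinearMap.congr_fun t.h_e v
    rw [LinearMap.mem_ker] at hv
    simp only [LinearMap.sub_apply, End.mul_apply, hv, map_zero, LinearMap.smul_apply, smul_zero,
      zero_sub, neg_eq_zero] at this
    exact this
  have hKn : ∀ v ∈ LinearMap.ker e, n v ∈ LinearMap.ker e := by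
    intro v hv
    rw [LinearMap.mem_ker] at hv
    change e (n v) = 0
    rw [← hne', hv, map_zero]
  have hKs : ∀ v ∈ LinearMap.ker e, s v ∈ LinearMap.ker e := by
    have : s = h - n := by rw [hsum]; abel
    intro v hv
    rw [this]
    exact Submodule.sub_mem _ (hK v hv) (hKn v hv)
  have hnker : ∀ u, e u = 0 → n u = 0 := by
    obtain ⟨N, hN⟩ := exists_fallingPoly_apply_eq_zero t.isNilpotent_e t.h_e t.e_f
    -- The annihilating polynomial on ker e has simple roots, so `h` is semisimple there. Then `n`
    -- is a difference of commuting semisimple operators, besides being nilpotent.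
    have h1 : End.IsSemisimple (h.restrict hK) := by
      refine End.isSemisimple_of_squarefree_aeval_eq_zero (p := fallingPoly N) ?_ ?_
      · refine Polynomial.Separable.squarefree ?_
        rw [fallingPoly]
        exact Polynomial.separable_prod_X_sub_C_iff'.2 (by simp)
      · ext v
        have h2 : ∀ p : ℂ[X], ((aeval (h.restrict hK) p v : LinearMap.ker e) : U)
            = aeval h p (v : U) := by
          intro p
          induction p using Polynomial.induction_on' with
          | add p q hp hq => simp [hp, hq]
          | monomial k a =>
            simp only [aeval_monomial, End.mul_apply, Module.algebraMap_end_apply,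
              Submodule.coe_smul]
            congr 1
            induction k with
            | zero => simp
            | succ k ih => rw [pow_succ', End.mul_apply, pow_succ', End.mul_apply, ← ih]; rfl
        rw [h2, hN _ v.2]
        rfl
    have h2 := hss.restrict hKs
    have h3 : (n.restrict hKn) = h.restrict hK - s.restrict hKs := by
      ext v
      simp [hsum]
    have h4 : (n.restrict hKn) = 0 := by
      refine End.eq_zero_of_isNilpotent_isSemisimple ?_ ?_
      · exact End.isNilpotent.restrict hKn hnil
      · rw [h3]
        refine End.IsSemisimple.sub_of_commute ?_ h1 h2
        ext v
        have : Commute h s := hcomm s hs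
        exact LinearMap.congr_fun this.eq (v : U)
    intro u hu
    exact congrArg Subtype.val (LinearMap.congr_fun h4 ⟨u, hu⟩)
  have hn0 : n = 0 := t.eq_zero_of_ker_le t (by rw [← neg_eq_zero, ← hne]; ext u; simp)
    (by ext u; exact sub_eq_zero.2 (LinearMap.congr_fun hhn.eq u)) hnker
  rw [hsum, hn0, zero_add]
  exact hss

/-- If `A` is nilpotent and commutes with `C = [A, Z]`, then `C` is nilpotent. -/
theorem isNilpotent_commutator {A Z : End ℂ U} (hA : IsNilpotent A)
    (hC : Commute A (A * Z - Z * A)) : IsNilpotent (A * Z - Z * A) := by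
  set C := A * Z - Z * A with hCdef
  set d := homAct A A with hd
  have hdX : ∀ X, d X = A * X - X * A := fun X ↦ rfl
  have hdnil : IsNilpotent d := by
    have h1 := LieAlgebra.ad_nilpotent_of_nilpotent (R := ℂ) hA
    have h2 : d = LieAlgebra.ad ℂ (End ℂ U) A := by ext X u; rfl
    rwa [h2]
  have hleib : ∀ (n : ℕ) (Y : End ℂ U),
      (d ^ (n + 1)) (Z * Y) = Z * (d ^ (n + 1)) Y + ((n + 1 : ℕ) : ℂ) • (C * (d ^ n) Y) := by
    have hdC : ∀ Y, d (C * Y) = C * d Y := by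
      intro Y
      rw [hdX, hdX, mul_sub, ← mul_assoc, hC.eq, mul_assoc, mul_assoc]
    have hdZ : ∀ Y, d (Z * Y) = Z * d Y + C * Y := by
      intro Y
      rw [hdX, hdX, hCdef]
      noncomm_ring
    intro n
    induction n with
    | zero => intro Y; simp [hdZ]
    | succ n ih =>
      intro Y
      rw [pow_succ', End.mul_apply, ih, map_add, map_smul, hdZ, hdC, ← End.mul_apply,
        ← End.mul_apply, ← pow_succ', ← pow_succ']
      push_cast
      module
  have hdCn : ∀ n : ℕ, d (C ^ n) = 0 := fun n ↦ by
    rw [hdX, (hC.pow_right n).eq, sub_self]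
  -- The map d = [A, ·] is a derivation with d Z = C and d C = 0, so d^n(Z^n) = n! C^n, and d is
  -- nilpotent.
  have hmain : ∀ n : ℕ, (d ^ n) (Z ^ n) = (n.factorial : ℂ) • C ^ n := by
    intro n
    induction n with
    | zero => simp
    | succ n ih =>
      rw [pow_succ' Z, hleib, ih, pow_succ' d, End.mul_apply, ih, map_smul, hdCn, smul_zero,
        mul_zero, zero_add, mul_smul_comm, smul_smul, ← pow_succ', Nat.factorial_succ]
      push_cast
      rfl
  obtain ⟨k, hk⟩ := hdnil
  refine ⟨k, ?_⟩
  have := hmain k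
  rw [hk, LinearMap.zero_apply] at this
  exact (smul_eq_zero.1 this.symm).resolve_left (Nat.cast_ne_zero.2 k.factorial_ne_zero)

/-- Z A preserves the images of the powers of A and acts on im A^k / im A^(k+1) through -(k+1) C
with C = [A, Z]. Since C is nilpotent by `isNilpotent_commutator`, so is Z A. -/
theorem trace_mul_eq_zero_of_commute_commutator {A Z : End ℂ U}
    (hA : IsNilpotent A) (hC : Commute A (A * Z - Z * A)) :
    LinearMap.trace ℂ U (Z * A) = 0 := by
  obtain ⟨n, hn⟩ := isNilpotent_commutator hA hC
  set C := A * Z - Z * A with hCdef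
  have hZA : ∀ k : ℕ, Z * A ^ k = A ^ k * Z - (k : ℂ) • (C * A ^ (k - 1)) := by
    intro k
    induction k with
    | zero => simp
    | succ k ih =>
      rw [pow_succ, ← mul_assoc, ih, sub_mul, mul_assoc (A ^ k), smul_mul_assoc, mul_assoc]
      have h1 : Z * A = A * Z - C := by rw [hCdef]; abel
      rcases Nat.eq_zero_or_pos k with rfl | hk
      · simp [h1]
      · rw [← pow_succ, Nat.sub_add_cancel hk, h1, mul_sub, ← mul_assoc, (hC.pow_left k).eq,
          Nat.add_sub_cancel]
        push_cast
        module
  have hstep : ∀ (k j : ℕ) (w : U), ∃ y,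
      ((Z * A) ^ j) ((A ^ k) w) = (A ^ k) (((-(k + 1 : ℂ)) ^ j) • (C ^ j) w) + (A ^ (k + 1)) y := by
    intro k j w
    have hZA' : ∀ (k : ℕ) (w : U), Z (A ((A ^ k) w)) = (A ^ (k + 1)) (Z w) - (k + 1 : ℂ) • (A ^ k) (C w) := by
      intro k w
      have h1 := LinearMap.congr_fun (hZA (k + 1)) w
      rw [Nat.add_sub_cancel, ← (hC.pow_left k).eq, pow_succ' A k] at h1
      rw [pow_succ' A k]
      simpa using h1
    induction j with
    | zero => exact ⟨0, by simp⟩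
    | succ j ih =>
      obtain ⟨y, hy⟩ := ih
      refine ⟨Z (((-(k + 1 : ℂ)) ^ j) • (C ^ j) w) + A (Z y) - ((k + 1 : ℕ) + 1 : ℂ) • C y, ?_⟩
      rw [pow_succ' (Z * A), End.mul_apply, hy, map_add, End.mul_apply, End.mul_apply, hZA', hZA',
        pow_succ' C, End.mul_apply, pow_succ A (k + 1), pow_succ (-(k + 1 : ℂ))]
      simp only [map_add, map_sub, map_smul, End.mul_apply]
      push_cast
      module
  have hpow : ∀ (k : ℕ) (w : U), ∃ y, ((Z * A) ^ (n * k)) w = (A ^ k) y := by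
    intro k
    induction k with
    | zero => intro w; exact ⟨w, by simp⟩
    | succ k ih =>
      intro w
      obtain ⟨y, hy⟩ := ih w
      obtain ⟨y', hy'⟩ := hstep k n y
      refine ⟨y', ?_⟩
      rw [Nat.mul_succ, add_comm, pow_add, End.mul_apply, hy, hy', hn]
      simp
  obtain ⟨k, hk⟩ := hA
  refine (LinearMap.isNilpotent_trace_of_isNilpotent ⟨n * k, ?_⟩).eq_zero
  ext w
  obtain ⟨y, hy⟩ := hpow k w
  rw [hy, hk]
  rfl

end Semisimplicity

/-! ### The Jacobson–Morozov theorem. -/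

section JacobsonMorozov

attribute [local instance] LieRing.ofAssociativeRing

open Module

variable {L : Type*} [LieRing L] [LieAlgebra ℂ L]

theorem slTwoRep_ad {e h f : L} (h1 : ⁅e, f⁆ = h) (h2 : ⁅h, e⁆ = (2 : ℂ) • e)
    (h3 : ⁅h, f⁆ = -((2 : ℂ) • f)) :
    SlTwoRep (LieAlgebra.ad ℂ L e : End ℂ L) (LieAlgebra.ad ℂ L h) (LieAlgebra.ad ℂ L f) where
  e_f := by rw [← h1, LieHom.map_lie]; rfl
  h_e := by rw [← map_smul, ← h2, LieHom.map_lie]; rfl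
  h_f := by rw [← map_smul, ← map_neg, ← h3, LieHom.map_lie]; rfl

/-- Completion of `h` and `e` to an `𝔰𝔩₂`-triple. -/
theorem exists_triple_of_lie_eq [FiniteDimensional ℂ L] {e h y : L} (he : IsNilpotent (LieAlgebra.ad ℂ L e : End ℂ L))
    (h1 : ⁅h, e⁆ = (2 : ℂ) • e) (h2 : ⁅e, y⁆ = h) :
    ∃ f : L, ⁅e, f⁆ = h ∧ ⁅h, f⁆ = -((2 : ℂ) • f) := by
  have hA : (LieAlgebra.ad ℂ L h : End ℂ L) * LieAlgebra.ad ℂ L e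
      - LieAlgebra.ad ℂ L e * LieAlgebra.ad ℂ L h = (2 : ℂ) • LieAlgebra.ad ℂ L e := by
    rw [← map_smul, ← h1, LieHom.map_lie]; rfl
  have hB : (LieAlgebra.ad ℂ L e : End ℂ L) * LieAlgebra.ad ℂ L y
      - LieAlgebra.ad ℂ L y * LieAlgebra.ad ℂ L e = LieAlgebra.ad ℂ L h := by
    rw [← h2, LieHom.map_lie]; rfl
  -- The wanted f is y - z with z in ker(ad e) and [h, z] + 2z = [h, y] + 2y. This is solvable
  -- because the weights of h on ker(ad e) are natural numbers, so ad h + 2 is invertible there.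
  let K := LinearMap.ker (LieAlgebra.ad ℂ L e : End ℂ L)
  have hK : ∀ v ∈ K, ((LieAlgebra.ad ℂ L h : End ℂ L) + (2 : ℂ) • 1) v ∈ K := by
    intro v hv
    have h3 : ⁅e, v⁆ = 0 := hv
    change ⁅e, ⁅h, v⁆ + (2 : ℂ) • v⁆ = 0
    rw [lie_add, lie_smul, h3, leibniz_lie, h3, ← lie_skew e h, h1]
    simp [h3]
  let T : End ℂ K := ((LieAlgebra.ad ℂ L h : End ℂ L) + (2 : ℂ) • 1).restrict hK
  have hinj : Function.Injective T := by
    rw [injective_iff_map_eq_zero]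
    intro v hv
    by_contra h0
    have h4 : ⁅h, (v : L)⁆ + (2 : ℂ) • (v : L) = 0 := congrArg Subtype.val hv
    obtain ⟨n, hn⟩ := exists_nat_eq_of_apply_eq_smul (v := (v : L)) (μ := -2) he hA hB v.2
      (by rw [neg_smul]; exact eq_neg_of_add_eq_zero_left h4) (fun h ↦ h0 (Subtype.ext h))
    have : ((n + 2 : ℕ) : ℂ) = 0 := by push_cast; rw [← hn]; ring
    rw [Nat.cast_eq_zero] at this
    omega
  have hz : ⁅h, y⁆ + (2 : ℂ) • y ∈ K := by
    change ⁅e, ⁅h, y⁆ + (2 : ℂ) • y⁆ = 0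
    rw [lie_add, lie_smul, leibniz_lie, h2, ← lie_skew e h, h1, neg_lie, smul_lie, h2]
    simp
  obtain ⟨z, hz'⟩ := LinearMap.injective_iff_surjective.1 hinj ⟨_, hz⟩
  have h5 : ⁅h, (z : L)⁆ + (2 : ℂ) • (z : L) = ⁅h, y⁆ + (2 : ℂ) • y := congrArg Subtype.val hz'
  have h6 : ⁅e, (z : L)⁆ = 0 := z.2
  refine ⟨y - z, by rw [lie_sub, h2, h6, sub_zero], ?_⟩
  rw [lie_sub, smul_sub, eq_sub_of_add_eq h5]
  module

/-- The Jacobson–Morozov theorem. -/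
theorem exists_triple_of_isNilpotent [FiniteDimensional ℂ L] [LieAlgebra.IsKilling ℂ L] {e : L}
    (he : IsNilpotent (LieAlgebra.ad ℂ L e : End ℂ L)) :
    ∃ f h : L, ⁅h, e⁆ = (2 : ℂ) • e ∧ ⁅h, f⁆ = -((2 : ℂ) • f) ∧ ⁅e, f⁆ = h := by
  -- If e were not in the image of (ad e)², a functional separating it would be the Killing pairing
  -- with some z. Invariance gives [e, [e, z]] = 0, so ad e commutes with [ad e, ad z], and the
  -- trace lemma gives pairing zero with e, a contradiction.
  obtain ⟨x, hx⟩ : ∃ x : L, ⁅e, ⁅e, x⁆⁆ = e := by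
    by_contra hn
    have hn' : e ∉ LinearMap.range ((LieAlgebra.ad ℂ L e : End ℂ L) ∘ₗ LieAlgebra.ad ℂ L e) := by
      rintro ⟨x, hx⟩
      exact hn ⟨x, hx⟩
    obtain ⟨l, hl, hl0⟩ := Submodule.exists_le_ker_of_notMem hn'
    obtain ⟨z, hz⟩ : ∃ z : L, ∀ x, killingForm ℂ L z x = l x := by
      have hinj : Function.Injective (killingForm ℂ L) := by
        rw [← LinearMap.ker_eq_bot]
        exact LieAlgebra.IsKilling.ker_killingForm_eq_bot ℂ L
      have := (LinearMap.injective_iff_surjective_of_finrank_eq_finrank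
        (Subspace.dual_finrank_eq (K := ℂ) (V := L)).symm).1 hinj l
      exact this.imp fun z hz x ↦ LinearMap.congr_fun hz x
    have hinv : ∀ a b : L, killingForm ℂ L a ⁅e, b⁆ = - killingForm ℂ L ⁅e, a⁆ b := by
      intro a b
      have h1 := LieModule.traceForm_apply_lie_apply ℂ L L a e b
      rw [← lie_skew e a, map_neg, LinearMap.neg_apply, neg_neg]
      exact h1.symm
    have hezz : ⁅e, ⁅e, z⁆⁆ = 0 := by
      have hker : ⁅e, ⁅e, z⁆⁆ ∈ LinearMap.ker (killingForm ℂ L) := by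
        rw [LinearMap.mem_ker]
        ext x
        have h1 : l ⁅e, ⁅e, x⁆⁆ = 0 := hl0 ⟨x, rfl⟩
        rw [← hz, hinv, hinv, neg_neg] at h1
        exact h1
      rw [LieAlgebra.IsKilling.ker_killingForm_eq_bot] at hker
      exact hker
    refine hl ?_
    rw [← hz, LieModule.traceForm_apply_apply]
    refine trace_mul_eq_zero_of_commute_commutator (A := LieAlgebra.ad ℂ L e)
      (Z := LieAlgebra.ad ℂ L z) he ?_
    have h1 : (LieAlgebra.ad ℂ L e : End ℂ L) * LieAlgebra.ad ℂ L z
        - LieAlgebra.ad ℂ L z * LieAlgebra.ad ℂ L e = LieAlgebra.ad ℂ L ⁅e, z⁆ := by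
      rw [LieHom.map_lie]; rfl
    rw [h1]
    have h2 : LieAlgebra.ad ℂ L ⁅e, ⁅e, z⁆⁆ = 0 := by rw [hezz, map_zero]
    rw [LieHom.map_lie] at h2
    exact sub_eq_zero.1 h2
  have h1 : ⁅(-2 : ℂ) • ⁅e, x⁆, e⁆ = (2 : ℂ) • e := by
    rw [smul_lie, ← lie_skew, hx]
    module
  obtain ⟨f, hf1, hf2⟩ := exists_triple_of_lie_eq (y := (-2 : ℂ) • x) he h1 (by rw [lie_smul])
  exact ⟨f, _, h1, hf2, hf1⟩

end JacobsonMorozov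

/-! ### The algebraic core: an equivariant extension yields a torsion-free representation. -/

section EquivariantExtension

set_option maxSynthPendingDepth 6

open Polynomial Module

attribute [local instance] LieRing.ofAssociativeRing

variable {L : Type*} [LieRing L] [LieAlgebra ℂ L]

/-- The centralizer of `e`, as a subspace. -/
abbrev adKer (e : L) : Submodule ℂ L := LinearMap.ker (LieAlgebra.ad ℂ L e : End ℂ L)

theorem mem_adKer {e x : L} : x ∈ adKer e ↔ ⁅e, x⁆ = 0 := Iff.rfl

/-- `Λ : 𝔤 → End (𝔤/𝔷(e))` extends the isotropy representation of `𝔷(e)` and is equivariant under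
`𝔷(e)`. -/
structure IsEquivariantExtension (e : L) (Λ : L →ₗ[ℂ] End ℂ (L ⧸ adKer e)) : Prop where
  isotropy : ∀ γ, ⁅e, γ⁆ = 0 → ∀ ξ : L, Λ γ (Submodule.Quotient.mk ξ) = Submodule.Quotient.mk ⁅γ, ξ⁆
  equivariant : ∀ γ, ⁅e, γ⁆ = 0 → ∀ ξ : L, Λ γ * Λ ξ - Λ ξ * Λ γ = Λ ⁅γ, ξ⁆

/-- The operator on the quotient induced by `ad h`, for `h` normalizing `𝔷(e)`. -/
def quotAd {e h : L} {c : ℂ} (hc : ⁅h, e⁆ = c • e) : End ℂ (L ⧸ adKer e) :=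
  (adKer e).mapQ (adKer e) (LieAlgebra.ad ℂ L h : End ℂ L) fun x hx ↦ by
    rw [mem_adKer] at hx
    change ⁅e, ⁅h, x⁆⁆ = 0
    rw [leibniz_lie, hx, lie_zero, add_zero, ← lie_skew e h, hc, neg_lie, smul_lie, hx, smul_zero,
      neg_zero]

@[simp]
theorem quotAd_mk {e h : L} {c : ℂ} (hc : ⁅h, e⁆ = c • e) (x : L) :
    quotAd hc (Submodule.Quotient.mk x) = Submodule.Quotient.mk ⁅h, x⁆ := rfl

theorem end_quot_ext {e : L} {W : Type*} [AddCommGroup W] [Module ℂ W]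
    {A B : (L ⧸ adKer e) →ₗ[ℂ] W}
    (h : ∀ x : L, A (Submodule.Quotient.mk x) = B (Submodule.Quotient.mk x)) : A = B := by
  ext x
  exact h x

/-- Lets torsion and curvature be regarded as tensors on 𝔤/𝔷(e), where the weights of the triple on
that space can be used. -/
theorem exists_bilin_quot {e : L} {W : Type*} [AddCommGroup W] [Module ℂ W] (B : L →ₗ[ℂ] L →ₗ[ℂ] W)
    (h1 : ∀ ξ η, ⁅e, ξ⁆ = 0 → B ξ η = 0) (h2 : ∀ ξ η, ⁅e, η⁆ = 0 → B ξ η = 0) :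
    ∃ B' : (L ⧸ adKer e) →ₗ[ℂ] (L ⧸ adKer e) →ₗ[ℂ] W,
      ∀ ξ η, B' (Submodule.Quotient.mk ξ) (Submodule.Quotient.mk η) = B ξ η := by
  obtain ⟨s, hs⟩ := (adKer e).mkQ.exists_rightInverse_of_surjective (Submodule.range_mkQ _)
  have hs' : ∀ ξ : L, ⁅e, s (Submodule.Quotient.mk ξ) - ξ⁆ = 0 := fun ξ ↦ by
    have := LinearMap.congr_fun hs (Submodule.Quotient.mk ξ)
    exact (Submodule.Quotient.eq (adKer e)).1 this
  refine ⟨B.compl₁₂ s s, fun ξ η ↦ ?_⟩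
  have e1 := h1 (s (Submodule.Quotient.mk ξ) - ξ) (s (Submodule.Quotient.mk η)) (hs' ξ)
  have e2 := h2 ξ (s (Submodule.Quotient.mk η) - η) (hs' η)
  rw [map_sub, LinearMap.sub_apply, sub_eq_zero] at e1
  rw [map_sub, sub_eq_zero] at e2
  rw [LinearMap.compl₁₂_apply, e1, e2]

variable [FiniteDimensional ℂ L] {e h f : L}

/-- An equivariant extension can be made invariant under the semisimple element `h`. -/
theorem IsEquivariantExtension.exists_weight_zero (hss : (LieAlgebra.ad ℂ L h : End ℂ L).IsSemisimple)
    {c : ℂ} (hc : ⁅h, e⁆ = c • e) {Λ : L →ₗ[ℂ] End ℂ (L ⧸ adKer e)}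
    (hΛ : IsEquivariantExtension e Λ) :
    ∃ Λ' : L →ₗ[ℂ] End ℂ (L ⧸ adKer e), IsEquivariantExtension e Λ' ∧
      ∀ ξ, quotAd hc * Λ' ξ - Λ' ξ * quotAd hc = Λ' ⁅h, ξ⁆ := by
  set hV := quotAd hc with hVdef
  have hVss : hV.IsSemisimple := by
    refine End.isSemisimple_of_squarefree_aeval_eq_zero hss.minpoly_squarefree ?_
    refine end_quot_ext fun x ↦ ?_
    have h1 : ∀ p : ℂ[X], aeval hV p (Submodule.Quotient.mk x)
        = Submodule.Quotient.mk (aeval (LieAlgebra.ad ℂ L h : End ℂ L) p x) := by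
      intro p
      induction p using Polynomial.induction_on' with
      | add p q hp hq => simp [hp, hq]
      | monomial k a =>
        simp only [aeval_monomial, End.mul_apply, Module.algebraMap_end_apply,
          Submodule.Quotient.mk_smul]
        congr 1
        induction k with
        | zero => simp
        | succ k ih => rw [pow_succ', End.mul_apply, pow_succ', End.mul_apply, ih]; rfl
    rw [h1, minpoly.aeval]
    rfl
  -- `δ` is the action of h on Hom(𝔤, End V). The aim is to move `Λ` into its kernel.
  let δ : End ℂ (L →ₗ[ℂ] End ℂ (L ⧸ adKer e)) :=
    homAct (LieAlgebra.ad ℂ L h : End ℂ L) (homAct hV hV)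
  have hδ : NoJordanBlocks δ := NoJordanBlocks.homAct hss
    (NoJordanBlocks.homAct hVss hVss.noJordanBlocks)
  have hδa : ∀ X ξ, δ X ξ = hV * X ξ - X ξ * hV - X ⁅h, ξ⁆ := fun X ξ ↦ rfl
  have hN : ∀ γ : L, ⁅e, γ⁆ = 0 → ⁅e, ⁅h, γ⁆⁆ = 0 := by
    intro γ hγ
    rw [leibniz_lie, hγ, lie_zero, add_zero, ← lie_skew e h, hc, neg_lie, smul_lie, hγ, smul_zero,
      neg_zero]
  have hhγ : ∀ γ, ⁅e, γ⁆ = 0 → hV * Λ γ - Λ γ * hV = Λ ⁅h, γ⁆ := by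
    intro γ hγ
    refine end_quot_ext fun x ↦ ?_
    simp only [LinearMap.sub_apply, End.mul_apply, hVdef, quotAd_mk, hΛ.isotropy γ hγ,
      hΛ.isotropy _ (hN γ hγ), ← Submodule.Quotient.mk_sub]
    rw [leibniz_lie h γ x]
    congr 1
    abel
  -- The direction space of the affine space of equivariant extensions. It contains δ Λ because the
  -- isotropy part of `Λ` is already ad h-invariant.
  let A : Submodule ℂ (L →ₗ[ℂ] End ℂ (L ⧸ adKer e)) :=
    { carrier := {a | (∀ γ, ⁅e, γ⁆ = 0 → a γ = 0) ∧
        ∀ γ, ⁅e, γ⁆ = 0 → ∀ ξ, Λ γ * a ξ - a ξ * Λ γ = a ⁅γ, ξ⁆}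
      add_mem' := by
        rintro a b ⟨ha, ha'⟩ ⟨hb, hb'⟩
        refine ⟨fun γ hγ ↦ by simp [ha γ hγ, hb γ hγ], fun γ hγ ξ ↦ ?_⟩
        rw [LinearMap.add_apply, LinearMap.add_apply, ← ha' γ hγ, ← hb' γ hγ]
        noncomm_ring
      zero_mem' := by simp
      smul_mem' := by
        rintro c a ⟨ha, ha'⟩
        refine ⟨fun γ hγ ↦ by simp [ha γ hγ], fun γ hγ ξ ↦ ?_⟩
        rw [LinearMap.smul_apply, LinearMap.smul_apply, ← ha' γ hγ]
        simp [smul_sub] }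
  -- Used with c = 0 for the elements of `A` and with c = 1 for `Λ` itself.
  have hmem : ∀ X : L →ₗ[ℂ] End ℂ (L ⧸ adKer e), (∃ c : ℂ, ∀ γ, ⁅e, γ⁆ = 0 → X γ = c • Λ γ) →
      (∀ γ, ⁅e, γ⁆ = 0 → ∀ ξ, Λ γ * X ξ - X ξ * Λ γ = X ⁅γ, ξ⁆) → δ X ∈ A := by
    rintro X ⟨c, hX⟩ hX'
    refine ⟨fun γ hγ ↦ ?_, fun γ hγ ξ ↦ ?_⟩
    · rw [hδa, hX γ hγ, hX _ (hN γ hγ), ← hhγ γ hγ, mul_smul_comm, smul_mul_assoc, smul_sub,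
        sub_self]
    · rw [hδa, hδa, leibniz_lie h γ ξ, map_add, ← hX' _ (hN γ hγ), ← hX' γ hγ, ← hX' γ hγ,
        ← hhγ γ hγ]
      noncomm_ring
  have hδA : ∀ a ∈ A, δ a ∈ A := fun a ha ↦
    hmem a ⟨0, fun γ hγ ↦ by rw [ha.1 γ hγ, zero_smul]⟩ ha.2
  let δ₀ : End ℂ A := δ.restrict hδA
  -- Without a Jordan block at 0 the operators δ₀ and δ₀² have equal range, so δ²Λ = δ²a for some a
  -- in `A`. The same property gives δ(Λ - a) = 0, and Λ - a is the corrected extension.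
  have hrange : LinearMap.range (δ₀ * δ₀) = LinearMap.range δ₀ := by
    have hker : LinearMap.ker (δ₀ * δ₀) = LinearMap.ker δ₀ := by
      refine le_antisymm (fun a ha ↦ ?_) (fun a ha ↦ ?_)
      · rw [LinearMap.mem_ker] at ha ⊢
        refine Subtype.ext (hδ 0 (a : L →ₗ[ℂ] End ℂ (L ⧸ adKer e)) _ ?_ ?_)
        · rw [zero_smul, sub_zero]; rfl
        · rw [zero_smul]; exact congrArg Subtype.val ha
      · rw [LinearMap.mem_ker] at ha ⊢
        rw [End.mul_apply, ha, map_zero]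
    refine Submodule.eq_of_le_of_finrank_eq ?_ ?_
    · rintro _ ⟨a, rfl⟩
      exact ⟨δ₀ a, rfl⟩
    · have h1 := LinearMap.finrank_range_add_finrank_ker δ₀
      have h2 := LinearMap.finrank_range_add_finrank_ker (δ₀ * δ₀)
      rw [hker] at h2
      omega
  have hδΛ : δ Λ ∈ A := hmem Λ ⟨1, fun γ _ ↦ (one_smul _ _).symm⟩ hΛ.equivariant
  obtain ⟨a, ha⟩ : δ₀ ⟨δ Λ, hδΛ⟩ ∈ LinearMap.range (δ₀ * δ₀) := by rw [hrange]; exact ⟨_, rfl⟩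
  have ha' : δ (δ (a : L →ₗ[ℂ] End ℂ (L ⧸ adKer e))) = δ (δ Λ) := congrArg Subtype.val ha
  have hzero : δ (Λ - a) = 0 := by
    refine hδ 0 (Λ - a) _ (by rw [zero_smul, sub_zero]) ?_
    rw [map_sub, map_sub, ha', sub_self, zero_smul]
  refine ⟨Λ - a, ⟨fun γ hγ ξ ↦ ?_, fun γ hγ ξ ↦ ?_⟩, fun ξ ↦ ?_⟩
  · rw [LinearMap.sub_apply, a.2.1 γ hγ, sub_zero, hΛ.isotropy γ hγ]
  · simp only [LinearMap.sub_apply, a.2.1 γ hγ, sub_zero]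
    rw [← hΛ.equivariant γ hγ, ← a.2.2 γ hγ]
    noncomm_ring
  · have := LinearMap.congr_fun hzero ξ
    rw [hδa, LinearMap.zero_apply, sub_eq_zero] at this
    exact this

variable {Λ : L →ₗ[ℂ] End ℂ (L ⧸ adKer e)}

/-- For a weight zero equivariant extension, `Λ_h` is `ad h + 1`, and is part of an
`𝔰𝔩₂`-triple. -/
theorem IsEquivariantExtension.apply_h (hΛ : IsEquivariantExtension e Λ) (hef : ⁅e, f⁆ = h)
    (hhe : ⁅h, e⁆ = (2 : ℂ) • e) (hhf : ⁅h, f⁆ = -((2 : ℂ) • f))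
    (hw : ∀ ξ, quotAd hhe * Λ ξ - Λ ξ * quotAd hhe = Λ ⁅h, ξ⁆) :
    Λ h = quotAd hhe + 1 ∧ ∃ F, SlTwoRep (Λ e) (Λ h) F := by
  have t := slTwoRep_ad hef hhe hhf
  set hV := quotAd hhe with hVdef
  have heV : ∀ ξ : L, Λ e (Submodule.Quotient.mk ξ) = Submodule.Quotient.mk ⁅e, ξ⁆ :=
    hΛ.isotropy e (lie_self e)
  have hHe : Λ h * Λ e - Λ e * Λ h = (2 : ℂ) • Λ e := by
    rw [← map_smul, ← hhe, ← lie_skew, map_neg, ← hΛ.equivariant e (lie_self e)]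
    abel
  -- The operator `Λ f` satisfies [Λ_e, Λ_f] = Λ_h by equivariance; the weight relation with Λ_h
  -- need not hold, so `F` replaces it, by the completion lemma in the Lie algebra End V.
  obtain ⟨F, hF1, hF2⟩ : ∃ F : End ℂ (L ⧸ adKer e), ⁅Λ e, F⁆ = Λ h ∧ ⁅Λ h, F⁆ = -((2 : ℂ) • F) := by
    refine exists_triple_of_lie_eq (y := Λ f)
      (LieAlgebra.ad_nilpotent_of_nilpotent (isNilpotent_of_commutator_eq_smul two_ne_zero hHe))
      hHe ?_
    rw [← hef]
    exact hΛ.equivariant e (lie_self e) f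
  have tV : SlTwoRep (Λ e) (Λ h) F := ⟨hF1, hHe, hF2⟩
  refine ⟨?_, F, tV⟩
  set D := Λ h - hV with hD
  have hHD : Λ h = hV + D := by rw [hD]; abel
  have hVe : hV * Λ e - Λ e * hV = (2 : ℂ) • Λ e := by rw [hw, hhe, map_smul]
  have hDh : Commute D hV := by
    have := hw h
    rw [lie_self, map_zero, sub_eq_zero] at this
    exact Commute.sub_left this.symm (Commute.refl _)
  have hDe : Commute D (Λ e) := by
    have : D * Λ e - Λ e * D = 0 := by
      rw [hD, sub_mul, mul_sub]
      have h1 := hHe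
      rw [← hVe] at h1
      calc Λ h * Λ e - hV * Λ e - (Λ e * Λ h - Λ e * hV)
          = (Λ h * Λ e - Λ e * Λ h) - (hV * Λ e - Λ e * hV) := by abel
        _ = 0 := by rw [h1, sub_self]
    exact sub_eq_zero.1 this
  let π : L →ₗ[ℂ] L ⧸ adKer e := (adKer e).mkQ
  have hπ : ∀ x, π x = Submodule.Quotient.mk x := fun x ↦ rfl
  have hπh : ∀ x, π ⁅h, x⁆ = hV (π x) := fun x ↦ rfl
  have hπe : ∀ x, π ⁅e, x⁆ = Λ e (π x) := fun x ↦ (heV x).symm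
  have hcancel : ∀ Q : End ℂ (L ⧸ adKer e), Q ∘ₗ π = 0 → Q = 0 := fun Q hQ ↦
    end_quot_ext fun x ↦ LinearMap.congr_fun hQ x
  have hcomm : ∀ (p : ℂ[X]) (B : End ℂ (L ⧸ adKer e)), Commute D B → Commute (aeval D p) B := by
    intro p B hB
    induction p using Polynomial.induction_on' with
    | add p q hp hq => rw [map_add]; exact hp.add_left hq
    | monomial k a =>
      rw [aeval_monomial]
      exact (Algebra.commute_algebraMap_left a B).mul_left (hB.pow_left k)
  have hactπ : ∀ Q, Commute Q hV →
      homAct (LieAlgebra.ad ℂ L h : End ℂ L) (Λ h) (Q ∘ₗ π) = (D * Q) ∘ₗ π := by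
    intro Q hQ
    ext x
    have h1 := LinearMap.congr_fun hQ.eq (π x)
    simp only [End.mul_apply] at h1
    change Λ h (Q (π x)) - Q (π ⁅h, x⁆) = D (Q (π x))
    rw [hπh, h1, hHD, LinearMap.add_apply]
    abel
  have hactπe : ∀ Q, Commute Q (Λ e) →
      homAct (LieAlgebra.ad ℂ L e : End ℂ L) (Λ e) (Q ∘ₗ π) = 0 := by
    intro Q hQ
    ext x
    have h1 := LinearMap.congr_fun hQ.eq (π x)
    simp only [End.mul_apply] at h1
    change Λ e (Q (π x)) - Q (π ⁅e, x⁆) = 0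
    rw [hπe, h1, sub_self]
  -- The projection `π` is killed by e in Hom(𝔤, V), and h acts on it as composition with `D`. Its
  -- weights are natural numbers, so `D` is diagonalizable with eigenvalues in ℕ.
  obtain ⟨N, hN⟩ : ∃ N, aeval D (fallingPoly N) = 0 := by
    have tH := t.hom tV
    obtain ⟨N, hN⟩ := exists_fallingPoly_apply_eq_zero tH.isNilpotent_e tH.h_e tH.e_f
    refine ⟨N, hcancel _ ?_⟩
    have hp : ∀ p : ℂ[X], aeval (homAct (LieAlgebra.ad ℂ L h : End ℂ L) (Λ h)) p π
        = (aeval D p) ∘ₗ π := by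
      intro p
      induction p using Polynomial.induction_on' with
      | add p q hp hq => rw [map_add, LinearMap.add_apply, hp, hq, map_add, LinearMap.add_comp]
      | monomial k a =>
        have hk : ((homAct (LieAlgebra.ad ℂ L h : End ℂ L) (Λ h)) ^ k) π = (D ^ k) ∘ₗ π := by
          induction k with
          | zero => rfl
          | succ k ih =>
            rw [pow_succ', End.mul_apply, ih, hactπ _ (hDh.pow_left k), ← pow_succ']
        rw [aeval_monomial, aeval_monomial, End.mul_apply, hk]
        ext x
        simp
    rw [← hp]
    exact hN π (hactπe 1 (Commute.one_left _))
  -- the factors other than `D - 1` can be removed one by one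
  let ι : (L ⧸ adKer e) →ₗ[ℂ] L := (adKer e).liftQ (LieAlgebra.ad ℂ L e : End ℂ L) le_rfl
  have hι : ∀ x, ι (Submodule.Quotient.mk x) = ⁅e, x⁆ := fun x ↦ rfl
  have hιinj : ∀ v, ι v = 0 → v = 0 := by
    intro v hv
    obtain ⟨x, rfl⟩ := Submodule.Quotient.mk_surjective _ v
    exact (Submodule.Quotient.mk_eq_zero _).2 hv
  have hιh : ∀ v, ⁅h, ι v⁆ = ι (hV v) + (2 : ℂ) • ι v := by
    intro v
    obtain ⟨x, rfl⟩ := Submodule.Quotient.mk_surjective _ v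
    rw [hVdef, quotAd_mk, hι, hι, leibniz_lie, hhe, smul_lie]
    abel
  have hιe : ∀ v, ⁅e, ι v⁆ = ι (Λ e v) := by
    intro v
    obtain ⟨x, rfl⟩ := Submodule.Quotient.mk_surjective _ v
    rw [heV, hι, hι]
  -- `Q` has image in the a-eigenspace of `D`. For a = 0, Q ∘ π is a module map 𝔤 → V killing ker(ad
  -- e). For a ≥ 2, ι ∘ Q : V → 𝔤 is killed by e and has weight 2 - a: negative if a ≥ 3, while a =
  -- 2 gives a module map with image in that of ad e.
  have hremove : ∀ (a : ℕ) (Q : End ℂ (L ⧸ adKer e)), a ≠ 1 → Commute Q hV → Commute Q (Λ e) →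
      Commute Q D → D * Q = (a : ℂ) • Q → Q = 0 := by
    intro a Q ha hQh hQe hQD hDQ
    rcases Nat.eq_zero_or_pos a with rfl | hpos
    · refine hcancel Q (t.eq_zero_of_ker_le tV (hactπe Q hQe) ?_ ?_)
      · rw [hactπ Q hQh, hDQ]
        simp
      · intro u hu
        rw [LinearMap.comp_apply, hπ, (Submodule.Quotient.mk_eq_zero _).2 hu, map_zero]
    · have hE : homAct (Λ e) (LieAlgebra.ad ℂ L e : End ℂ L) (ι ∘ₗ Q) = 0 := by
        refine LinearMap.ext fun v ↦ ?_
        have h1 := LinearMap.congr_fun hQe.eq v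
        simp only [End.mul_apply] at h1
        change ⁅e, ι (Q v)⁆ - ι (Q (Λ e v)) = 0
        rw [hιe, h1, sub_self]
      have hH : homAct (Λ h) (LieAlgebra.ad ℂ L h : End ℂ L) (ι ∘ₗ Q)
          = (2 - a : ℂ) • (ι ∘ₗ Q) := by
        refine LinearMap.ext fun v ↦ ?_
        have h1 := LinearMap.congr_fun hQh.eq v
        have h2 := LinearMap.congr_fun hQD.eq v
        have h3 := LinearMap.congr_fun hDQ v
        simp only [End.mul_apply, LinearMap.smul_apply] at h1 h2 h3
        change ⁅h, ι (Q v)⁆ - ι (Q (Λ h v)) = (2 - a : ℂ) • ι (Q v)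
        rw [hιh, hHD, LinearMap.add_apply, map_add, h1, h2, h3, map_add, map_smul]
        module
      have h0 : ι ∘ₗ Q = 0 := by
        obtain rfl | h3 : a = 2 ∨ 3 ≤ a := by omega
        · refine tV.eq_zero_of_le_range t hE (by rw [hH]; simp) fun v ↦ ?_
          obtain ⟨x, hx⟩ := Submodule.Quotient.mk_surjective _ (Q v)
          exact ⟨x, by rw [LinearMap.comp_apply, ← hx]; rfl⟩
        · refine (tV.hom t).eq_zero_of_neg (n := a - 2) (by omega) hE ?_
          rw [hH, Nat.cast_sub (by omega)]
          push_cast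
          congr 1
          ring
      refine LinearMap.ext fun v ↦ ?_
      exact hιinj _ (LinearMap.congr_fun h0 v)
  have hfinal : ∀ S : Finset ℕ, 1 ∉ S →
      aeval D ((X - C 1) * ∏ j ∈ S, (X - C (j : ℂ))) = 0 → D - 1 = 0 := by
    intro S
    induction S using Finset.induction_on with
    | empty => intro _ h0; simpa using h0
    | insert a S haS ih =>
      intro h1 h0
      refine ih (fun h ↦ h1 (Finset.mem_insert_of_mem h)) ?_
      refine hremove a _ (fun h ↦ h1 (h ▸ Finset.mem_insert_self a S)) (hcomm _ _ hDh)
        (hcomm _ _ hDe) (hcomm _ _ (Commute.refl D)) ?_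
      rw [Finset.prod_insert haS, mul_left_comm, map_mul, map_sub, aeval_X, aeval_C, sub_mul,
        sub_eq_zero] at h0
      rw [h0, Algebra.algebraMap_eq_smul_one, smul_mul_assoc, one_mul]
  have hD1 : D - 1 = 0 := by
    refine hfinal ((Finset.range N).erase 1) (Finset.notMem_erase _ _) ?_
    obtain ⟨q, hq⟩ : fallingPoly N ∣ (X - C 1) * ∏ j ∈ (Finset.range N).erase 1, (X - C (j : ℂ)) := by
      by_cases h1 : 1 ∈ Finset.range N
      · rw [fallingPoly, ← Finset.mul_prod_erase _ _ h1, Nat.cast_one]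
      · rw [fallingPoly, Finset.erase_eq_of_notMem h1]
        exact dvd_mul_left _ _
    rw [hq, map_mul, hN, zero_mul]
  rw [hHD, sub_eq_zero.1 hD1]

/-- If the isotropy representation of the centralizer of `e` has an equivariant extension, then it
extends to a representation of the whole Lie algebra without torsion. -/
theorem IsEquivariantExtension.exists_representation (hΛ : IsEquivariantExtension e Λ)
    (hef : ⁅e, f⁆ = h) (hhe : ⁅h, e⁆ = (2 : ℂ) • e) (hhf : ⁅h, f⁆ = -((2 : ℂ) • f)) :
    ∃ Γ : L →ₗ[ℂ] End ℂ (L ⧸ adKer e),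
      (∀ ξ η, Γ ⁅ξ, η⁆ = Γ ξ * Γ η - Γ η * Γ ξ) ∧
      (∀ ξ η, Γ ξ (Submodule.Quotient.mk η) - Γ η (Submodule.Quotient.mk ξ)
        = Submodule.Quotient.mk ⁅ξ, η⁆) ∧
      ∀ ξ, Γ ξ (Submodule.Quotient.mk h) = Submodule.Quotient.mk ξ := by
  have t := slTwoRep_ad hef hhe hhf
  obtain ⟨Γ, hΓ, hw⟩ := hΛ.exists_weight_zero t.isSemisimple_h hhe
  obtain ⟨hh, F, tV⟩ := hΓ.apply_h hef hhe hhf hw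
  have hantisymm : ∀ η, ⁅e, η⁆ = 0 → ∀ ξ : L,
      Submodule.Quotient.mk (p := adKer e) ⁅ξ, η⁆ = -Γ η (Submodule.Quotient.mk ξ) := by
    intro η hη ξ
    rw [hΓ.isotropy η hη, ← lie_skew, Submodule.Quotient.mk_neg]
  -- torsion
  let T₀ : L →ₗ[ℂ] L →ₗ[ℂ] (L ⧸ adKer e) := LinearMap.mk₂ ℂ
    (fun ξ η ↦ Γ ξ (Submodule.Quotient.mk η) - Γ η (Submodule.Quotient.mk ξ)
      - Submodule.Quotient.mk ⁅ξ, η⁆)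
    (fun a b c ↦ by simp; abel) (fun a b c ↦ by simp [smul_sub])
    (fun a b c ↦ by simp; abel) (fun a b c ↦ by simp [smul_sub])
  have hT₀ : ∀ ξ η, T₀ ξ η = Γ ξ (Submodule.Quotient.mk η) - Γ η (Submodule.Quotient.mk ξ)
      - Submodule.Quotient.mk ⁅ξ, η⁆ := fun _ _ ↦ rfl
  have hmk0 : ∀ ξ, ⁅e, ξ⁆ = 0 → Submodule.Quotient.mk (p := adKer e) ξ = 0 := fun ξ hξ ↦
    (Submodule.Quotient.mk_eq_zero _).2 hξ
  obtain ⟨T, hT⟩ := exists_bilin_quot (e := e) T₀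
    (fun ξ η hξ ↦ by rw [hT₀, hmk0 ξ hξ, hΓ.isotropy ξ hξ, map_zero, sub_zero, sub_self])
    (fun ξ η hη ↦ by rw [hT₀, hmk0 η hη, hantisymm η hη ξ, map_zero]; abel)
  have hTx : ∀ (x : L) (xV : End ℂ (L ⧸ adKer e)),
      (∀ ξ : L, xV (Submodule.Quotient.mk ξ) = Submodule.Quotient.mk ⁅x, ξ⁆) →
      (∀ ξ, xV * Γ ξ - Γ ξ * xV = Γ ⁅x, ξ⁆) → ∀ ξ η, xV (T₀ ξ η) = T₀ ⁅x, ξ⁆ η + T₀ ξ ⁅x, η⁆ := by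
    intro x xV h1 h2 ξ η
    have h3 : ∀ ξ η : L, xV (Γ ξ (Submodule.Quotient.mk η))
        = Γ ⁅x, ξ⁆ (Submodule.Quotient.mk η) + Γ ξ (Submodule.Quotient.mk ⁅x, η⁆) := by
      intro ξ η
      rw [← h2, ← h1]
      simp
    rw [hT₀, hT₀, hT₀, map_sub, map_sub, h3, h3, h1, leibniz_lie, Submodule.Quotient.mk_add]
    abel
  -- Invariance under ad h and Λ_h = ad h + 1 give `T` in Hom(V, Hom(V, V)) the weight 1 - 1 - 1 =
  -- -1; equivariance under e makes it a vector killed by e.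
  have hT0 : T = 0 := by
    refine (tV.hom (tV.hom tV)).eq_zero_of_neg (n := 1) one_ne_zero ?_ ?_
    · refine end_quot_ext fun ξ ↦ end_quot_ext fun η ↦ ?_
      simp only [homAct_apply_apply, LinearMap.sub_apply, hΓ.isotropy e (lie_self e), hT]
      rw [hTx e (Γ e) (hΓ.isotropy e (lie_self e)) (hΓ.equivariant e (lie_self e))]
      simp
    · refine end_quot_ext fun ξ ↦ end_quot_ext fun η ↦ ?_
      simp only [hh, homAct_apply_apply, LinearMap.sub_apply, LinearMap.add_apply, End.one_apply,
        map_add, quotAd_mk, hT, LinearMap.smul_apply]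
      rw [hTx h (quotAd hhe) (fun _ ↦ rfl) hw]
      push_cast
      module
  have htors : ∀ ξ η : L, Γ ξ (Submodule.Quotient.mk η) - Γ η (Submodule.Quotient.mk ξ)
        = Submodule.Quotient.mk ⁅ξ, η⁆ := by
    intro ξ η
    have := hT ξ η
    rw [hT0, hT₀] at this
    exact (sub_eq_zero.1 this.symm)
  -- curvature
  let R₀ : L →ₗ[ℂ] L →ₗ[ℂ] End ℂ (L ⧸ adKer e) := LinearMap.mk₂ ℂ
    (fun ξ η ↦ Γ ξ * Γ η - Γ η * Γ ξ - Γ ⁅ξ, η⁆)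
    (fun a b c ↦ by simp only [map_add, add_lie]; noncomm_ring)
    (fun a b c ↦ by simp [smul_sub])
    (fun a b c ↦ by simp only [map_add, lie_add]; noncomm_ring)
    (fun a b c ↦ by simp [smul_sub])
  have hR₀ : ∀ ξ η, R₀ ξ η = Γ ξ * Γ η - Γ η * Γ ξ - Γ ⁅ξ, η⁆ := fun _ _ ↦ rfl
  obtain ⟨R, hR⟩ := exists_bilin_quot (e := e) R₀
    (fun ξ η hξ ↦ by rw [hR₀, hΓ.equivariant ξ hξ, sub_self])
    (fun ξ η hη ↦ by
      rw [hR₀, ← lie_skew, map_neg, ← hΓ.equivariant η hη]; abel)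
  have hRx : ∀ (x : L) (xV : End ℂ (L ⧸ adKer e)),
      (∀ ξ, xV * Γ ξ - Γ ξ * xV = Γ ⁅x, ξ⁆) →
      ∀ ξ η, xV * R₀ ξ η - R₀ ξ η * xV = R₀ ⁅x, ξ⁆ η + R₀ ξ ⁅x, η⁆ := by
    intro x xV h2 ξ η
    rw [hR₀, hR₀, hR₀]
    have h3 : Γ ⁅⁅x, ξ⁆, η⁆ + Γ ⁅ξ, ⁅x, η⁆⁆ = xV * Γ ⁅ξ, η⁆ - Γ ⁅ξ, η⁆ * xV := by
      rw [h2, leibniz_lie x ξ η, map_add]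
    calc xV * (Γ ξ * Γ η - Γ η * Γ ξ - Γ ⁅ξ, η⁆) - (Γ ξ * Γ η - Γ η * Γ ξ - Γ ⁅ξ, η⁆) * xV
        = (xV * Γ ξ - Γ ξ * xV) * Γ η - Γ η * (xV * Γ ξ - Γ ξ * xV)
          + (Γ ξ * (xV * Γ η - Γ η * xV) - (xV * Γ η - Γ η * xV) * Γ ξ)
          - (xV * Γ ⁅ξ, η⁆ - Γ ⁅ξ, η⁆ * xV) := by
          simp only [mul_sub, sub_mul, mul_assoc]
          abel
      _ = _ := by
        rw [h2, h2, ← h3]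
        abel
  -- With one more argument the weight is 1 - 1 - 1 - 1 = -2.
  have hR0 : R = 0 := by
    refine (tV.hom (tV.hom (tV.hom tV))).eq_zero_of_neg (n := 2) two_ne_zero ?_ ?_
    · refine end_quot_ext fun ξ ↦ end_quot_ext fun η ↦ ?_
      have h1 := hRx e (Γ e) (hΓ.equivariant e (lie_self e)) ξ η
      have h2 : homAct (Γ e) (Γ e) (R₀ ξ η) = R₀ ⁅e, ξ⁆ η + R₀ ξ ⁅e, η⁆ := h1
      simp only [homAct_apply_apply, LinearMap.sub_apply, hΓ.isotropy e (lie_self e), hR, h2]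
      simp
    · refine end_quot_ext fun ξ ↦ end_quot_ext fun η ↦ ?_
      have h1 := hRx h (quotAd hhe) hw ξ η
      have h2 : homAct (quotAd hhe + 1) (quotAd hhe + 1) (R₀ ξ η) = R₀ ⁅h, ξ⁆ η + R₀ ξ ⁅h, η⁆ := by
        rw [← h1]
        change (quotAd hhe + 1) * R₀ ξ η - R₀ ξ η * (quotAd hhe + 1) = _
        noncomm_ring
      simp only [hh, homAct_apply_apply (quotAd hhe + 1) (homAct _ _), LinearMap.sub_apply,
        LinearMap.add_apply, End.one_apply, map_add, quotAd_mk, hR, LinearMap.smul_apply, h2]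
      push_cast
      module
  refine ⟨Γ, fun ξ η ↦ ?_, htors, fun ξ ↦ ?_⟩
  · have := hR ξ η
    rw [hR0, hR₀] at this
    exact (sub_eq_zero.1 this.symm).symm
  -- Zero torsion on ξ and h: Γ_ξ h̄ is the class of ([h, ξ] + ξ) + [ξ, h].
  · rw [sub_eq_iff_eq_add.1 (htors ξ h), hh, LinearMap.add_apply, quotAd_mk, End.one_apply,
      ← add_assoc, ← Submodule.Quotient.mk_add, ← lie_skew, neg_add_cancel, Submodule.Quotient.mk_zero,
      zero_add]

end EquivariantExtension

/-! ### Exponentials of operators and their derivative along a Lie algebra. -/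

section Exponential

open NormedSpace

variable {A : Type*} [NormedRing A] [NormedAlgebra ℂ A] [CompleteSpace A]

theorem exp_add_of_commute' {x y : A} (h : Commute x y) : exp (x + y) = exp x * exp y :=
  letI := NormedAlgebra.restrictScalars ℚ ℂ A
  exp_add_of_commute h

theorem exp_mul_exp_neg (x : A) : exp x * exp (-x) = 1 := by
  rw [← exp_add_of_commute' (Commute.neg_right (Commute.refl x)), add_neg_cancel, exp_zero]

theorem exp_neg_mul_exp (x : A) : exp (-x) * exp x = 1 := by
  rw [← exp_add_of_commute' (Commute.neg_left (Commute.refl x)), neg_add_cancel, exp_zero]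

theorem contDiff_exp {n : WithTop ℕ∞} : ContDiff ℂ n (exp : A → A) :=
  contDiff_iff_contDiffAt.2 fun x ↦ (exp_analytic x).contDiffAt

theorem hasDerivAt_exp_neg_smul (x : A) (t : ℂ) :
    HasDerivAt (fun u : ℂ ↦ exp (-(u • x))) (-(exp (-(t • x)) * x)) t := by
  have h := (hasDerivAt_exp_smul_const (-x) t)
  simpa only [smul_neg, mul_neg] using h

theorem eq_of_hasDerivAt_zero {W : Type*} [NormedAddCommGroup W] [NormedSpace ℂ W] {f : ℂ → W}
    (hf : ∀ t, HasDerivAt f 0 t) (s t : ℂ) : f s = f t :=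
  is_const_of_deriv_eq_zero (fun t ↦ (hf t).differentiableAt) (fun t ↦ (hf t).deriv) s t

/-- A point at which the operator `exp a` is stationary is killed by `a`, if `a` is small. -/
theorem eventually_apply_eq_zero_of_exp_apply_eq {W : Type*} [NormedAddCommGroup W]
    [NormedSpace ℂ W] [CompleteSpace W] :
    ∀ᶠ a : W →L[ℂ] W in 𝓝 0, ∀ v, exp a v = v → a v = 0 := by
  have hc : ∀ᶠ a : W →L[ℂ] W in 𝓝 0, ‖exp a - 1‖ < 1 / 2 := by
    have h : ContinuousAt (fun a : W →L[ℂ] W ↦ ‖exp a - 1‖) 0 :=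
      ((contDiff_exp (n := 0)).continuous.sub continuous_const).norm.continuousAt
    refine h.eventually_lt continuousAt_const ?_
    rw [exp_zero, sub_self, norm_zero]
    norm_num
  obtain ⟨ε, hε, hball⟩ := Metric.eventually_nhds_iff_ball.1 hc
  refine Metric.eventually_nhds_iff_ball.2 ⟨ε, hε, fun a ha v hv ↦ ?_⟩
  -- For small `a` the derivative (exp(ta) - 1)(a v) has norm at most ‖a v‖/2 on the unit disc. The
  -- mean value inequality from 0 to 1, with exp(a) v = v, gives ‖a v‖ ≤ ‖a v‖/2.
  have hd : ∀ t : ℂ, HasDerivAt (fun t : ℂ ↦ exp (t • a) v - t • a v)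
      (exp (t • a) (a v) - a v) t := by
    intro t
    have h1 := ((hasDerivAt_exp_smul_const a t).clm_apply (hasDerivAt_const t v))
    have h2 := (hasDerivAt_id t).smul_const (a v)
    simpa using h1.fun_sub h2
  have hb : ∀ t ∈ Metric.closedBall (0 : ℂ) 1, ‖exp (t • a) (a v) - a v‖ ≤ 1 / 2 * ‖a v‖ := by
    intro t ht
    have hta : t • a ∈ Metric.ball (0 : W →L[ℂ] W) ε := by
      rw [mem_ball_zero_iff] at ha ⊢
      rw [mem_closedBall_zero_iff] at ht
      rw [norm_smul]
      nlinarith [norm_nonneg a, norm_nonneg t]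
    calc ‖exp (t • a) (a v) - a v‖ = ‖(exp (t • a) - 1) (a v)‖ := by simp
      _ ≤ ‖exp (t • a) - 1‖ * ‖a v‖ := ContinuousLinearMap.le_opNorm _ _
      _ ≤ 1 / 2 * ‖a v‖ := by gcongr; exact (hball _ hta).le
  have := (convex_closedBall (0 : ℂ) 1).norm_image_sub_le_of_norm_hasDerivWithin_le
    (fun t _ ↦ (hd t).hasDerivWithinAt) hb (x := 0) (y := 1) (by simp) (by simp)
  simp only [one_smul, hv, zero_smul, exp_zero] at this
  simp only [one_apply_eq_self, sub_zero, sub_sub_cancel_left, norm_neg, norm_one,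
    mul_one] at this
  exact norm_eq_zero.1 (by linarith [norm_nonneg (a v)])

variable {E : Type*} [NormedAddCommGroup E] [NormedSpace ℂ E] [CompleteSpace E]
  {ad : E →L[ℂ] E →L[ℂ] E} {R : E →L[ℂ] A}

/-- The curve exp(-t R x) R(exp(t ad x) y) exp(t R x) has derivative zero. For R = ad it shows that
exp(ad x) is an automorphism. -/
theorem exp_mul_apply (hR : ∀ x y, R (ad x y) = R x * R y - R y * R x) (x y : E) :
    exp (R x) * R y = R (exp (ad x) y) * exp (R x) := by
  have hd : ∀ t : ℂ, HasDerivAt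
      (fun t : ℂ ↦ exp (-(t • R x)) * R (exp (t • ad x) y) * exp (t • R x)) 0 t := by
    intro t
    have h1 := hasDerivAt_exp_neg_smul (R x) t
    have h2 : HasDerivAt (fun t : ℂ ↦ R (exp (t • ad x) y)) (R (ad x (exp (t • ad x) y))) t := by
      have := (hasDerivAt_exp_smul_const' (ad x) t).clm_apply (hasDerivAt_const t y)
      simpa [Function.comp_def] using R.hasFDerivAt.comp_hasDerivAt t this
    have h3 := hasDerivAt_exp_smul_const' (R x) t
    refine ((h1.fun_mul h2).fun_mul h3).congr_deriv ?_
    rw [hR]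
    noncomm_ring
  have h := eq_of_hasDerivAt_zero hd 1 0
  simp only [one_smul, zero_smul, neg_zero, exp_zero, one_mul, mul_one,
    one_apply_eq_self] at h
  rw [← h, ← mul_assoc, ← mul_assoc, exp_mul_exp_neg, one_mul]

theorem exp_ad_apply_ad (hJ : ∀ x y, ad (ad x y) = ad x * ad y - ad y * ad x) (x y z : E) :
    exp (ad x) (ad y z) = ad (exp (ad x) y) (exp (ad x) z) :=
  congrArg (fun T : E →L[ℂ] E ↦ T z) (exp_mul_apply (R := ad) hJ x y)

/-- The right logarithmic derivative of `exp` at `X` in the direction `Y`, along the ray through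
`X`. -/
theorem hasDerivAt_fderiv_exp_mul (X Y : A) (s : ℂ) :
    HasDerivAt (fun s : ℂ ↦ fderiv ℂ exp (s • X) (s • Y) * exp (-(s • X)))
      (exp (s • X) * Y * exp (-(s • X))) s := by
  have hexp : ContDiff ℂ 2 (exp : A → A) := contDiff_exp
  have hdiff : ∀ Z : A, HasFDerivAt exp (fderiv ℂ exp Z) Z := fun Z ↦
    (hexp.differentiable two_ne_zero Z).hasFDerivAt
  let D : ℂ → A := fun s ↦ fderiv ℂ exp (s • X) (s • Y)
  -- Differentiating exp((s+t)Z) = exp(sZ) exp(tZ) at Z = X in the direction Y gives a cocycle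
  -- identity, which reduces the derivative of `D` at s to that at 0.
  have hadd : ∀ s t, D (s + t) = D s * exp (t • X) + exp (s • X) * D t := by
    intro s t
    have hline : ∀ r : ℂ, HasDerivAt (fun ε : ℂ ↦ exp (r • (X + ε • Y))) (D r) 0 := by
      intro r
      have h1 : HasDerivAt (fun ε : ℂ ↦ r • (X + ε • Y)) (r • Y) 0 := by
        simpa using! (((hasDerivAt_id (0 : ℂ)).smul_const Y).const_add X).fun_const_smul r
      have h2 := (hdiff (r • (X + (0 : ℂ) • Y))).comp_hasDerivAt (0 : ℂ) h1
      simpa [D, Function.comp_def] using h2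
    have h1 := (hline s).mul (hline t)
    simp only [zero_smul, add_zero] at h1
    refine (hline (s + t)).unique (h1.congr_of_eventuallyEq (.of_forall fun ε ↦ ?_))
    change exp ((s + t) • (X + ε • Y)) = exp (s • (X + ε • Y)) * exp (t • (X + ε • Y))
    rw [add_smul, exp_add_of_commute']
    exact ((Commute.refl _).smul_left s).smul_right t
  have hD0 : D 0 = 0 := by simp [D]
  have hD' : HasDerivAt D Y 0 := by
    have h1 : HasDerivAt (fun s : ℂ ↦ fderiv ℂ exp (s • X))
        (fderiv ℂ (fderiv ℂ (exp : A → A)) 0 X) 0 := by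
      have hd2 : Differentiable ℂ (fderiv ℂ (exp : A → A)) :=
        (hexp.fderiv_right (m := 1) (by norm_num)).differentiable one_ne_zero
      have h2 : HasDerivAt (fun s : ℂ ↦ s • X) X 0 := by
        simpa using (hasDerivAt_id (0 : ℂ)).smul_const X
      have h3 := (hd2 ((0 : ℂ) • X)).hasFDerivAt.comp_hasDerivAt (0 : ℂ) h2
      simpa [Function.comp_def] using h3
    have h2 : HasDerivAt (fun s : ℂ ↦ s • Y) Y 0 := by
      simpa using (hasDerivAt_id (0 : ℂ)).smul_const Y
    have h4 : fderiv ℂ (exp : A → A) 0 = 1 := hasFDerivAt_exp_zero.fderiv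
    simpa [h4, D] using h1.clm_apply h2
  have hDs : HasDerivAt D (D s * X + exp (s • X) * Y) s := by
    have h1 : HasDerivAt (fun t : ℂ ↦ D s * exp (t • X) + exp (s • X) * D t)
        (D s * X + exp (s • X) * Y) 0 := by
      have h2 := hasDerivAt_exp_smul_const X (0 : ℂ)
      rw [zero_smul, exp_zero, one_mul] at h2
      exact (h2.const_mul _).add (hD'.const_mul _)
    have h3 : HasDerivAt (fun t : ℂ ↦ D (s + t)) (D s * X + exp (s • X) * Y) 0 :=
      h1.congr_of_eventuallyEq (.of_forall fun t ↦ hadd s t)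
    have h4 := HasDerivAt.comp_sub_const s s (f := fun t : ℂ ↦ D (s + t)) (by rwa [sub_self])
    simpa using h4
  refine (hDs.fun_mul (hasDerivAt_exp_neg_smul X s)).congr_deriv ?_
  have hc : exp (-(s • X)) * X = X * exp (-(s • X)) := by
    have h1 := hasDerivAt_exp_smul_const (-X) s
    have h2 := hasDerivAt_exp_smul_const' (-X) s
    simpa using h1.unique h2
  rw [hc]
  noncomm_ring

/-- The derivative of `exp` along the image of a Lie algebra is given by an element of the Lie
algebra. -/
theorem exists_fderiv_exp_eq [FiniteDimensional ℂ A]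
    (hR : ∀ x y, R (ad x y) = R x * R y - R y * R x) (x y : E) :
    ∃ z, fderiv ℂ exp (R x) (R y) = exp (R x) * R z := by
  -- A functional vanishing on the image of R is constant on the curve of
  -- `hasDerivAt_fderiv_exp_mul`, whose velocity lies in that image. The curve starts at 0.
  obtain ⟨w, hw⟩ : fderiv ℂ exp (R x) (R y) * exp (-(R x)) ∈ LinearMap.range R.toLinearMap := by
    by_contra hnot
    obtain ⟨φ, hφ, hker⟩ := Submodule.exists_le_ker_of_notMem hnot
    refine hφ ?_
    let φ' : A →L[ℂ] ℂ := LinearMap.toContinuousLinearMap φ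
    have hd : ∀ s : ℂ, HasDerivAt
        (fun s : ℂ ↦ φ' (fderiv ℂ exp (s • R x) (s • R y) * exp (-(s • R x)))) 0 s := by
      intro s
      have h := φ'.hasFDerivAt.comp_hasDerivAt s (hasDerivAt_fderiv_exp_mul (R x) (R y) s)
      have h0 : φ' (exp (s • R x) * R y * exp (-(s • R x))) = 0 := by
        rw [← map_smul, exp_mul_apply hR, mul_assoc, exp_mul_exp_neg, mul_one]
        exact hker ⟨_, rfl⟩
      rwa [h0] at h
    have h := eq_of_hasDerivAt_zero hd 1 0
    simp only [one_smul, zero_smul, map_zero, zero_mul] at h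
    exact h
  -- The factor exp(-ad x) passes from the right to the left logarithmic derivative.
  refine ⟨exp (-ad x) w, ?_⟩
  have h1 : exp (R x) * R (exp (-ad x) w) = R w * exp (R x) := by
    rw [exp_mul_apply hR, ← mul_apply_eq_comp, exp_mul_exp_neg,
      one_apply_eq_self]
  rw [h1]
  change R w = _ at hw
  rw [hw, mul_assoc, exp_neg_mul_exp, mul_one]

end Exponential

theorem exists_norm_le_mul_of_injective {W W' : Type*} [NormedAddCommGroup W] [NormedSpace ℂ W]
    [FiniteDimensional ℂ W] [NormedAddCommGroup W'] [NormedSpace ℂ W'] {f : W →ₗ[ℂ] W'}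
    (hf : Function.Injective f) : ∃ K : ℝ, 0 ≤ K ∧ ∀ w, ‖w‖ ≤ K * ‖f w‖ := by
  obtain ⟨K, -, hK⟩ := (LinearMap.injective_iff_antilipschitz f).1 hf
  refine ⟨K, K.2, fun w ↦ ?_⟩
  have h := hK.le_mul_dist w 0
  rwa [dist_zero_right, map_zero, dist_zero_right] at h

/-! ### Automorphisms of 𝔤 near the identity are inner. -/

section Automorphisms

open NormedSpace

variable {E : Type*} [NormedAddCommGroup E] [NormedSpace ℂ E] [FiniteDimensional ℂ E]
  {ad : E →L[ℂ] E →L[ℂ] E} {p : (E →L[ℂ] E) →L[ℂ] E}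

set_option maxSynthPendingDepth 6 in
/-- An automorphism close to the identity, in a complement of the inner derivations, is the
identity. -/
theorem exists_pos_forall_eq_zero_of_automorphism
    (hder : ∀ D : E →L[ℂ] E, (∀ x y, D (ad x y) = ad (D x) y + ad x (D y)) → ∃ z, D = ad z)
    (hp : ∀ x, p (ad x) = x) :
    ∃ ε > 0, ∀ Y : E →L[ℂ] E, p Y = 0 → ‖Y‖ < ε →
      (∀ x y, (1 + Y) (ad x y) = ad ((1 + Y) x) ((1 + Y) y)) → Y = 0 := by
  have := FiniteDimensional.complete ℂ E
  -- `δ` is the linearized automorphism equation; its kernel, the inner derivations, meets ker p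
  -- trivially, so ‖Y‖ ≤ K ‖δ Y‖ on ker p. The full equation makes δ Y quadratic in Y, which forces
  -- a small Y to vanish.
  let δ : (E →L[ℂ] E) →ₗ[ℂ] E →L[ℂ] E →L[ℂ] E :=
    { toFun := fun Y ↦ (ContinuousLinearMap.compL ℂ E E E Y).comp ad - ad.comp Y
        - ((ContinuousLinearMap.compL ℂ E E E).flip Y).comp ad
      map_add' := fun Y Z ↦ by ext x y; simp; abel
      map_smul' := fun c Y ↦ by ext x y; simp [smul_sub] }
  have hδ : ∀ Y x y, δ Y x y = Y (ad x y) - ad (Y x) y - ad x (Y y) := fun _ _ _ ↦ rfl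
  let δ₀ : (E →L[ℂ] E) →ₗ[ℂ] (E →L[ℂ] E →L[ℂ] E) × E := δ.prod p.toLinearMap
  have hinj : Function.Injective δ₀ := by
    rw [injective_iff_map_eq_zero]
    intro Y h
    have h' : δ Y = 0 := congrArg Prod.fst h
    have hY : p Y = 0 := congrArg Prod.snd h
    obtain ⟨z, rfl⟩ := hder Y fun x y ↦ by
      have := hδ Y x y
      rw [h', sub_sub] at this
      exact sub_eq_zero.1 this.symm
    have hz : z = 0 := by rw [← hp z, hY]
    rw [hz, map_zero]
  obtain ⟨K, hK, hanti⟩ := exists_norm_le_mul_of_injective hinj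
  have hC : 0 < K * ‖ad‖ + 1 := by positivity
  refine ⟨1 / (K * ‖ad‖ + 1), by positivity, fun Y hpY hY haut ↦ ?_⟩
  have h1 : ‖Y‖ ≤ K * ‖δ Y‖ := by
    have h := hanti Y
    have h0 : δ₀ Y = (δ Y, 0) := Prod.ext rfl hpY
    rwa [h0, Prod.norm_def, norm_zero, max_eq_left (norm_nonneg _)] at h
  have h2 : ‖δ Y‖ ≤ ‖ad‖ * ‖Y‖ * ‖Y‖ := by
    refine ContinuousLinearMap.opNorm_le_bound _ (by positivity) fun x ↦ ?_
    refine ContinuousLinearMap.opNorm_le_bound _ (by positivity) fun y ↦ ?_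
    have h3 : δ Y x y = ad (Y x) (Y y) := by
      have := haut x y
      simp only [add_apply, one_apply_eq_self, map_add] at this
      have h4 : Y (ad x y) = ad (Y x) y + (ad x (Y y) + ad (Y x) (Y y)) := by
        refine add_left_cancel (a := ad x y) ?_
        rw [this]
        abel
      rw [hδ, h4]
      abel
    rw [h3]
    calc ‖ad (Y x) (Y y)‖ ≤ ‖ad‖ * ‖Y x‖ * ‖Y y‖ := ad.le_opNorm₂ _ _
      _ ≤ ‖ad‖ * (‖Y‖ * ‖x‖) * (‖Y‖ * ‖y‖) := by
        gcongr <;> exact ContinuousLinearMap.le_opNorm _ _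
      _ = ‖ad‖ * ‖Y‖ * ‖Y‖ * ‖x‖ * ‖y‖ := by ring
  by_contra hne
  have hpos : 0 < ‖Y‖ := norm_pos_iff.2 hne
  have h3 : ‖Y‖ ≤ (K * ‖ad‖ * ‖Y‖) * ‖Y‖ := by
    calc ‖Y‖ ≤ K * ‖δ Y‖ := h1
      _ ≤ K * (‖ad‖ * ‖Y‖ * ‖Y‖) := by gcongr
      _ = _ := by ring
  have h4 : 1 ≤ K * ‖ad‖ * ‖Y‖ := le_of_mul_le_mul_right (by rwa [one_mul]) hpos
  rw [lt_div_iff₀ hC] at hY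
  nlinarith

theorem hasFDerivAt_exp_mul_one_add {A : Type*} [NormedRing A] [NormedAlgebra ℂ A]
    [CompleteSpace A] (q : A →L[ℂ] A) :
    HasFDerivAt (fun Z : A ↦ exp (q Z) * (1 + (Z - q Z))) (ContinuousLinearMap.id ℂ A) 0 := by
  have h1 : HasFDerivAt (fun Z ↦ q Z) q 0 := q.hasFDerivAt
  have h2 : HasFDerivAt (fun Z ↦ exp (q Z)) q 0 := by
    have h3 : HasFDerivAt exp (1 : A →L[ℂ] A) (q 0) := by
      rw [map_zero]
      exact hasFDerivAt_exp_zero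
    exact h3.comp 0 h1
  have h4 : HasFDerivAt (fun Z : A ↦ 1 + (Z - q Z)) (ContinuousLinearMap.id ℂ _ - q) 0 :=
    ((hasFDerivAt_id 0).sub h1).const_add 1
  refine (h2.mul' h4).congr_fderiv ?_
  ext Z
  simp

/-- Automorphisms close to the identity are exponentials of inner derivations, holomorphically. -/
theorem exists_log_of_automorphism
    (hJ : ∀ x y, ad (ad x y) = ad x * ad y - ad y * ad x)
    (hder : ∀ D : E →L[ℂ] E, (∀ x y, D (ad x y) = ad (D x) y + ad x (D y)) → ∃ z, D = ad z)
    (hinj : Function.Injective ad) :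
    ∃ (U : Set (E →L[ℂ] E)) (l : (E →L[ℂ] E) → E), IsOpen U ∧ 1 ∈ U ∧ ContDiffOn ℂ ∞ l U ∧
      l 1 = 0 ∧ ∀ T ∈ U, (∀ x y, T (ad x y) = ad (T x) (T y)) → T = exp (ad (l T)) := by
  have := FiniteDimensional.complete ℂ E
  obtain ⟨p₀, hp₀⟩ := ad.toLinearMap.exists_leftInverse_of_injective (LinearMap.ker_eq_bot.2 hinj)
  let p : (E →L[ℂ] E) →L[ℂ] E := LinearMap.toContinuousLinearMap p₀
  have hp : ∀ x, p (ad x) = x := fun x ↦ LinearMap.congr_fun hp₀ x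
  obtain ⟨ε, hε, hrig⟩ := exists_pos_forall_eq_zero_of_automorphism hder hp
  -- Local coordinates that split an operator into the exponential of an inner derivation and a
  -- factor 1 + Y with p Y = 0. If the product is an automorphism, so is the second factor, which is
  -- then 1 by rigidity.
  let Ψ : (E →L[ℂ] E) → (E →L[ℂ] E) := fun Z ↦ exp (ad (p Z)) * (1 + (Z - ad (p Z)))
  have hΨ : ContDiff ℂ ∞ Ψ := by
    have h1 : ContDiff ℂ ∞ fun Z ↦ ad (p Z) := (ad.comp p).contDiff
    exact (contDiff_exp.comp h1).mul (contDiff_const.add (contDiff_id.sub h1))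
  have hΨ0 : Ψ 0 = 1 := by simp [Ψ]
  have hΨ' : HasFDerivAt Ψ ((ContinuousLinearEquiv.refl ℂ (E →L[ℂ] E) :
      (E →L[ℂ] E) ≃L[ℂ] (E →L[ℂ] E)) : (E →L[ℂ] E) →L[ℂ] (E →L[ℂ] E)) 0 := by
    exact hasFDerivAt_exp_mul_one_add (ad.comp p)
  let Φ := hΨ.contDiffAt.toOpenPartialHomeomorph Ψ hΨ' (by simp)
  have hΦ : ∀ Z, Φ Z = Ψ Z := fun Z ↦ rfl
  have h0 : (0 : E →L[ℂ] E) ∈ Φ.source :=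
    hΨ.contDiffAt.mem_toOpenPartialHomeomorph_source hΨ' (by simp)
  -- the set of good points
  let S : Set (E →L[ℂ] E) := {Z | ‖Z - ad (p Z)‖ < ε} ∩
    {Z | fderiv ℂ Ψ Z ∈ Set.range ((↑) : ((E →L[ℂ] E) ≃L[ℂ] (E →L[ℂ] E)) → _)}
  have hS : IsOpen S := by
    refine IsOpen.inter (isOpen_lt (by fun_prop) continuous_const) ?_
    exact ContinuousLinearEquiv.isOpen.preimage (hΨ.continuous_fderiv (by simp))
  have h0S : (0 : E →L[ℂ] E) ∈ S := ⟨by simpa using hε, ⟨_, hΨ'.fderiv.symm⟩⟩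
  refine ⟨Φ.target ∩ Φ.symm ⁻¹' S, fun T ↦ p (Φ.symm T), Φ.symm.isOpen_inter_preimage hS,
    ⟨?_, ?_⟩, ?_, ?_, ?_⟩
  · rw [← hΨ0, ← hΦ]; exact Φ.map_source h0
  · rw [← hΨ0, ← hΦ, Set.mem_preimage, Φ.left_inv h0]; exact h0S
  · refine p.contDiff.comp_contDiffOn fun T hT ↦ ContDiffAt.contDiffWithinAt ?_
    obtain ⟨f', hf'⟩ := hT.2.2
    refine Φ.contDiffAt_symm hT.1 (f₀' := f') ?_ hΨ.contDiffAt
    rw [hf']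
    exact (hΨ.differentiable (by simp) _).hasFDerivAt
  · change p (Φ.symm 1) = 0
    rw [← hΨ0, ← hΦ, Φ.left_inv h0, map_zero]
  · intro T hT haut
    set Z := Φ.symm T with hZ
    have hT' : T = exp (ad (p Z)) * (1 + (Z - ad (p Z))) := (Φ.right_inv hT.1).symm
    have hY : Z - ad (p Z) = 0 := by
      refine hrig _ (by rw [map_sub, hp, sub_self]) hT.2.1 fun x y ↦ ?_
      have h1 : 1 + (Z - ad (p Z)) = exp (ad (-p Z)) * T := by
        rw [hT', ← mul_assoc, map_neg, exp_neg_mul_exp, one_mul]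
      rw [h1, mul_apply_eq_comp, haut, exp_ad_apply_ad hJ]
      rfl
    rw [hY, add_zero, mul_one] at hT'
    exact hT'

end Automorphisms

/-! ### Inverse functions, local sections and locally constant functions on manifolds. -/

section InverseFunction

variable {F : Type*} [NormedAddCommGroup F] [NormedSpace ℂ F]
  {F' : Type*} [NormedAddCommGroup F'] [NormedSpace ℂ F']
  {M : Type*} [TopologicalSpace M] [ChartedSpace F M]
  {N : Type*} [TopologicalSpace N] [ChartedSpace F' N]

/-- The derivative in the preferred charts. -/
theorem hasMFDerivAt_iff_hasFDerivAt {f : M → N} {x : M} {f' : F →L[ℂ] F'} :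
    HasMFDerivAt 𝓘(ℂ, F) 𝓘(ℂ, F') f x f' ↔ ContinuousAt f x ∧
      HasFDerivAt (chartAt F' (f x) ∘ f ∘ (chartAt F x).symm) f' (chartAt F x x) := by
  have h : HasMFDerivAt 𝓘(ℂ, F) 𝓘(ℂ, F') f x f' ↔ ContinuousAt f x ∧
      HasFDerivWithinAt (chartAt F' (f x) ∘ f ∘ (chartAt F x).symm) f' (Set.range id)
        (chartAt F x x) := Iff.rfl
  rw [h, Set.range_id, hasFDerivWithinAt_univ]

/-- The source is shrunk to the points where the derivative is invertible, so that the inverse is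
holomorphic on its whole domain and not only at the image of `a`. -/
theorem exists_openPartialHomeomorph [FiniteDimensional ℂ F] {g : F → F'} {V : Set F}
    (hV : IsOpen V) (hg : ContDiffOn ℂ ∞ g V) {a : F} (ha : a ∈ V)
    (hbij : Function.Bijective (fderiv ℂ g a)) :
    ∃ Θ : OpenPartialHomeomorph F F', a ∈ Θ.source ∧ Θ.source ⊆ V ∧ (∀ y, Θ y = g y) ∧
      ContDiffOn ℂ ∞ Θ Θ.source ∧ ContDiffOn ℂ ∞ Θ.symm Θ.target := by
  have := FiniteDimensional.complete ℂ F
  let f' : F ≃L[ℂ] F' :=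
    haveI : FiniteDimensional ℂ F' := LinearEquiv.finiteDimensional
      (LinearEquiv.ofBijective (fderiv ℂ g a).toLinearMap hbij)
    (LinearEquiv.ofBijective (fderiv ℂ g a).toLinearMap hbij).toContinuousLinearEquiv
  have hga : ContDiffAt ℂ ∞ g a := hg.contDiffAt (hV.mem_nhds ha)
  have hf' : HasFDerivAt g (f' : F →L[ℂ] F') a :=
    (hga.differentiableAt (by simp)).hasFDerivAt
  let Θ₀ := hga.toOpenPartialHomeomorph g hf' (by simp)
  have ha₀ : a ∈ Θ₀.source := hga.mem_toOpenPartialHomeomorph_source hf' (by simp)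
  let S : Set F := V ∩ fderiv ℂ g ⁻¹' Set.range ((↑) : (F ≃L[ℂ] F') → F →L[ℂ] F')
  have hS : IsOpen S :=
    (hg.continuousOn_fderiv_of_isOpen hV (by simp)).isOpen_inter_preimage hV
      ContinuousLinearEquiv.isOpen
  let Θ := Θ₀.restrOpen S hS
  have hsub : ∀ y ∈ Θ.source, y ∈ S := fun y hy ↦ hy.2
  refine ⟨Θ, ⟨ha₀, ha, f', hf'.fderiv.symm⟩, fun y hy ↦ (hsub y hy).1, fun y ↦ rfl,
    hg.mono fun y hy ↦ (hsub y hy).1, fun y hy ↦ ContDiffAt.contDiffWithinAt ?_⟩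
  obtain ⟨h1, f₁, h2⟩ := hsub _ (Θ.map_target hy)
  have h3 : ContDiffAt ℂ ∞ g (Θ.symm y) := hg.contDiffAt (hV.mem_nhds h1)
  refine Θ.contDiffAt_symm hy (f₀' := f₁) ?_ h3
  rw [h2]
  exact (h3.differentiableAt (by simp)).hasFDerivAt

variable [IsManifold 𝓘(ℂ, F) ∞ M] [IsManifold 𝓘(ℂ, F') ∞ N]

/-- The inverse function theorem on manifolds. -/
theorem exists_partialDiffeomorph [FiniteDimensional ℂ F] {f : M → N} {U : Set M} (hU : IsOpen U)
    (hf : ContMDiffOn 𝓘(ℂ, F) 𝓘(ℂ, F') ∞ f U) {x : M} (hx : x ∈ U)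
    (hbij : Function.Bijective (mfderiv 𝓘(ℂ, F) 𝓘(ℂ, F') f x)) :
    ∃ Φ : PartialDiffeomorph 𝓘(ℂ, F) 𝓘(ℂ, F') M N ∞,
      x ∈ Φ.source ∧ Φ.source ⊆ U ∧ ∀ y ∈ Φ.source, Φ y = f y := by
  set φ := chartAt F x with hφ
  set ψ := chartAt F' (f x) with hψ
  let W : Set M := φ.source ∩ (U ∩ f ⁻¹' ψ.source)
  have hW : IsOpen W := φ.open_source.inter (hf.continuousOn.isOpen_inter_preimage hU ψ.open_source)
  have hxW : x ∈ W := ⟨mem_chart_source F x, hx, mem_chart_source F' (f x)⟩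
  let V : Set F := φ.target ∩ φ.symm ⁻¹' W
  have hV : IsOpen V := φ.symm.isOpen_inter_preimage hW
  let g : F → F' := ψ ∘ f ∘ φ.symm
  have hg : ContDiffOn ℂ ∞ g V := by
    rw [← contMDiffOn_iff_contDiffOn]
    refine (contMDiffOn_chart (I := 𝓘(ℂ, F')) (n := ∞)).comp (t := ψ.source)
      (hf.comp ((contMDiffOn_chart_symm (I := 𝓘(ℂ, F)) (n := ∞)).mono Set.inter_subset_left) ?_) ?_
    · exact fun y hy ↦ hy.2.2.1
    · exact fun y hy ↦ hy.2.2.2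
  have hφx : φ x ∈ V := ⟨mem_chart_target F x, by
    rw [Set.mem_preimage, φ.left_inv (mem_chart_source F x)]; exact hxW⟩
  have hmd : MDifferentiableAt 𝓘(ℂ, F) 𝓘(ℂ, F') f x :=
    (hf.contMDiffAt (hU.mem_nhds hx)).mdifferentiableAt (by simp)
  have hder : fderiv ℂ g (φ x) = mfderiv 𝓘(ℂ, F) 𝓘(ℂ, F') f x :=
    (hasMFDerivAt_iff_hasFDerivAt.1 hmd.hasMFDerivAt).2.fderiv
  obtain ⟨Θ, hΘx, hΘV, hΘg, hΘ, hΘ'⟩ := exists_openPartialHomeomorph hV hg hφx (by rwa [hder])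
  let Φ := (φ.trans Θ).trans ψ.symm
  have hsrc : ∀ y ∈ Φ.source, y ∈ φ.source ∧ φ y ∈ Θ.source ∧ y ∈ W ∧ Φ y = f y := by
    intro y hy
    simp only [Φ, OpenPartialHomeomorph.trans_source, Set.mem_inter_iff, Set.mem_preimage,
      OpenPartialHomeomorph.coe_trans, Function.comp_apply] at hy
    have h1 := (hΘV hy.1.2).2
    rw [Set.mem_preimage, φ.left_inv hy.1.1] at h1
    refine ⟨hy.1.1, hy.1.2, h1, ?_⟩
    change ψ.symm (Θ (φ y)) = f y
    rw [hΘg]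
    change ψ.symm (ψ (f (φ.symm (φ y)))) = f y
    rw [φ.left_inv hy.1.1, ψ.left_inv h1.2.2]
  refine ⟨⟨Φ.toPartialEquiv, Φ.open_source, Φ.open_target, ?_, ?_⟩, ?_, ?_, ?_⟩
  · exact (hf.mono fun y hy ↦ (hsrc y hy).2.2.1.2.1).congr fun y hy ↦ (hsrc y hy).2.2.2
  · change ContMDiffOn 𝓘(ℂ, F') 𝓘(ℂ, F) ∞ (φ.symm ∘ Θ.symm ∘ ψ) Φ.target
    have htgt : ∀ z ∈ Φ.target, z ∈ ψ.source ∧ ψ z ∈ Θ.target ∧ Θ.symm (ψ z) ∈ φ.target := by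
      intro z hz
      simp only [Φ, OpenPartialHomeomorph.trans_target, Set.mem_inter_iff, Set.mem_preimage,
        OpenPartialHomeomorph.symm_symm, OpenPartialHomeomorph.symm_target] at hz
      exact ⟨hz.1, hz.2.1, hz.2.2⟩
    refine (contMDiffOn_chart_symm (I := 𝓘(ℂ, F)) (n := ∞)).comp (t := φ.target)
      ((contMDiffOn_iff_contDiffOn.2 hΘ').comp
        ((contMDiffOn_chart (I := 𝓘(ℂ, F')) (n := ∞)).mono fun z hz ↦ (htgt z hz).1) ?_) ?_
    · exact fun z hz ↦ (htgt z hz).2.1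
    · exact fun z hz ↦ (htgt z hz).2.2
  · change x ∈ Φ.source
    simp only [Φ, OpenPartialHomeomorph.trans_source, Set.mem_inter_iff, Set.mem_preimage,
      OpenPartialHomeomorph.coe_trans, Function.comp_apply]
    refine ⟨⟨mem_chart_source F x, hΘx⟩, ?_⟩
    rw [hΘg]
    change ψ (f (φ.symm (φ x))) ∈ ψ.target
    rw [φ.left_inv (mem_chart_source F x)]
    exact mem_chart_target F' (f x)
  · exact fun y hy ↦ (hsrc y hy).2.2.1.2.1
  · exact fun y hy ↦ (hsrc y hy).2.2.2

/-- A submersion has local sections. -/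
theorem exists_local_section [FiniteDimensional ℂ F'] {a : M → N}
    (ha : ContMDiff 𝓘(ℂ, F) 𝓘(ℂ, F') ∞ a) {x : M}
    (hsurj : Function.Surjective (mfderiv 𝓘(ℂ, F) 𝓘(ℂ, F') a x)) :
    ∃ (U : Set N) (s : N → M), IsOpen U ∧ a x ∈ U ∧ ContMDiffOn 𝓘(ℂ, F') 𝓘(ℂ, F) ∞ s U ∧
      s (a x) = x ∧ ∀ y ∈ U, a (s y) = y := by
  set φ := chartAt F x with hφ
  have hmd : HasMFDerivAt 𝓘(ℂ, F) 𝓘(ℂ, F') a x _ := (ha.mdifferentiable (by simp) x).hasMFDerivAt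
  let a' : F →L[ℂ] F' := mfderiv 𝓘(ℂ, F) 𝓘(ℂ, F') a x
  obtain ⟨r₀, hr₀⟩ := a'.toLinearMap.exists_rightInverse_of_surjective
    (LinearMap.range_eq_top.2 hsurj)
  let r : F' →L[ℂ] F := LinearMap.toContinuousLinearMap r₀
  have hr : ∀ w, a' (r w) = w := fun w ↦ LinearMap.congr_fun hr₀ w
  -- An affine slice through x, in the chart, along a right inverse `r` of the derivative; on it the
  -- map is a local diffeomorphism.
  let j : F' → F := fun w ↦ φ x + r w
  have hj : ContDiff ℂ ∞ j := contDiff_const.add r.contDiff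
  have hj0 : j 0 = φ x := by simp [j]
  let b : F' → M := fun w ↦ φ.symm (j w)
  have hb0 : b 0 = x := by
    change φ.symm (j 0) = x
    rw [hj0, φ.left_inv (mem_chart_source F x)]
  have hVo : IsOpen (j ⁻¹' φ.target) := φ.open_target.preimage hj.continuous
  have h0V : (0 : F') ∈ j ⁻¹' φ.target := by
    rw [Set.mem_preimage, hj0]; exact mem_chart_target F x
  have hb : ContMDiffOn 𝓘(ℂ, F') 𝓘(ℂ, F) ∞ b (j ⁻¹' φ.target) :=
    (contMDiffOn_chart_symm (I := 𝓘(ℂ, F)) (n := ∞)).comp hj.contMDiff.contMDiffOn subset_rfl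
  have hd : HasMFDerivAt 𝓘(ℂ, F') 𝓘(ℂ, F') (a ∘ b) 0 (ContinuousLinearMap.id ℂ F') := by
    have h1 : HasMFDerivAt 𝓘(ℂ, F') 𝓘(ℂ, F) b 0 r := by
      rw [hasMFDerivAt_iff_hasFDerivAt]
      refine ⟨((hb.continuousOn).continuousAt (hVo.mem_nhds h0V)), ?_⟩
      have h2 : HasFDerivAt j r 0 := r.hasFDerivAt.const_add _
      refine h2.congr_of_eventuallyEq ?_
      filter_upwards [hVo.mem_nhds h0V] with w hw
      change chartAt F (b 0) (φ.symm (j w)) = j w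
      rw [hb0]
      exact φ.right_inv hw
    have h3 : HasMFDerivAt 𝓘(ℂ, F) 𝓘(ℂ, F') a (b 0) a' := by
      rw [hb0]
      exact hmd
    have h4 := h3.comp 0 h1
    have h5 : a'.comp r = ContinuousLinearMap.id ℂ F' := ContinuousLinearMap.ext hr
    exact h4.congr_mfderiv h5
  have hbij : Function.Bijective (mfderiv 𝓘(ℂ, F') 𝓘(ℂ, F') (a ∘ b) 0) := by
    rw [hd.mfderiv]
    exact Function.bijective_id
  obtain ⟨Φ, h0Φ, hΦV, hΦ⟩ := exists_partialDiffeomorph hVo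
    (ha.comp_contMDiffOn hb) h0V hbij
  have hΦ0 : Φ 0 = a x := by rw [hΦ 0 h0Φ, Function.comp_apply, hb0]
  refine ⟨Φ.target, b ∘ Φ.invFun, Φ.open_target, ?_, ?_, ?_, ?_⟩
  · rw [← hΦ0]; exact Φ.map_source h0Φ
  · exact hb.comp Φ.contMDiffOn_invFun fun y hy ↦ hΦV (Φ.map_target hy)
  · rw [← hΦ0, Function.comp_apply]
    have : Φ.invFun (Φ 0) = 0 := Φ.left_inv h0Φ
    rw [this, hb0]
  · intro y hy
    have h1 := hΦ _ (Φ.map_target hy)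
    rw [Function.comp_apply] at h1 ⊢
    exact h1.symm.trans (Φ.right_inv hy)

/-- A function with vanishing derivative near a point is constant near this point. -/
theorem eventually_eq_of_mfderiv_eq_zero {W : Type*} [NormedAddCommGroup W] [NormedSpace ℂ W]
    {f : M → W} {x : M}
    (hf : ∀ᶠ y in 𝓝 x, HasMFDerivAt 𝓘(ℂ, F) 𝓘(ℂ, W) f y (0 : F →L[ℂ] W)) :
    ∀ᶠ y in 𝓝 x, f y = f x := by
  set φ := chartAt F x with hφ
  have hxs : x ∈ φ.source := mem_chart_source F x
  have h1 : ∀ᶠ z in 𝓝 (φ x), HasFDerivAt (f ∘ φ.symm) (0 : F →L[ℂ] W) z := by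
    have hc : Filter.Tendsto φ.symm (𝓝 (φ x)) (𝓝 x) := by
      have := φ.continuousAt_symm (φ.map_source hxs)
      rwa [ContinuousAt, φ.left_inv hxs] at this
    filter_upwards [hc.eventually hf, φ.open_target.mem_nhds (φ.map_source hxs)] with z hz hzt
    have h2 : MDifferentiableAt 𝓘(ℂ, F) 𝓘(ℂ, F) φ.symm z :=
      ((contMDiffOn_chart_symm (I := 𝓘(ℂ, F)) (n := ∞)).contMDiffAt
        (φ.open_target.mem_nhds hzt)).mdifferentiableAt (by simp)
    have h3 := hz.comp z h2.hasMFDerivAt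
    exact (hasMFDerivAt_iff_hasFDerivAt.1 h3).2.congr_fderiv (ContinuousLinearMap.zero_comp _)
  obtain ⟨ε, hε, hball⟩ := Metric.eventually_nhds_iff_ball.1 h1
  have h5 : ∀ z ∈ Metric.ball (φ x) ε, (f ∘ φ.symm) z = (f ∘ φ.symm) (φ x) := fun z hz ↦
    (convex_ball (φ x) ε).is_const_of_fderivWithin_eq_zero (𝕜 := ℂ)
      (fun w hw ↦ (hball w hw).differentiableAt.differentiableWithinAt)
      (fun w hw ↦ by
        rw [fderivWithin_of_isOpen Metric.isOpen_ball hw, (hball w hw).fderiv])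
      hz (Metric.mem_ball_self hε)
  filter_upwards [φ.continuousAt hxs (Metric.ball_mem_nhds _ hε), φ.open_source.mem_nhds hxs]
    with y hy hys
  have := h5 _ hy
  rwa [Function.comp_apply, Function.comp_apply, φ.left_inv hys, φ.left_inv hxs] at this

theorem eq_of_mfderiv_eq_zero [PreconnectedSpace M] {W : Type*} [NormedAddCommGroup W]
    [NormedSpace ℂ W] {f : M → W}
    (hf : ∀ y, HasMFDerivAt 𝓘(ℂ, F) 𝓘(ℂ, W) f y (0 : F →L[ℂ] W)) (x y : M) : f x = f y :=
  ((IsLocallyConstant.iff_eventually_eq f).2 fun _ ↦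
    eventually_eq_of_mfderiv_eq_zero (.of_forall hf)).apply_eq_of_preconnectedSpace x y

end InverseFunction

/-! ### Vector fields in charts; the Lie bracket as a commutator of directional derivatives. -/

section LieDerivative

open VectorField

variable {F : Type*} [NormedAddCommGroup F] [NormedSpace ℂ F]
  {M : Type*} [TopologicalSpace M] [ChartedSpace F M]
  {W : Type*} [NormedAddCommGroup W] [NormedSpace ℂ W]

theorem contDiffAt_comp_extChartAt_symm {x : M} {u : M → W} (hu : CMDiffAt ∞ u x) :
    ContDiffAt ℂ ∞ (u ∘ (extChartAt 𝓘(ℂ, F) x).symm) (extChartAt 𝓘(ℂ, F) x x) := by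
  have h := (contMDiffAt_iff.1 hu).2
  rw [modelWithCornersSelf_coe, Set.range_id, contDiffWithinAt_univ] at h
  exact h

/-- The derivative at `x` of a function given in the preferred chart at `x`. -/
theorem hasMFDerivAt_comp_extChartAt {x : M} {g : F → W} {g' : F →L[ℂ] W}
    (hg : HasFDerivAt g g' (extChartAt 𝓘(ℂ, F) x x)) :
    HasMFDerivAt 𝓘(ℂ, F) 𝓘(ℂ, W) (g ∘ extChartAt 𝓘(ℂ, F) x) x g' := by
  rw [hasMFDerivAt_iff_hasFDerivAt]
  refine ⟨hg.continuousAt.comp (continuousAt_extChartAt x), ?_⟩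
  refine hg.congr_of_eventuallyEq ?_
  filter_upwards [(chartAt F x).open_target.mem_nhds (mem_chart_target F x)] with a ha
  change g (chartAt F x ((chartAt F x).symm a)) = g a
  rw [(chartAt F x).right_inv ha]

variable [IsManifold 𝓘(ℂ, F) ∞ M]

/-- The vector field `Y` in the preferred chart at `x`. -/
def chartField (x : M) (Y : Π y : M, TangentSpace 𝓘(ℂ, F) y) : F → F :=
  mpullbackWithin 𝓘(ℂ, F) 𝓘(ℂ, F) (extChartAt 𝓘(ℂ, F) x).symm Y (Set.range 𝓘(ℂ, F))

theorem mvfderiv_apply_eq_fderiv {x y : M} (hy : y ∈ (extChartAt 𝓘(ℂ, F) x).source) {u : M → W}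
    (hu : MDiffAt u y) (Y : Π y : M, TangentSpace 𝓘(ℂ, F) y) :
    mvfderiv 𝓘(ℂ, F) u y (Y y) = fderiv ℂ (u ∘ (extChartAt 𝓘(ℂ, F) x).symm)
      (extChartAt 𝓘(ℂ, F) x y) (chartField x Y (extChartAt 𝓘(ℂ, F) x y)) := by
  have : IsManifold 𝓘(ℂ, F) 1 M := IsManifold.of_le (n := ∞) ENat.LEInfty.out
  set φ := extChartAt 𝓘(ℂ, F) x with hφ
  have hmem : φ y ∈ φ.target := φ.map_source hy
  have hinv := isInvertible_mfderivWithin_extChartAt_symm hmem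
  have hy' : φ.symm (φ y) = y := φ.left_inv hy
  have hs : MDifferentiableWithinAt 𝓘(ℂ, F) 𝓘(ℂ, F) φ.symm (Set.range 𝓘(ℂ, F)) (φ y) :=
    mdifferentiableWithinAt_extChartAt_symm hmem
  have hu' : MDiffAt u (φ.symm (φ y)) := by rwa [hy']
  have hcomp := hu'.hasMFDerivAt.comp_hasMFDerivWithinAt (φ y) hs.hasMFDerivWithinAt
  let A : F →L[ℂ] W := mfderiv 𝓘(ℂ, F) 𝓘(ℂ, W) u (φ.symm (φ y))
  let B : F →L[ℂ] F := mfderivWithin 𝓘(ℂ, F) 𝓘(ℂ, F) φ.symm (Set.range 𝓘(ℂ, F)) (φ y)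
  have hcomp' : HasFDerivAt (u ∘ φ.symm) (A.comp B) (φ y) := by
    have h1 : HasFDerivWithinAt (u ∘ φ.symm) (A.comp B) (Set.range id) (φ y) :=
      hcomp.hasFDerivWithinAt
    rwa [Set.range_id, hasFDerivWithinAt_univ] at h1
  have h2 : B (chartField x Y (φ y)) = Y (φ.symm (φ y)) := hinv.self_apply_inverse _
  have h3 : mvfderiv 𝓘(ℂ, F) u y (Y y)
      = mfderiv 𝓘(ℂ, F) 𝓘(ℂ, W) u (φ.symm (φ y)) (Y (φ.symm (φ y))) := by
    rw [hy']
    rfl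
  rw [hcomp'.fderiv, h3]
  exact (congrArg A h2).symm

theorem eventually_mdifferentiableAt {x : M} {u : M → W} (hu : CMDiffAt ∞ u x) :
    ∀ᶠ y in 𝓝 x, MDiffAt u y := by
  have : IsManifold 𝓘(ℂ, F) 1 M := IsManifold.of_le (n := ∞) ENat.LEInfty.out
  have h1 : ContMDiffAt 𝓘(ℂ, F) 𝓘(ℂ, W) 1 u x := hu.of_le ENat.LEInfty.out
  filter_upwards [(contMDiffAt_iff_contMDiffAt_nhds (by simp)).1 h1] with y hy
  exact hy.mdifferentiableAt one_ne_zero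

/-- The directional derivative of a function, in the preferred chart at `x`. -/
theorem mvfderiv_apply_eventuallyEq {x : M} {u : M → W}
    (hu : ∀ᶠ y in 𝓝 x, MDiffAt u y) (Y : Π y : M, TangentSpace 𝓘(ℂ, F) y) :
    (fun y ↦ mvfderiv 𝓘(ℂ, F) u y (Y y)) =ᶠ[𝓝 x]
      (fun a ↦ fderiv ℂ (u ∘ (extChartAt 𝓘(ℂ, F) x).symm) a (chartField x Y a)) ∘
        extChartAt 𝓘(ℂ, F) x := by
  filter_upwards [hu, extChartAt_source_mem_nhds (I := 𝓘(ℂ, F)) x] with y h1 h2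
  exact mvfderiv_apply_eq_fderiv h2 h1 Y

variable [CompleteSpace F]

theorem contDiffAt_chartField {x : M} {Y : Π y : M, TangentSpace 𝓘(ℂ, F) y}
    (hY : CMDiffAt ∞ (T% Y) x) :
    ContDiffAt ℂ ∞ (chartField x Y) (extChartAt 𝓘(ℂ, F) x x) := by
  have h := contMDiffWithinAt_mpullbackWithin_extChartAt_symm (n := ∞) (s := Set.univ)
    hY.contMDiffWithinAt uniqueMDiffOn_univ (Set.mem_univ x) le_rfl
  rw [Set.preimage_univ, Set.inter_univ] at h
  have h' := h.contMDiffAt (extChartAt_target_mem_nhds x)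
  exact contMDiffAt_iff_contDiffAt.1
    ((contMDiff_snd_tangentBundle_modelSpace F 𝓘(ℂ, F)).contMDiffAt.comp _ h')

theorem differentiableAt_chartField {x : M}
    {Y : Π y : M, TangentSpace 𝓘(ℂ, F) y} (hY : MDiffAt (T% Y) x) :
    DifferentiableAt ℂ (chartField x Y) (extChartAt 𝓘(ℂ, F) x x) := by
  have : IsManifold 𝓘(ℂ, F) 2 M := IsManifold.of_le (n := ∞) ENat.LEInfty.out
  have h := MDifferentiableWithinAt.differentiableWithinAt_mpullbackWithin_vectorField
    (mdifferentiableWithinAt_univ.2 hY)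
  refine DifferentiableWithinAt.differentiableAt h ?_
  simp

theorem contMDiffAt_mvfderiv_apply {x : M} {u : M → W} (hu : CMDiffAt ∞ u x)
    {Y : Π y : M, TangentSpace 𝓘(ℂ, F) y} (hY : CMDiffAt ∞ (T% Y) x) :
    CMDiffAt ∞ (fun y ↦ mvfderiv 𝓘(ℂ, F) u y (Y y)) x := by
  refine ContMDiffAt.congr_of_eventuallyEq ?_
    (mvfderiv_apply_eventuallyEq (eventually_mdifferentiableAt hu) Y)
  refine ContMDiffAt.comp x ?_ (contMDiffAt_extChartAt (n := ∞))
  exact contMDiffAt_iff_contDiffAt.2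
    (((contDiffAt_comp_extChartAt_symm hu).fderiv_right (m := ∞) le_rfl).clm_apply
      (contDiffAt_chartField hY))

theorem mdifferentiableAt_mvfderiv_apply {x : M} {u : M → W} (hu : CMDiffAt ∞ u x)
    {Y : Π y : M, TangentSpace 𝓘(ℂ, F) y} (hY : MDiffAt (T% Y) x) :
    MDiffAt (fun y ↦ mvfderiv 𝓘(ℂ, F) u y (Y y)) x := by
  refine MDifferentiableAt.congr_of_eventuallyEq ?_
    (mvfderiv_apply_eventuallyEq (eventually_mdifferentiableAt hu) Y)
  exact (hasMFDerivAt_comp_extChartAt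
    ((((contDiffAt_comp_extChartAt_symm hu).fderiv_right (m := ∞) le_rfl).differentiableAt
      (by simp)).clm_apply (differentiableAt_chartField hY)).hasFDerivAt).mdifferentiableAt

/-- The Lie bracket is the commutator of the directional derivatives. -/
theorem mvfderiv_mlieBracket {x : M} {u : M → W} (hu : CMDiffAt ∞ u x)
    {X Y : Π y : M, TangentSpace 𝓘(ℂ, F) y} (hX : MDiffAt (T% X) x) (hY : MDiffAt (T% Y) x) :
    mvfderiv 𝓘(ℂ, F) u x (mlieBracket 𝓘(ℂ, F) X Y x) =
      mvfderiv 𝓘(ℂ, F) (fun y ↦ mvfderiv 𝓘(ℂ, F) u y (Y y)) x (X x) -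
        mvfderiv 𝓘(ℂ, F) (fun y ↦ mvfderiv 𝓘(ℂ, F) u y (X y)) x (Y x) := by
  have : IsManifold 𝓘(ℂ, F) 1 M := IsManifold.of_le (n := ∞) ENat.LEInfty.out
  set φ := extChartAt 𝓘(ℂ, F) x with hφ
  set û := u ∘ φ.symm with hû
  have hev := eventually_mdifferentiableAt hu
  have hûs := contDiffAt_comp_extChartAt_symm hu
  have hxs : x ∈ φ.source := mem_extChartAt_source x
  have hd2 : DifferentiableAt ℂ (fderiv ℂ û) (φ x) :=
    (hûs.fderiv_right (m := ∞) le_rfl).differentiableAt (by simp)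
  -- Each iterated derivative is a second-derivative term plus a first-derivative term. The former
  -- cancel by symmetry and the latter give the bracket.
  have key : ∀ {X Y : Π y : M, TangentSpace 𝓘(ℂ, F) y}, MDiffAt (T% Y) x →
      mvfderiv 𝓘(ℂ, F) (fun y ↦ mvfderiv 𝓘(ℂ, F) u y (Y y)) x (X x) =
        fderiv ℂ (fderiv ℂ û) (φ x) (chartField x X (φ x)) (chartField x Y (φ x)) +
          fderiv ℂ û (φ x) (fderiv ℂ (chartField x Y) (φ x) (chartField x X (φ x))) := by
    intro X Y hY
    rw [mvfderiv_apply_eq_fderiv hxs (mdifferentiableAt_mvfderiv_apply hu hY) X]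
    have h1 : ((fun y ↦ mvfderiv 𝓘(ℂ, F) u y (Y y)) ∘ φ.symm) =ᶠ[𝓝 (φ x)]
        fun a ↦ fderiv ℂ û a (chartField x Y a) := by
      have hc : Filter.Tendsto φ.symm (𝓝 (φ x)) (𝓝 x) := by
        have := continuousAt_extChartAt_symm (I := 𝓘(ℂ, F)) x
        rwa [ContinuousAt, extChartAt_to_inv] at this
      filter_upwards [hc.eventually (mvfderiv_apply_eventuallyEq hev Y),
        extChartAt_target_mem_nhds (I := 𝓘(ℂ, F)) x] with a ha hat
      rw [Function.comp_apply, ha, Function.comp_apply, φ.right_inv hat]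
    rw [h1.fderiv_eq, fderiv_clm_apply hd2 (differentiableAt_chartField hY)]
    simp only [add_apply, ContinuousLinearMap.comp_apply,
      ContinuousLinearMap.flip_apply]
    abel
  have hbr : mvfderiv 𝓘(ℂ, F) u x (mlieBracket 𝓘(ℂ, F) X Y x) =
      fderiv ℂ û (φ x) (lieBracket ℂ (chartField x X) (chartField x Y) (φ x)) := by
    have hcomp : HasMFDerivAt 𝓘(ℂ, F) 𝓘(ℂ, W) (û ∘ φ) x (fderiv ℂ û (φ x)) :=
      hasMFDerivAt_comp_extChartAt (hûs.differentiableAt (by simp)).hasFDerivAt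
    have h2 : HasMFDerivAt 𝓘(ℂ, F) 𝓘(ℂ, W) u x (fderiv ℂ û (φ x)) := by
      refine hcomp.congr_of_eventuallyEq ?_
      filter_upwards [extChartAt_source_mem_nhds (I := 𝓘(ℂ, F)) x] with y hy
      change u y = u (φ.symm (φ y))
      rw [φ.left_inv hy]
    have h3 : mfderiv 𝓘(ℂ, F) 𝓘(ℂ, F) φ x = ContinuousLinearMap.id ℂ F :=
      (hasMFDerivAt_comp_extChartAt (g := id) (hasFDerivAt_id _)).mfderiv
    have h4 : mlieBracket 𝓘(ℂ, F) X Y x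
        = lieBracket ℂ (chartField x X) (chartField x Y) (φ x) := by
      let A : F →L[ℂ] F := mfderiv 𝓘(ℂ, F) 𝓘(ℂ, F) φ x
      have h3' : A = ContinuousLinearMap.id ℂ F := h3
      have h5 : mlieBracket 𝓘(ℂ, F) X Y x = A.inverse
          (lieBracketWithin ℂ (chartField x X) (chartField x Y)
            (φ.symm ⁻¹' Set.univ ∩ Set.range id) (φ x)) := rfl
      rw [Set.preimage_univ, Set.range_id, Set.inter_univ, h3', ContinuousLinearMap.inverse_id,
        lieBracketWithin_univ] at h5
      exact h5
    have h6 : (mvfderiv 𝓘(ℂ, F) u x : F →L[ℂ] W) = fderiv ℂ û (φ x) := h2.mfderiv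
    exact (DFunLike.congr_fun h6 _).trans (congrArg (fderiv ℂ û (φ x)) h4)
  rw [hbr, key hX, key hY, lieBracket, map_sub]
  have hsymm := hûs.isSymmSndFDerivAt
    (by rw [minSmoothness_of_isRCLikeNormedField]; exact ENat.LEInfty.out)
  rw [hsymm.eq]
  abel

end LieDerivative

/-! ### Partial derivatives on products of manifolds. -/

section PartialDerivatives

variable {F : Type*} [NormedAddCommGroup F] [NormedSpace ℂ F]
  {F' : Type*} [NormedAddCommGroup F'] [NormedSpace ℂ F']
  {M : Type*} [TopologicalSpace M] [ChartedSpace F M]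
  {N : Type*} [TopologicalSpace N] [ChartedSpace F' N]
  {W : Type*} [NormedAddCommGroup W] [NormedSpace ℂ W]

variable (F) in
/-- The derivative of a vector-valued function, as a linear map on the model space. -/
def vderiv (u : M → W) (x : M) : F →L[ℂ] W := mvfderiv 𝓘(ℂ, F) u x

theorem vderiv_eq_fderiv {u : M → W} {x : M} (hu : MDiffAt u x) :
    vderiv F u x =
      fderiv ℂ (u ∘ (extChartAt 𝓘(ℂ, F) x).symm) (extChartAt 𝓘(ℂ, F) x x) :=
  (hasMFDerivAt_iff_hasFDerivAt.1 hu.hasMFDerivAt).2.fderiv.symm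

/-- A function of two variables in the preferred charts. -/
def chartFun (Q : M → N → W) (x : M) (y : N) (p : F × F') : W :=
  Q ((extChartAt 𝓘(ℂ, F) x).symm p.1) ((extChartAt 𝓘(ℂ, F') y).symm p.2)

variable {Q : M → N → W} {x : M} {y : N}

theorem contDiffAt_chartFun
    (hQ : ContMDiffAt (𝓘(ℂ, F).prod 𝓘(ℂ, F')) 𝓘(ℂ, W) ∞ (fun p : M × N ↦ Q p.1 p.2) (x, y)) :
    ContDiffAt ℂ ∞ (chartFun Q x y) (extChartAt 𝓘(ℂ, F) x x, extChartAt 𝓘(ℂ, F') y y) := by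
  have h := (contMDiffAt_iff.1 hQ).2
  rw [ModelWithCorners.range_eq_univ, contDiffWithinAt_univ] at h
  exact h

theorem vderiv_eventuallyEq_chartFun [IsManifold 𝓘(ℂ, F) ∞ M] [IsManifold 𝓘(ℂ, F') ∞ N]
    (hQ : ContMDiffAt (𝓘(ℂ, F).prod 𝓘(ℂ, F')) 𝓘(ℂ, W) ∞ (fun p : M × N ↦ Q p.1 p.2) (x, y)) :
    (fun x' ↦ vderiv F' (Q x') y) =ᶠ[𝓝 x]
      (fun a ↦ (fderiv ℂ (chartFun Q x y) (a, extChartAt 𝓘(ℂ, F') y y)).comp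
        (ContinuousLinearMap.inr ℂ F F')) ∘ extChartAt 𝓘(ℂ, F) x := by
  have h1 : ∀ᶠ p : M × N in 𝓝 (x, y),
      MDifferentiableAt (𝓘(ℂ, F).prod 𝓘(ℂ, F')) 𝓘(ℂ, W) (fun p : M × N ↦ Q p.1 p.2) p := by
    have h2 : ContMDiffAt (𝓘(ℂ, F).prod 𝓘(ℂ, F')) 𝓘(ℂ, W) 1 (fun p : M × N ↦ Q p.1 p.2) (x, y) :=
      hQ.of_le ENat.LEInfty.out
    have : IsManifold 𝓘(ℂ, F) 1 M := IsManifold.of_le (n := ∞) ENat.LEInfty.out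
    have : IsManifold 𝓘(ℂ, F') 1 N := IsManifold.of_le (n := ∞) ENat.LEInfty.out
    filter_upwards [(contMDiffAt_iff_contMDiffAt_nhds (by simp)).1 h2] with y hy
    exact hy.mdifferentiableAt one_ne_zero
  have h3 : ∀ᶠ x' in 𝓝 x, MDifferentiableAt (𝓘(ℂ, F).prod 𝓘(ℂ, F')) 𝓘(ℂ, W)
      (fun p : M × N ↦ Q p.1 p.2) (x', y) :=
    (Continuous.prodMk_left y).continuousAt.eventually h1
  have h4 : ∀ᶠ p in 𝓝 (extChartAt 𝓘(ℂ, F) x x, extChartAt 𝓘(ℂ, F') y y),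
      DifferentiableAt ℂ (chartFun Q x y) p := by
    have h5 : ContDiffAt ℂ 1 (chartFun Q x y)
      (extChartAt 𝓘(ℂ, F) x x, extChartAt 𝓘(ℂ, F') y y) :=
      (contDiffAt_chartFun hQ).of_le ENat.LEInfty.out
    filter_upwards [h5.eventually (by simp)] with p hp
    exact hp.differentiableAt one_ne_zero
  have h6 : ∀ᶠ x' in 𝓝 x, DifferentiableAt ℂ (chartFun Q x y)
      (extChartAt 𝓘(ℂ, F) x x', extChartAt 𝓘(ℂ, F') y y) :=
    ((continuousAt_extChartAt (I := 𝓘(ℂ, F)) x).prodMk continuousAt_const).eventually h4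
  filter_upwards [h3, h6, extChartAt_source_mem_nhds (I := 𝓘(ℂ, F)) x] with x' hx' hx'' hs
  have h7 : MDiffAt (Q x') y :=
    MDifferentiableAt.comp (I' := 𝓘(ℂ, F).prod 𝓘(ℂ, F')) y (f := fun y' ↦ (x', y')) hx'
      (mdifferentiableAt_const.prodMk mdifferentiableAt_id)
  rw [vderiv_eq_fderiv h7]
  have h8 : Q x' ∘ (extChartAt 𝓘(ℂ, F') y).symm =
      chartFun Q x y ∘ fun b ↦ (extChartAt 𝓘(ℂ, F) x x', b) := by
    ext b
    change Q x' _ = Q ((extChartAt 𝓘(ℂ, F) x).symm (extChartAt 𝓘(ℂ, F) x x')) _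
    rw [(extChartAt 𝓘(ℂ, F) x).left_inv hs]
  rw [h8]
  exact (hx''.hasFDerivAt.comp _ (hasFDerivAt_prodMk_right _ _)).fderiv

/-- A partial derivative of a holomorphic function is holomorphic. -/
theorem contMDiffAt_vderiv_partial [IsManifold 𝓘(ℂ, F) ∞ M] [IsManifold 𝓘(ℂ, F') ∞ N]
    (hQ : ContMDiffAt (𝓘(ℂ, F).prod 𝓘(ℂ, F')) 𝓘(ℂ, W) ∞ (fun p : M × N ↦ Q p.1 p.2) (x, y)) :
    ContMDiffAt 𝓘(ℂ, F) 𝓘(ℂ, F' →L[ℂ] W) ∞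
      (fun x' ↦ vderiv F' (Q x') y) x := by
  refine ContMDiffAt.congr_of_eventuallyEq ?_ (vderiv_eventuallyEq_chartFun hQ)
  refine ContMDiffAt.comp x ?_ (contMDiffAt_extChartAt (n := ∞))
  refine contMDiffAt_iff_contDiffAt.2 (ContDiffAt.clm_comp ?_ contDiffAt_const)
  exact ContDiffAt.comp _ ((contDiffAt_chartFun hQ).fderiv_right (m := ∞) le_rfl)
    (contDiffAt_id.prodMk contDiffAt_const)

/-- Mixed partial derivatives can be interchanged. -/
theorem vderiv_vderiv_comm [IsManifold 𝓘(ℂ, F) ∞ M] [IsManifold 𝓘(ℂ, F') ∞ N]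
    (hQ : ContMDiffAt (𝓘(ℂ, F).prod 𝓘(ℂ, F')) 𝓘(ℂ, W) ∞ (fun p : M × N ↦ Q p.1 p.2) (x, y))
    (v : F) (w : F') :
    vderiv F (fun x' ↦ vderiv F' (Q x') y w) x v =
      vderiv F' (fun y' ↦ vderiv F (fun x' ↦ Q x' y') x v) y w := by
  have hswap : ContMDiffAt (𝓘(ℂ, F').prod 𝓘(ℂ, F)) (𝓘(ℂ, F).prod 𝓘(ℂ, F')) ∞
      (fun p : N × M ↦ (p.2, p.1)) (y, x) := contMDiffAt_snd.prodMk contMDiffAt_fst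
  have hQ' : ContMDiffAt (𝓘(ℂ, F').prod 𝓘(ℂ, F)) 𝓘(ℂ, W) ∞
      (fun p : N × M ↦ (fun y' x' ↦ Q x' y') p.1 p.2) (y, x) :=
    ContMDiffAt.comp (I' := 𝓘(ℂ, F).prod 𝓘(ℂ, F')) (y, x) (f := fun p : N × M ↦ (p.2, p.1)) hQ
      hswap
  set a := extChartAt 𝓘(ℂ, F) x x with ha
  set b := extChartAt 𝓘(ℂ, F') y y with hb
  set q : F × F' → W := chartFun Q x y with hq
  have hqs := contDiffAt_chartFun hQ
  have hd2 : HasFDerivAt (fderiv ℂ q) (fderiv ℂ (fderiv ℂ q) (a, b)) (a, b) :=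
    ((hqs.fderiv_right (m := ∞) le_rfl).differentiableAt (by simp)).hasFDerivAt
  have hsymm := hqs.isSymmSndFDerivAt
    (by rw [minSmoothness_of_isRCLikeNormedField]; exact ENat.LEInfty.out)
  have h1 : vderiv F (fun x' ↦ vderiv F' (Q x') y w) x v
      = fderiv ℂ (fderiv ℂ q) (a, b) (v, 0) (0, w) := by
    have h2 : HasFDerivAt (fun a' : F ↦ fderiv ℂ q (a', b) ((0 : F), w))
        (((ContinuousLinearMap.apply ℂ W ((0 : F), w)).comp
          (fderiv ℂ (fderiv ℂ q) (a, b))).comp (ContinuousLinearMap.inl ℂ F F')) a :=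
      HasFDerivAt.comp (f := fun e : F ↦ (e, b)) a
        ((ContinuousLinearMap.apply ℂ W ((0 : F), w)).hasFDerivAt.comp (a, b) hd2)
        (hasFDerivAt_prodMk_left a b)
    have h3 := (hasMFDerivAt_comp_extChartAt h2).congr_of_eventuallyEq
      ((vderiv_eventuallyEq_chartFun hQ).fun_comp fun T : F' →L[ℂ] W ↦ T w)
    exact DFunLike.congr_fun h3.mfderiv v
  have h4 : vderiv F' (fun y' ↦ vderiv F (fun x' ↦ Q x' y') x v) y w
      = fderiv ℂ (fderiv ℂ q) (a, b) (0, w) (v, 0) := by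
    have h5 : ∀ b' : F', fderiv ℂ (chartFun (fun y' x' ↦ Q x' y') y x) (b', a) (0, v)
        = fderiv ℂ q (a, b') (v, 0) := by
      intro b'
      have h6 : chartFun (fun y' x' ↦ Q x' y') y x
          = q ∘ (ContinuousLinearEquiv.prodComm ℂ F' F) := rfl
      rw [h6, ContinuousLinearEquiv.comp_right_fderiv]
      rfl
    have h2 : HasFDerivAt (fun b' : F' ↦ fderiv ℂ q (a, b') (v, (0 : F')))
        (((ContinuousLinearMap.apply ℂ W (v, (0 : F'))).comp
          (fderiv ℂ (fderiv ℂ q) (a, b))).comp (ContinuousLinearMap.inr ℂ F F')) b :=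
      HasFDerivAt.comp (f := fun e : F' ↦ (a, e)) b
        ((ContinuousLinearMap.apply ℂ W (v, (0 : F'))).hasFDerivAt.comp (a, b) hd2)
        (hasFDerivAt_prodMk_right a b)
    have h3 := (hasMFDerivAt_comp_extChartAt h2).congr_of_eventuallyEq
      (((vderiv_eventuallyEq_chartFun hQ').fun_comp fun T : F →L[ℂ] W ↦ T v).trans
        (.of_forall fun y' ↦ h5 _))
    exact DFunLike.congr_fun h3.mfderiv w
  rw [h1, h4, hsymm.eq]

end PartialDerivatives

/-! ### Derivatives as maps between fixed model spaces. -/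

section ModelDerivatives

variable {F : Type*} [NormedAddCommGroup F] [NormedSpace ℂ F]
  {F' : Type*} [NormedAddCommGroup F'] [NormedSpace ℂ F']
  {F'' : Type*} [NormedAddCommGroup F''] [NormedSpace ℂ F'']
  {M : Type*} [TopologicalSpace M] [ChartedSpace F M]
  {N : Type*} [TopologicalSpace N] [ChartedSpace F' N]
  {P : Type*} [TopologicalSpace P] [ChartedSpace F'' P]
  {W : Type*} [NormedAddCommGroup W] [NormedSpace ℂ W]
  {W' : Type*} [NormedAddCommGroup W'] [NormedSpace ℂ W']

variable (F F') in
/-- The derivative of a map of manifolds, as a linear map between the model spaces. -/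
def tderiv (f : M → N) (x : M) : F →L[ℂ] F' := mfderiv 𝓘(ℂ, F) 𝓘(ℂ, F') f x

theorem tderiv_comp {g : N → P} {f : M → N} {x : M} (hg : MDiffAt g (f x)) (hf : MDiffAt f x) :
    tderiv F F'' (fun y ↦ g (f y)) x = (tderiv F' F'' g (f x)).comp (tderiv F F' f x) :=
  mfderiv_comp x hg hf

theorem tderiv_comp_of_eq {g : N → P} {f : M → N} {x : M} {y : N} (hg : MDiffAt g y)
    (hf : MDiffAt f x) (hy : f x = y) :
    tderiv F F'' (fun y ↦ g (f y)) x = (tderiv F' F'' g y).comp (tderiv F F' f x) := by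
  subst hy
  exact tderiv_comp hg hf

theorem vderiv_comp {g : N → W} {f : M → N} {x : M} (hg : MDiffAt g (f x)) (hf : MDiffAt f x) :
    vderiv F (fun y ↦ g (f y)) x = (vderiv F' g (f x)).comp (tderiv F F' f x) :=
  mfderiv_comp x hg hf

theorem vderiv_comp_of_eq {g : N → W} {f : M → N} {x : M} {y : N} (hg : MDiffAt g y)
    (hf : MDiffAt f x) (hy : f x = y) :
    vderiv F (fun y ↦ g (f y)) x = (vderiv F' g y).comp (tderiv F F' f x) := by
  subst hy
  exact vderiv_comp hg hf

/-- `g'` is the derivative of the vector-valued function `g` at `x`. -/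
def HasVDerivAt (g : M → W) (x : M) (g' : F →L[ℂ] W) : Prop :=
  HasMFDerivAt 𝓘(ℂ, F) 𝓘(ℂ, W) g x g'

theorem hasVDerivAt_iff {g : M → W} {x : M} {g' : F →L[ℂ] W} :
    HasVDerivAt g x g' ↔
      ContinuousAt g x ∧ HasFDerivAt (g ∘ (chartAt F x).symm) g' (chartAt F x x) :=
  hasMFDerivAt_iff_hasFDerivAt

theorem hasVDerivAt_vderiv {g : M → W} {x : M} (hg : MDiffAt g x) :
    HasVDerivAt g x (vderiv F g x) :=
  hg.hasMFDerivAt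

theorem HasVDerivAt.vderiv {g : M → W} {x : M} {g' : F →L[ℂ] W}
    (hg : HasVDerivAt g x g') : vderiv F g x = g' :=
  HasMFDerivAt.mfderiv hg

theorem vderiv_congr {g g' : M → W} {x : M} (h : g =ᶠ[𝓝 x] g') :
    vderiv F g x = vderiv F g' x :=
  ContinuousLinearMap.ext fun v ↦ DFunLike.congr_fun (h.mfderiv_eq) v

theorem tderiv_congr {g g' : M → N} {x : M} (h : g =ᶠ[𝓝 x] g') :
    tderiv F F' g x = tderiv F F' g' x :=
  ContinuousLinearMap.ext fun v ↦ DFunLike.congr_fun (h.mfderiv_eq) v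

/-- The chain rule, for a function on a vector space. -/
theorem vderiv_comp_fderiv {g : W → W'} {f : M → W} {x : M} {g' : W →L[ℂ] W'}
    (hg : HasFDerivAt g g' (f x)) (hf : MDiffAt f x) :
    vderiv F (fun y ↦ g (f y)) x = g'.comp (vderiv F f x) :=
  HasVDerivAt.vderiv (HasMFDerivAt.comp x hg.hasMFDerivAt (hasVDerivAt_vderiv hf))

theorem vderiv_clm_comp (T : W →L[ℂ] W') {f : M → W} {x : M} (hf : MDiffAt f x) :
    vderiv F (fun y ↦ T (f y)) x = T.comp (vderiv F f x) :=
  vderiv_comp_fderiv T.hasFDerivAt hf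

theorem vderiv_clm_apply {f : M → W →L[ℂ] W'} {g : M → W} {x : M} (hf : MDiffAt f x)
    (hg : MDiffAt g x) (v : F) :
    vderiv F (fun y ↦ f y (g y)) x v = f x (vderiv F g x v) + vderiv F f x v (g x) := by
  have h1 := hasVDerivAt_iff.1 (hasVDerivAt_vderiv hf)
  have h2 := hasVDerivAt_iff.1 (hasVDerivAt_vderiv hg)
  have h3 := h1.2.clm_apply h2.2
  have h4 : HasVDerivAt (fun y ↦ f y (g y)) x _ :=
    hasVDerivAt_iff.2 ⟨h1.1.clm_apply h2.1, h3⟩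
  rw [h4.vderiv]
  simp

theorem vderiv_mul {f g : M → W →L[ℂ] W} {x : M}
    (hf : MDiffAt f x) (hg : MDiffAt g x) (v : F) :
    vderiv F (fun y ↦ f y * g y) x v = f x * vderiv F g x v + vderiv F f x v * g x := by
  have h1 := hasVDerivAt_iff.1 (hasVDerivAt_vderiv hf)
  have h2 := hasVDerivAt_iff.1 (hasVDerivAt_vderiv hg)
  have h3 := h1.2.mul' h2.2
  have h4 : HasVDerivAt (fun y ↦ f y * g y) x _ := hasVDerivAt_iff.2 ⟨h1.1.mul h2.1, h3⟩
  rw [h4.vderiv]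
  simp

theorem vderiv_extChartAt (x : M) :
    vderiv F (extChartAt 𝓘(ℂ, F) x) x = ContinuousLinearMap.id ℂ F :=
  HasVDerivAt.vderiv (hasMFDerivAt_comp_extChartAt (g := id) (hasFDerivAt_id _))

end ModelDerivatives

/-! ### The adjoint action and left invariant derivatives. -/

section Adjoint

set_option linter.unusedSectionVars false

variable {E : Type*} [NormedAddCommGroup E] [NormedSpace ℂ E]
  {G : Type*} [TopologicalSpace G] [ChartedSpace E G] [Group G] [LieGroup 𝓘(ℂ, E) ∞ G]
  {W : Type*} [NormedAddCommGroup W] [NormedSpace ℂ W]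

theorem mdifferentiableAt_mul_left (g x : G) :
    MDifferentiableAt 𝓘(ℂ, E) 𝓘(ℂ, E) (fun y : G ↦ g * y) x :=
  (contMDiff_mul_left (n := ∞)).mdifferentiable (by simp) x

theorem mdifferentiableAt_mul_right (g x : G) :
    MDifferentiableAt 𝓘(ℂ, E) 𝓘(ℂ, E) (fun y : G ↦ y * g) x :=
  (contMDiff_mul_right (n := ∞)).mdifferentiable (by simp) x

theorem contMDiff_conj (g : G) : ContMDiff 𝓘(ℂ, E) 𝓘(ℂ, E) ∞ (fun y : G ↦ g * y * g⁻¹) :=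
  contMDiff_mul_right.comp contMDiff_mul_left

theorem mdifferentiableAt_conj (g x : G) :
    MDifferentiableAt 𝓘(ℂ, E) 𝓘(ℂ, E) (fun y : G ↦ g * y * g⁻¹) x :=
  (contMDiff_conj g).mdifferentiable (by simp) x

variable (E) in
/-- The adjoint action, as an operator on the model space. -/
def AdM (g : G) : E →L[ℂ] E := tderiv E E (fun x : G ↦ g * x * g⁻¹) 1

theorem AdM_mul (g h : G) : AdM E (g * h) = AdM E g * AdM E h := by
  have h1 : (fun x : G ↦ g * h * x * (g * h)⁻¹) = fun x ↦ g * (h * x * h⁻¹) * g⁻¹ := by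
    ext x; group
  rw [AdM, h1]
  exact tderiv_comp_of_eq (g := fun y : G ↦ g * y * g⁻¹) (mdifferentiableAt_conj g 1)
    (mdifferentiableAt_conj h 1) (by simp)

theorem tderiv_id {F M : Type*} [NormedAddCommGroup F] [NormedSpace ℂ F] [TopologicalSpace M]
    [ChartedSpace F M] (x : M) : tderiv F F (fun y : M ↦ y) x = ContinuousLinearMap.id ℂ F :=
  mfderiv_id

theorem AdM_one : AdM E (1 : G) = 1 := by
  have h1 : (fun x : G ↦ 1 * x * 1⁻¹) = fun x ↦ x := by ext x; simp
  rw [AdM, h1]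
  exact tderiv_id 1

theorem AdM_inv_mul (g : G) : AdM E g⁻¹ * AdM E g = 1 := by
  rw [← AdM_mul, inv_mul_cancel, AdM_one]

theorem contMDiffAt_extChartAt_one :
    ContMDiffAt 𝓘(ℂ, E) 𝓘(ℂ, E) ∞ (extChartAt 𝓘(ℂ, E) (1 : G)) 1 :=
  contMDiffAt_extChartAt

/-- Writes Ad g as a partial derivative of a function with values in a fixed vector space; its
holomorphy then follows from `contMDiffAt_vderiv_partial`. -/
theorem AdM_eq_vderiv (g : G) :
    AdM E g = vderiv E (fun x : G ↦ extChartAt 𝓘(ℂ, E) (1 : G) (g * x * g⁻¹)) 1 := by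
  rw [vderiv_comp_of_eq (contMDiffAt_extChartAt_one.mdifferentiableAt (by simp))
    (mdifferentiableAt_conj g 1) (by simp), vderiv_extChartAt]
  rfl

theorem contMDiff_AdM : ContMDiff 𝓘(ℂ, E) 𝓘(ℂ, E →L[ℂ] E) ∞ (AdM E : G → E →L[ℂ] E) := by
  intro g
  have h1 : (AdM E : G → E →L[ℂ] E) =
      fun g ↦ vderiv E (fun x : G ↦ extChartAt 𝓘(ℂ, E) (1 : G) (g * x * g⁻¹)) 1 :=
    funext AdM_eq_vderiv
  rw [h1]
  refine contMDiffAt_vderiv_partial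
    (Q := fun g x : G ↦ extChartAt 𝓘(ℂ, E) (1 : G) (g * x * g⁻¹)) ?_
  have h2 : ContMDiffAt (𝓘(ℂ, E).prod 𝓘(ℂ, E)) 𝓘(ℂ, E) ∞
      (fun p : G × G ↦ p.1 * p.2 * p.1⁻¹) (g, 1) :=
    (contMDiffAt_fst.mul contMDiffAt_snd).mul contMDiffAt_fst.inv
  refine ContMDiffAt.comp (g, 1) (f := fun p : G × G ↦ p.1 * p.2 * p.1⁻¹) ?_ h2
  simp only [mul_one, mul_inv_cancel]
  exact contMDiffAt_extChartAt_one

theorem mdifferentiable_AdM : MDifferentiable 𝓘(ℂ, E) 𝓘(ℂ, E →L[ℂ] E) (AdM E : G → E →L[ℂ] E) :=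
  contMDiff_AdM.mdifferentiable (by simp)

variable (E) in
/-- The derivative of `f` at `g` in the direction of the left invariant vector fields. -/
def lderiv (f : G → W) (g : G) : E →L[ℂ] W := vderiv E (fun h ↦ f (g * h)) 1

theorem lderiv_eq_comp {f : G → W} {g : G} (hf : MDifferentiableAt 𝓘(ℂ, E) 𝓘(ℂ, W) f g) :
    lderiv E f g = (vderiv E f g).comp (tderiv E E (fun h ↦ g * h) 1) :=
  vderiv_comp_of_eq hf (mdifferentiableAt_mul_left g 1) (mul_one g)

theorem lderiv_one (f : G → W) : lderiv E f 1 = vderiv E f 1 := by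
  simp only [lderiv, one_mul]

/-- A function is determined by its left invariant derivatives. -/
theorem vderiv_eq_comp_lderiv {f : G → W} {g : G} (hf : MDifferentiableAt 𝓘(ℂ, E) 𝓘(ℂ, W) f g) :
    vderiv E f g = (lderiv E f g).comp (tderiv E E (fun h ↦ g⁻¹ * h) g) := by
  rw [lderiv_eq_comp hf, ContinuousLinearMap.comp_assoc,
    ← tderiv_comp_of_eq (mdifferentiableAt_mul_left g 1) (mdifferentiableAt_mul_left g⁻¹ g)
      (inv_mul_cancel g)]
  have h1 : (fun y : G ↦ g * (g⁻¹ * y)) = fun y ↦ y := by ext y; simp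
  rw [h1, tderiv_id, ContinuousLinearMap.comp_id]

end Adjoint

/-! ### The derivative of Ad is ad, and Ad acts by automorphisms. -/

section Bracket

variable {E : Type*} [NormedAddCommGroup E] [NormedSpace ℂ E] [FiniteDimensional ℂ E]
  [CompleteSpace E]
  {G : Type*} [TopologicalSpace G] [ChartedSpace E G] [Group G] [LieGroup 𝓘(ℂ, E) ∞ G]
  {W : Type*} [NormedAddCommGroup W] [NormedSpace ℂ W]

variable (E G) in
/-- The Lie bracket of `T₁G`, as a bilinear map on the model space. -/
def adM : E →L[ℂ] E →L[ℂ] E :=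
  LinearMap.toContinuousBilinearMap (LinearMap.mk₂ ℂ
    (fun x y : E ↦ (Bracket.bracket (L := GroupLieAlgebra 𝓘(ℂ, E) G)
      (M := GroupLieAlgebra 𝓘(ℂ, E) G) x y : E))
    (fun x y z ↦ add_lie (L := GroupLieAlgebra 𝓘(ℂ, E) G) (M := GroupLieAlgebra 𝓘(ℂ, E) G) x y z)
    (fun c x y ↦ smul_lie (R := ℂ) (L := GroupLieAlgebra 𝓘(ℂ, E) G)
      (M := GroupLieAlgebra 𝓘(ℂ, E) G) c x y)
    (fun x y z ↦ lie_add (L := GroupLieAlgebra 𝓘(ℂ, E) G) (M := GroupLieAlgebra 𝓘(ℂ, E) G) x y z)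
    (fun c x y ↦ lie_smul (R := ℂ) (L := GroupLieAlgebra 𝓘(ℂ, E) G)
      (M := GroupLieAlgebra 𝓘(ℂ, E) G) c x y))

theorem adM_adM (x y : E) : adM E G (adM E G x y) =
    adM E G x * adM E G y - adM E G y * adM E G x := by
  ext z
  have h := lie_lie (L := GroupLieAlgebra 𝓘(ℂ, E) G) (M := GroupLieAlgebra 𝓘(ℂ, E) G) x y z
  exact h

/-- The bracket is the commutator of left invariant derivatives. -/
theorem vderiv_adM {f : G → W} (hf : ContMDiffAt 𝓘(ℂ, E) 𝓘(ℂ, W) ∞ f 1) (x y : E) :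
    vderiv E f 1 (adM E G x y) = vderiv E (fun g ↦ lderiv E f g y) 1 x -
      vderiv E (fun g ↦ lderiv E f g x) 1 y := by
  have h1 := mvfderiv_mlieBracket hf
    (mdifferentiableAt_mulInvariantVectorField (x : GroupLieAlgebra 𝓘(ℂ, E) G))
    (mdifferentiableAt_mulInvariantVectorField (y : GroupLieAlgebra 𝓘(ℂ, E) G))
  have h2 : ∀ z : E, vderiv E (fun g ↦ lderiv E f g z) 1 =
      vderiv E (fun g : G ↦ mvfderiv 𝓘(ℂ, E) f g
        (mulInvariantVectorField (z : GroupLieAlgebra 𝓘(ℂ, E) G) g)) 1 := by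
    intro z
    refine vderiv_congr ?_
    filter_upwards [eventually_mdifferentiableAt hf] with g hg
    rw [lderiv_eq_comp hg]
    rfl
  have h3 : ∀ z : E,
      (mulInvariantVectorField (I := 𝓘(ℂ, E)) (G := G) z (1 : G) : E) = z := by
    intro z
    have h4 : tderiv E E (fun h : G ↦ 1 * h) 1 = ContinuousLinearMap.id ℂ E := by
      simp only [one_mul]
      exact tderiv_id 1
    exact DFunLike.congr_fun h4 z
  rw [h2, h2]
  refine h1.trans ?_
  exact congrArg₂ (· - ·) (congrArg (vderiv E _ 1) (h3 x)) (congrArg (vderiv E _ 1) (h3 y))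

/-- The derivative of `Ad` at `1` is `ad`. -/
theorem vderiv_AdM_one (x : E) : vderiv E (AdM E : G → E →L[ℂ] E) 1 x = adM E G x := by
  ext y
  set κ := extChartAt 𝓘(ℂ, E) (1 : G) with hκ
  have hκs : ContMDiffAt 𝓘(ℂ, E) 𝓘(ℂ, E) ∞ κ 1 := contMDiffAt_extChartAt_one
  have hmul : ContMDiffAt (𝓘(ℂ, E).prod 𝓘(ℂ, E)) 𝓘(ℂ, E) ∞
      (fun p : G × G ↦ κ (p.2 * p.1)) (1, 1) := by
    have h2 : ContMDiffAt (𝓘(ℂ, E).prod 𝓘(ℂ, E)) 𝓘(ℂ, E) ∞ (fun p : G × G ↦ p.2 * p.1) (1, 1) :=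
      contMDiffAt_snd.mul contMDiffAt_fst
    refine ContMDiffAt.comp (1, 1) (f := fun p : G × G ↦ p.2 * p.1) ?_ h2
    simp only [mul_one]
    exact hκs
  -- `r g` is the derivative of right translation in the chart, so a left invariant derivative of
  -- `κ` is r(g) ∘ Ad g. In the product rule at 1, interchanging mixed derivatives turns the term
  -- with r' into the second term of `vderiv_adM`; what remains is Ad'.
  let r : G → E →L[ℂ] E := fun g ↦ vderiv E (fun h ↦ κ (h * g)) 1
  have hr : MDifferentiableAt 𝓘(ℂ, E) 𝓘(ℂ, E →L[ℂ] E) r 1 :=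
    (contMDiffAt_vderiv_partial (Q := fun g h ↦ κ (h * g)) hmul).mdifferentiableAt (by simp)
  have hr1 : r 1 = ContinuousLinearMap.id ℂ E := by
    simp only [r, mul_one]
    exact vderiv_extChartAt 1
  have hlr : (fun g ↦ lderiv E κ g y) =ᶠ[𝓝 1] fun g ↦ r g (AdM E g y) := by
    filter_upwards [eventually_mdifferentiableAt hκs] with g hg
    have h5 : (fun h ↦ κ (g * h)) = fun h ↦ (fun k ↦ κ (k * g)) (g * h * g⁻¹) := by
      ext h; simp
    have h6 : MDifferentiableAt 𝓘(ℂ, E) 𝓘(ℂ, E) (fun k ↦ κ (k * g)) 1 :=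
      MDifferentiableAt.comp (1 : G) (f := fun k ↦ k * g) (g := κ) (by rwa [one_mul])
        (mdifferentiableAt_mul_right g 1)
    rw [lderiv, h5, vderiv_comp_of_eq h6 (mdifferentiableAt_conj g 1) (by simp)]
    rfl
  have hAdy : MDifferentiableAt 𝓘(ℂ, E) 𝓘(ℂ, E) (fun g : G ↦ AdM E g y) 1 :=
    (mdifferentiable_AdM 1).clm_apply mdifferentiableAt_const
  have h7 : vderiv E (fun g : G ↦ AdM E g y) 1 x = vderiv E (AdM E : G → E →L[ℂ] E) 1 x y := by
    rw [vderiv_clm_apply (mdifferentiable_AdM 1) mdifferentiableAt_const]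
    have : vderiv E (fun _ : G ↦ y) 1 = 0 := mfderiv_const
    rw [this]
    simp
  have h8 : vderiv E r 1 x y = vderiv E (fun g ↦ lderiv E κ g x) 1 y := by
    have h9 := vderiv_vderiv_comm (Q := fun g h : G ↦ κ (h * g)) hmul x y
    have h10 : vderiv E (fun g ↦ r g y) 1 x = vderiv E r 1 x y := by
      rw [vderiv_clm_apply hr mdifferentiableAt_const]
      have : vderiv E (fun _ : G ↦ y) 1 = 0 := mfderiv_const
      rw [this]
      simp
    rw [← h10]
    exact h9
  have h11 := vderiv_adM hκs x y
  rw [vderiv_congr hlr, vderiv_clm_apply hr hAdy, hr1, h7, AdM_one, one_apply_eq_self, h8,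
    vderiv_extChartAt] at h11
  simpa using h11.symm

/-- The left invariant derivative of `Ad`. -/
theorem lderiv_AdM (g : G) (x : E) : lderiv E (AdM E : G → E →L[ℂ] E) g x
    = AdM E g * adM E G x := by
  have h1 : (fun h : G ↦ AdM E (g * h)) = fun h ↦
      ContinuousLinearMap.mul ℂ (E →L[ℂ] E) (AdM E g) (AdM E h) := by
    ext1 h
    exact AdM_mul g h
  rw [lderiv, h1, vderiv_clm_comp _ (mdifferentiable_AdM 1), ContinuousLinearMap.comp_apply,
    vderiv_AdM_one]
  rfl

/-- Derivative at h = 1 of Ad(g h g⁻¹) = Ad(g h) Ad(g⁻¹). -/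
theorem adM_AdM (g : G) (x : E) : adM E G (AdM E g x) * AdM E g = AdM E g * adM E G x := by
  have h1 : vderiv E (fun h : G ↦ AdM E (g * h * g⁻¹)) 1 x = adM E G (AdM E g x) := by
    rw [vderiv_comp_of_eq (mdifferentiable_AdM 1) (mdifferentiableAt_conj g 1) (by simp),
      ContinuousLinearMap.comp_apply, vderiv_AdM_one]
    rfl
  have h2 : (fun h : G ↦ AdM E (g * h * g⁻¹)) = fun h ↦
      ((ContinuousLinearMap.mul ℂ (E →L[ℂ] E)).flip (AdM E g⁻¹)) (AdM E (g * h)) := by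
    ext1 h
    exact AdM_mul (g * h) g⁻¹
  have h3 : MDifferentiableAt 𝓘(ℂ, E) 𝓘(ℂ, E →L[ℂ] E) (fun h : G ↦ AdM E (g * h)) 1 :=
    MDifferentiableAt.comp (1 : G) (f := fun h ↦ g * h) (mdifferentiable_AdM _)
      (mdifferentiableAt_mul_left g 1)
  rw [h2, vderiv_clm_comp _ h3, ContinuousLinearMap.comp_apply] at h1
  have h4 := lderiv_AdM g x
  rw [lderiv] at h4
  rw [h4] at h1
  rw [← h1]
  change AdM E g * adM E G x * AdM E g⁻¹ * AdM E g = _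
  rw [mul_assoc, AdM_inv_mul, mul_one]

theorem AdM_adM (g : G) (x y : E) :
    AdM E g (adM E G x y) = adM E G (AdM E g x) (AdM E g y) :=
  (DFunLike.congr_fun (adM_AdM g x) y).symm

end Bracket

/-! ### Consequences of a non-degenerate Killing form: trivial center, inner derivations. -/

section Derivations

variable {L : Type*} [LieRing L] [LieAlgebra ℂ L] [FiniteDimensional ℂ L]
  [LieAlgebra.IsKilling ℂ L]

theorem eq_of_forall_lie_eq {x y : L} (h : ∀ z : L, ⁅x, z⁆ = ⁅y, z⁆) : x = y := by
  refine (LieDerivation.injective_ad_of_center_eq_bot (R := ℂ) (L := L)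
    (LieAlgebra.center_eq_bot _ _)) ?_
  exact LieDerivation.ext fun z ↦ by simpa using h z

theorem exists_eq_lie_of_derivation (D : L →ₗ[ℂ] L)
    (hD : ∀ x y, D ⁅x, y⁆ = ⁅D x, y⁆ + ⁅x, D y⁆) : ∃ z : L, ∀ w : L, D w = ⁅z, w⁆ := by
  let D₂ : LieDerivation ℂ L L :=
    { D with
      leibniz' := fun x y ↦ by
        rw [← lie_skew y, sub_neg_eq_add, add_comm]
        exact hD x y }
  obtain ⟨z, hz⟩ := LieDerivation.IsKilling.exists_eq_ad D₂
  refine ⟨z, fun w ↦ ?_⟩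
  have h := DFunLike.congr_fun hz w
  rw [LieDerivation.ad_apply_apply] at h
  exact h.symm

end Derivations

/-! ### Logarithmic coordinates on G and local integration of representations. -/

section Logarithm

set_option linter.unusedSectionVars false

open NormedSpace

variable {E : Type*} [NormedAddCommGroup E] [NormedSpace ℂ E] [FiniteDimensional ℂ E]
  [CompleteSpace E]
  {G : Type*} [TopologicalSpace G] [ChartedSpace E G] [Group G] [LieGroup 𝓘(ℂ, E) ∞ G]

theorem adM_injective [LieAlgebra.IsKilling ℂ (GroupLieAlgebra 𝓘(ℂ, E) G)] :
    Function.Injective (adM E G) := by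
  have : FiniteDimensional ℂ (GroupLieAlgebra 𝓘(ℂ, E) G) := inferInstanceAs (FiniteDimensional ℂ E)
  exact fun x y hxy ↦ eq_of_forall_lie_eq (L := GroupLieAlgebra 𝓘(ℂ, E) G)
    fun z ↦ DFunLike.congr_fun hxy z

theorem exists_eq_adM_of_derivation [LieAlgebra.IsKilling ℂ (GroupLieAlgebra 𝓘(ℂ, E) G)]
    (D : E →L[ℂ] E) (hD : ∀ x y, D (adM E G x y) = adM E G (D x) y + adM E G x (D y)) :
    ∃ z, D = adM E G z := by
  have : FiniteDimensional ℂ (GroupLieAlgebra 𝓘(ℂ, E) G) := inferInstanceAs (FiniteDimensional ℂ E)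
  obtain ⟨z, hz⟩ := exists_eq_lie_of_derivation (L := GroupLieAlgebra 𝓘(ℂ, E) G) D.toLinearMap hD
  exact ⟨z, ContinuousLinearMap.ext hz⟩

variable (E G) in
/-- Logarithmic coordinates near the identity: `Ad g = exp (ad (l g))`. -/
structure IsLogChart (N : Set G) (l : G → E) : Prop where
  isOpen : IsOpen N
  one_mem : 1 ∈ N
  contMDiffOn : ContMDiffOn 𝓘(ℂ, E) 𝓘(ℂ, E) ∞ l N
  map_one : l 1 = 0
  AdM_eq : ∀ g ∈ N, AdM E g = exp (adM E G (l g))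

/-- Composes Ad with the logarithm of automorphisms of 𝔤 near 1. The resulting l plays the role of
the inverse of the exponential map of G. -/
theorem exists_isLogChart [LieAlgebra.IsKilling ℂ (GroupLieAlgebra 𝓘(ℂ, E) G)] :
    ∃ (N : Set G) (l : G → E), IsLogChart E G N l := by
  obtain ⟨U, l, hU, h1, hl, hl1, hlog⟩ := exists_log_of_automorphism (ad := adM E G)
    adM_adM exists_eq_adM_of_derivation adM_injective
  refine ⟨AdM E ⁻¹' U, fun g ↦ l (AdM E g), hU.preimage contMDiff_AdM.continuous, ?_, ?_, ?_, ?_⟩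
  · rw [Set.mem_preimage, AdM_one]; exact h1
  · exact (contMDiffOn_iff_contDiffOn.2 hl).comp contMDiff_AdM.contMDiffOn subset_rfl
  · rw [AdM_one, hl1]
  · exact fun g hg ↦ hlog _ hg (AdM_adM g)

variable {N : Set G} {l : G → E}

theorem IsLogChart.mdifferentiableAt (hl : IsLogChart E G N l) {g : G} (hg : g ∈ N) :
    MDifferentiableAt 𝓘(ℂ, E) 𝓘(ℂ, E) l g :=
  (hl.contMDiffOn.contMDiffAt (hl.isOpen.mem_nhds hg)).mdifferentiableAt (by simp)

theorem IsLogChart.mdifferentiableAt_mul (hl : IsLogChart E G N l) {g : G} (hg : g ∈ N) :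
    MDifferentiableAt 𝓘(ℂ, E) 𝓘(ℂ, E) (fun h ↦ l (g * h)) 1 :=
  MDifferentiableAt.comp (1 : G) (f := fun h ↦ g * h) (g := l)
    (by rw [mul_one]; exact hl.mdifferentiableAt hg) (mdifferentiableAt_mul_left g 1)

theorem IsLogChart.eventually_mul_mem (hl : IsLogChart E G N l) {g : G} (hg : g ∈ N) :
    ∀ᶠ h in 𝓝 (1 : G), g * h ∈ N := by
  have hc : ContinuousAt (fun h ↦ g * h) (1 : G) :=
    (mdifferentiableAt_mul_left (E := E) g 1).continuousAt
  exact hc (hl.isOpen.mem_nhds (by simpa using hg))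

theorem vderiv_exp_comp {A : Type*} [NormedRing A] [NormedAlgebra ℂ A] [CompleteSpace A]
    (R : E →L[ℂ] A) {k : G → E} {g : G} (hk : MDifferentiableAt 𝓘(ℂ, E) 𝓘(ℂ, E) k g) (x : E) :
    vderiv E (fun h ↦ exp (R (k h))) g x = fderiv ℂ exp (R (k g)) (R (vderiv E k g x)) := by
  have h1 : HasFDerivAt (fun y : E ↦ exp (R y)) ((fderiv ℂ exp (R (k g))).comp R) (k g) :=
    HasFDerivAt.comp (k g) ((contDiff_exp (n := 1)).differentiable one_ne_zero _).hasFDerivAt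
      R.hasFDerivAt
  rw [vderiv_comp_fderiv h1 hk]
  rfl

theorem fderiv_exp_prod {A B : Type*} [NormedRing A] [NormedAlgebra ℂ A] [CompleteSpace A]
    [NormedRing B] [NormedAlgebra ℂ B] [CompleteSpace B] (p q : A × B) :
    fderiv ℂ exp p q = (fderiv ℂ exp p.1 q.1, fderiv ℂ exp p.2 q.2) := by
  have h1 : (exp : A × B → A × B) = fun p ↦ (exp p.1, exp p.2) := by
    let _ := NormedAlgebra.restrictScalars ℚ ℂ A
    let _ := NormedAlgebra.restrictScalars ℚ ℂ B
    ext p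
    · exact Prod.fst_exp p
    · exact Prod.snd_exp p
  have h2 : HasFDerivAt (exp : A → A) (fderiv ℂ exp p.1) p.1 :=
    ((contDiff_exp (n := 1)).differentiable one_ne_zero _).hasFDerivAt
  have h3 : HasFDerivAt (exp : B → B) (fderiv ℂ exp p.2) p.2 :=
    ((contDiff_exp (n := 1)).differentiable one_ne_zero _).hasFDerivAt
  have h4 := HasFDerivAt.prodMap p h2 h3
  rw [h1]
  exact DFunLike.congr_fun (HasFDerivAt.fderiv h4) q

/-- Both sides are the left invariant derivative of Ad at g, computed from Ad = exp(ad l) and from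
`lderiv_AdM`. -/
theorem IsLogChart.exp_adM_mul (hl : IsLogChart E G N l) {g : G} (hg : g ∈ N) (x : E) :
    fderiv ℂ exp (adM E G (l g)) (adM E G (vderiv E (fun h ↦ l (g * h)) 1 x)) =
      exp (adM E G (l g)) * adM E G x := by
  have h1 := vderiv_exp_comp (adM E G) (hl.mdifferentiableAt_mul hg) x
  rw [mul_one] at h1
  rw [← h1, ← hl.AdM_eq g hg, ← lderiv_AdM, lderiv]
  refine DFunLike.congr_fun (vderiv_congr ?_) x
  filter_upwards [hl.eventually_mul_mem hg] with h hh
  exact (hl.AdM_eq _ hh).symm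

/-- A representation of the Lie algebra can be integrated locally. -/
theorem IsLogChart.lderiv_exp [LieAlgebra.IsKilling ℂ (GroupLieAlgebra 𝓘(ℂ, E) G)]
    (hl : IsLogChart E G N l) {B : Type*} [NormedRing B]
    [NormedAlgebra ℂ B] [FiniteDimensional ℂ B] {R : E →L[ℂ] B}
    (hR : ∀ x y, R (adM E G x y) = R x * R y - R y * R x) {g : G} (hg : g ∈ N) (x : E) :
    lderiv E (fun h ↦ exp (R (l h))) g x = exp (R (l g)) * R x := by
  have := FiniteDimensional.complete ℂ B
  set y := vderiv E (fun h ↦ l (g * h)) 1 x with hy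
  have h1 := vderiv_exp_comp R (hl.mdifferentiableAt_mul hg) x
  rw [mul_one, ← hy] at h1
  rw [lderiv, h1]
  -- Pairing R with ad makes one element `z` describe the derivative of exp in both representations.
  -- The ad component is known and ad is injective, so z = x.
  let S : E →L[ℂ] (E →L[ℂ] E) × B := (adM E G).prod R
  have hS : ∀ x y, S (adM E G x y) = S x * S y - S y * S x :=
    fun x y ↦ Prod.ext (adM_adM x y) (hR x y)
  obtain ⟨z, hz⟩ := exists_fderiv_exp_eq (A := (E →L[ℂ] E) × B) (ad := adM E G) (R := S) hS (l g) y
  rw [fderiv_exp_prod] at hz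
  have hz1 := congrArg Prod.fst hz
  have hz2 := congrArg Prod.snd hz
  let _ := NormedAlgebra.restrictScalars ℚ ℂ B
  let _ := NormedAlgebra.restrictScalars ℚ ℂ (E →L[ℂ] E)
  rw [Prod.fst_mul, Prod.fst_exp] at hz1
  rw [Prod.snd_mul, Prod.snd_exp] at hz2
  have h3 : exp (adM E G (l g)) * adM E G x = exp (adM E G (l g)) * adM E G z :=
    (hl.exp_adM_mul hg x).symm.trans hz1
  have h4 : x = z := adM_injective (G := G) (by
    have h5 := congrArg (fun T ↦ exp (-(adM E G (l g))) * T) h3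
    simp only [← mul_assoc, exp_neg_mul_exp, one_mul] at h5
    exact h5)
  rw [h4]
  exact hz2

theorem IsLogChart.vderiv_one [LieAlgebra.IsKilling ℂ (GroupLieAlgebra 𝓘(ℂ, E) G)]
    (hl : IsLogChart E G N l) : vderiv E l 1 = ContinuousLinearMap.id ℂ E := by
  ext x
  refine adM_injective (G := G) ?_
  have h1 := hl.exp_adM_mul hl.one_mem x
  simp only [hl.map_one, map_zero, one_mul, exp_zero] at h1
  rw [hasFDerivAt_exp_zero.fderiv] at h1
  exact h1

/-- One-parameter groups, defined near `0`. -/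
theorem exists_curve [LieAlgebra.IsKilling ℂ (GroupLieAlgebra 𝓘(ℂ, E) G)] (x : E) :
    ∃ (c : ℂ → G) (δ : ℝ), 0 < δ ∧ ContinuousOn c (Metric.ball 0 δ) ∧ c 0 = 1 ∧
      HasMFDerivAt 𝓘(ℂ, ℂ) 𝓘(ℂ, E) c 0 (ContinuousLinearMap.toSpanSingleton ℂ x) ∧
      ∀ t ∈ Metric.ball (0 : ℂ) δ, AdM E (c t) = exp (t • adM E G x) := by
  obtain ⟨N, l, hl⟩ := exists_isLogChart (E := E) (G := G)
  have hd : tderiv E E l 1 = ContinuousLinearMap.id ℂ E := hl.vderiv_one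
  have hbij : Function.Bijective (mfderiv 𝓘(ℂ, E) 𝓘(ℂ, E) l 1) := by
    change Function.Bijective (tderiv E E l 1)
    rw [hd]
    exact Function.bijective_id
  obtain ⟨Φ, h1Φ, hΦN, hΦ⟩ := exists_partialDiffeomorph hl.isOpen hl.contMDiffOn hl.one_mem hbij
  have hΦ1 : Φ 1 = 0 := by rw [hΦ 1 h1Φ, hl.map_one]
  have h0 : (0 : E) ∈ Φ.target := by rw [← hΦ1]; exact Φ.map_source h1Φ
  have hinv0 : Φ.invFun 0 = 1 := by rw [← hΦ1]; exact Φ.left_inv h1Φ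
  have hinv : ∀ y ∈ Φ.target, l (Φ.invFun y) = y := fun y hy ↦
    (hΦ _ (Φ.map_target hy)).symm.trans (Φ.right_inv hy)
  have hdi : MDifferentiableAt 𝓘(ℂ, E) 𝓘(ℂ, E) Φ.invFun 0 :=
    (Φ.contMDiffOn_invFun.contMDiffAt (Φ.open_target.mem_nhds h0)).mdifferentiableAt (by simp)
  have hti : tderiv E E Φ.invFun 0 = ContinuousLinearMap.id ℂ E := by
    have h2 : tderiv E E (fun y ↦ l (Φ.invFun y)) 0 = ContinuousLinearMap.id ℂ E := by
      rw [← tderiv_id (F := E) (M := E) 0]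
      refine tderiv_congr ?_
      filter_upwards [Φ.open_target.mem_nhds h0] with y hy using hinv y hy
    rwa [tderiv_comp_of_eq (hl.mdifferentiableAt hl.one_mem) hdi hinv0, hd,
      ContinuousLinearMap.id_comp] at h2
  have hline : ContinuousAt (fun t : ℂ ↦ t • x) 0 := by fun_prop
  obtain ⟨δ, hδ, hball⟩ := Metric.mem_nhds_iff.1
    (hline (Φ.open_target.mem_nhds (by simpa using h0)))
  refine ⟨fun t ↦ Φ.invFun (t • x), δ, hδ, ?_, ?_, ?_, ?_⟩
  · exact Φ.contMDiffOn_invFun.continuousOn.comp (by fun_prop) hball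
  · simp only [zero_smul]
    exact hinv0
  · have h3 : HasMFDerivAt 𝓘(ℂ, ℂ) 𝓘(ℂ, E) (fun t : ℂ ↦ t • x) 0
        (ContinuousLinearMap.toSpanSingleton ℂ x) :=
      (ContinuousLinearMap.toSpanSingleton ℂ x).hasFDerivAt.hasMFDerivAt
    have h4 : HasMFDerivAt 𝓘(ℂ, E) 𝓘(ℂ, E) Φ.invFun ((0 : ℂ) • x)
        (ContinuousLinearMap.id ℂ E) := by
      rw [zero_smul]
      exact hdi.hasMFDerivAt.congr_mfderiv hti
    exact HasMFDerivAt.comp (0 : ℂ) (f := fun t : ℂ ↦ t • x) h4 h3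
  · intro t ht
    have h5 : Φ.invFun (t • x) ∈ N := hΦN (Φ.map_target (hball ht))
    rw [hl.AdM_eq _ h5, hinv _ (hball ht), map_smul]

/-- Near the identity, the stabilizer of `v` consists of exponentials of its Lie algebra. -/
theorem IsLogChart.eventually_adM_eq_zero (hl : IsLogChart E G N l) :
    ∀ᶠ g in 𝓝 (1 : G), ∀ v, AdM E g v = v → adM E G (l g) v = 0 := by
  have hc : ContinuousAt (fun g ↦ adM E G (l g)) 1 :=
    (adM E G).continuous.continuousAt.comp (hl.mdifferentiableAt hl.one_mem).continuousAt
  have h0 : adM E G (l 1) = 0 := by rw [hl.map_one, map_zero]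
  rw [ContinuousAt, h0] at hc
  filter_upwards [hc.eventually eventually_apply_eq_zero_of_exp_apply_eq,
    hl.isOpen.mem_nhds hl.one_mem] with g hg hgN v hv
  exact hg v (by rwa [← hl.AdM_eq g hgN])

end Logarithm

/-! ### The monodromy principle on simply connected spaces. -/

section Monodromy

/-- On a simply connected space, functions that are given locally up to left multiplication by
constants can be glued together. -/
theorem exists_glue_of_simplyConnected {X : Type*} [TopologicalSpace X] [SimplyConnectedSpace X]
    [LocallyPathConnectedSpace X] {A : Type*} [Group A] {U : X → Set X} (hU : ∀ i, IsOpen (U i))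
    (hmem : ∀ i, i ∈ U i) (r : X → X → A)
    (hr : ∀ i j, ∀ x ∈ U i ∩ U j, ∀ᶠ y in 𝓝 x, r i y * (r j y)⁻¹ = r i x * (r j x)⁻¹)
    (x₀ : X) (a₀ : A) :
    ∃ s : X → A, s x₀ = a₀ ∧
      ∀ i, ∀ x ∈ U i, ∀ᶠ y in 𝓝 x, s y * (r i y)⁻¹ = s x * (r i x)⁻¹ := by
  let _ : TopologicalSpace A := ⊥
  have : DiscreteTopology A := ⟨rfl⟩
  -- The locally constant ratios of the local functions are the transition functions of a bundle
  -- with discrete fibre `A`.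
  let Z : FiberBundleCore X X A :=
    { baseSet := U
      isOpen_baseSet := hU
      indexAt := id
      mem_baseSet_at := hmem
      coordChange := fun i j x a ↦ a * (r i x * (r j x)⁻¹)
      coordChange_self := fun i x _ a ↦ by simp
      continuousOn_coordChange := by
        rintro i j ⟨x, a⟩ ⟨hx, -⟩
        refine ContinuousAt.continuousWithinAt ?_
        have h1 : ∀ᶠ p : X × A in 𝓝 (x, a), p.2 = a :=
          (continuous_snd.tendsto (x, a)).eventually
            ((isOpen_discrete {a}).mem_nhds (Set.mem_singleton a))
        have h2 : ∀ᶠ p : X × A in 𝓝 (x, a), r i p.1 * (r j p.1)⁻¹ = r i x * (r j x)⁻¹ :=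
          (continuous_fst.tendsto (x, a)).eventually (hr i j x hx)
        refine (continuousAt_const (y := a * (r i x * (r j x)⁻¹))).congr ?_
        filter_upwards [h1, h2] with p hp1 hp2
        rw [hp1, hp2]
      coordChange_comp := fun i j k x _ a ↦ by group }
  have hcov : IsCoveringMap Z.proj :=
    IsFiberBundle.isCoveringMap fun x ↦ ⟨Z.localTriv x, hmem x⟩
  -- The identity of the simply connected base lifts to the covering. In the chart i the lift is a
  -- locally constant left factor relating the glued function to `r i`.
  obtain ⟨S, ⟨hS0, hS⟩, -⟩ := hcov.existsUnique_continuousMap_lifts (ContinuousMap.id X) x₀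
    (⟨x₀, a₀ * (r x₀ x₀)⁻¹⟩ : Z.TotalSpace) rfl
  have hS1 : ∀ x, (S x).1 = x := fun x ↦ congrFun hS x
  let b : X → A := fun x ↦ (S x).2
  refine ⟨fun x ↦ b x * r x x, ?_, fun i x hx ↦ ?_⟩
  · have : b x₀ = a₀ * (r x₀ x₀)⁻¹ := by
      have h : ∀ p q : Z.TotalSpace, p = q → (p.2 : A) = q.2 := fun p q h ↦ by rw [h]
      exact h _ _ hS0
    simp [this]
  · have h1 : ContinuousAt (fun y ↦ ((Z.localTriv i) (S y)).2) x := by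
      refine continuous_snd.continuousAt.comp (ContinuousAt.comp ?_ S.continuous.continuousAt)
      refine (Z.localTriv i).continuousOn.continuousAt ((Z.localTriv i).open_source.mem_nhds ?_)
      rw [(Z.localTriv i).mem_source]
      change (S x).1 ∈ U i
      rw [hS1 x]
      exact hx
    have h2 : ∀ y, ((Z.localTriv i) (S y)).2 = b y * r y y * (r i y)⁻¹ := by
      intro y
      change b y * (r (S y).1 (S y).1 * (r i (S y).1)⁻¹) = _
      rw [hS1 y, mul_assoc]
    have h3 := h1.eventually (eventually_nhds_iff.2
      ⟨{((Z.localTriv i) (S x)).2}, fun _ h ↦ h, isOpen_discrete _, Set.mem_singleton _⟩)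
    filter_upwards [h3] with y hy
    rw [← h2 y, ← h2 x]
    exact hy

end Monodromy

/-! ### Operator-valued functions with a prescribed logarithmic derivative. -/

section Integration

open NormedSpace

set_option linter.unusedSectionVars false

variable {E : Type*} [NormedAddCommGroup E] [NormedSpace ℂ E]
  {G : Type*} [TopologicalSpace G] [ChartedSpace E G] [Group G] [LieGroup 𝓘(ℂ, E) ∞ G]
  {W : Type*} [NormedAddCommGroup W] [NormedSpace ℂ W]

/-- The left logarithmic derivative of `f` at `g` is `R`. -/
structure HasLogDerivAt (R : E →L[ℂ] (W →L[ℂ] W)) (f : G → W →L[ℂ] W) (g : G) : Prop where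
  mdifferentiableAt : MDifferentiableAt 𝓘(ℂ, E) 𝓘(ℂ, W →L[ℂ] W) f g
  lderiv_eq : ∀ x, lderiv E f g x = f g * R x

variable {R : E →L[ℂ] (W →L[ℂ] W)} {f f' : G → W →L[ℂ] W} {g : G}

theorem HasLogDerivAt.comp_mul_left {k : G} (hf : HasLogDerivAt R f (k * g)) :
    HasLogDerivAt R (fun x ↦ f (k * x)) g :=
  ⟨MDifferentiableAt.comp g (f := fun x ↦ k * x) hf.1 (mdifferentiableAt_mul_left k g),
    fun x ↦ by
      rw [← hf.lderiv_eq]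
      simp only [lderiv, mul_assoc]⟩

theorem HasLogDerivAt.const_mul (hf : HasLogDerivAt R f g) (C : W →L[ℂ] W) :
    HasLogDerivAt R (fun x ↦ C * f x) g := by
  have h : MDifferentiableAt 𝓘(ℂ, E) 𝓘(ℂ, W →L[ℂ] W) (fun x ↦ C * f x) g :=
    mdifferentiableAt_const.clm_comp hf.1
  refine ⟨h, fun x ↦ ?_⟩
  have h2 := hf.lderiv_eq x
  rw [lderiv_eq_comp hf.1] at h2
  have h3 : vderiv E (fun x ↦ C * f x) g = _ :=
    vderiv_clm_comp (ContinuousLinearMap.mul ℂ (W →L[ℂ] W) C) hf.1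
  rw [lderiv_eq_comp h, h3, mul_assoc, ← h2]
  rfl

theorem HasLogDerivAt.congr (hf : HasLogDerivAt R f g) (h : f' =ᶠ[𝓝 g] f) :
    HasLogDerivAt R f' g := by
  have h' : MDifferentiableAt 𝓘(ℂ, E) 𝓘(ℂ, W →L[ℂ] W) f' g := hf.1.congr_of_eventuallyEq h
  refine ⟨h', fun x ↦ ?_⟩
  rw [lderiv_eq_comp h', vderiv_congr h, ← lderiv_eq_comp hf.1, hf.lderiv_eq, h.eq_of_nhds]

/-- The derivative of f f'⁻¹ is f R f'⁻¹ - f f'⁻¹ (f' R) f'⁻¹ = 0. Solutions of the same equation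
therefore differ locally by a constant left factor. -/
theorem HasLogDerivAt.mul_inverse [CompleteSpace W] (hf : HasLogDerivAt R f g)
    (hf' : HasLogDerivAt R f' g) (hu : IsUnit (f' g)) :
    HasMFDerivAt 𝓘(ℂ, E) 𝓘(ℂ, W →L[ℂ] W) (fun y ↦ f y * Ring.inverse (f' y)) g
      (0 : E →L[ℂ] (W →L[ℂ] W)) := by
  obtain ⟨u, hu⟩ := hu
  have h1 : HasFDerivAt (Ring.inverse : (W →L[ℂ] W) → W →L[ℂ] W)
      (-ContinuousLinearMap.mulLeftRight ℂ (W →L[ℂ] W) ↑u⁻¹ ↑u⁻¹) (f' g) := by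
    rw [← hu]
    exact hasFDerivAt_ringInverse (𝕜 := ℂ) u
  have h2 : MDifferentiableAt 𝓘(ℂ, E) 𝓘(ℂ, W →L[ℂ] W) (fun y ↦ Ring.inverse (f' y)) g :=
    MDifferentiableAt.comp g (f := f') h1.hasMFDerivAt.mdifferentiableAt hf'.1
  have h3 : MDifferentiableAt 𝓘(ℂ, E) 𝓘(ℂ, W →L[ℂ] W) (fun y ↦ f y * Ring.inverse (f' y)) g :=
    hf.1.clm_comp h2
  have h5 : vderiv E (fun y ↦ f y * Ring.inverse (f' y)) g = 0 := by
    refine ContinuousLinearMap.ext fun x ↦ ?_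
    rw [vderiv_mul hf.1 h2, vderiv_comp_fderiv h1 hf'.1, vderiv_eq_comp_lderiv hf.1,
      vderiv_eq_comp_lderiv hf'.1]
    simp only [ContinuousLinearMap.comp_apply, hf.lderiv_eq, hf'.lderiv_eq, ← hu,
      Ring.inverse_unit, neg_apply, ContinuousLinearMap.mulLeftRight_apply, zero_apply]
    simp [← mul_assoc]
  exact h3.hasMFDerivAt.congr_mfderiv h5

end Integration

/-! ### Representations of the Lie algebra integrate to the simply connected group. -/

section Globalization

open NormedSpace

variable {E : Type*} [NormedAddCommGroup E] [NormedSpace ℂ E] [FiniteDimensional ℂ E]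
  [CompleteSpace E]
  {G : Type*} [TopologicalSpace G] [ChartedSpace E G] [Group G] [LieGroup 𝓘(ℂ, E) ∞ G]
  [LieAlgebra.IsKilling ℂ (GroupLieAlgebra 𝓘(ℂ, E) G)]
  {W : Type*} [NormedAddCommGroup W] [NormedSpace ℂ W] [FiniteDimensional ℂ W]

theorem IsLogChart.hasLogDerivAt {N : Set G} {l : G → E} (hl : IsLogChart E G N l)
    {R : E →L[ℂ] (W →L[ℂ] W)} (hR : ∀ x y, R (adM E G x y) = R x * R y - R y * R x) {g : G}
    (hg : g ∈ N) : HasLogDerivAt R (fun h ↦ exp (R (l h))) g := by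
  have := FiniteDimensional.complete ℂ W
  refine ⟨?_, hl.lderiv_exp hR hg⟩
  have h1 : ContDiff ℂ 1 (fun x : E ↦ exp (R x)) := contDiff_exp.comp R.contDiff
  exact MDifferentiableAt.comp g (g := fun x : E ↦ exp (R x)) (f := l)
    (h1.differentiable one_ne_zero _).mdifferentiableAt (hl.mdifferentiableAt hg)

/-- A finite dimensional representation of the Lie algebra of a simply connected group integrates
to a representation of the group. -/
theorem IsLogChart.exists_representation [SimplyConnectedSpace G] {N : Set G} {l : G → E}
    (hl : IsLogChart E G N l) {R : E →L[ℂ] (W →L[ℂ] W)}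
    (hR : ∀ x y, R (adM E G x y) = R x * R y - R y * R x) :
    ∃ ρ : G →* (W →L[ℂ] W), ContMDiff 𝓘(ℂ, E) 𝓘(ℂ, W →L[ℂ] W) ∞ ρ ∧
      (∀ g, HasLogDerivAt R ρ g) ∧ ∀ᶠ g in 𝓝 1, ρ g = exp (R (l g)) := by
  have := FiniteDimensional.complete ℂ W
  have : LocallyPathConnectedSpace G := ChartedSpace.locallyPathConnectedSpace E G
  -- The local solution exp(R ∘ l), translated from 1 to i and taken in the group of units, where
  -- the monodromy principle applies.
  let P : G → G → (W →L[ℂ] W)ˣ := fun i x ↦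
    ⟨exp (R (l (i⁻¹ * x))), exp (-(R (l (i⁻¹ * x)))), exp_mul_exp_neg _, exp_neg_mul_exp _⟩
  let U : G → Set G := fun i ↦ (fun x ↦ i⁻¹ * x) ⁻¹' N
  have hU : ∀ i, IsOpen (U i) := fun i ↦
    hl.isOpen.preimage (contMDiff_mul_left (I := 𝓘(ℂ, E)) (n := ∞)).continuous
  have hmem : ∀ i, i ∈ U i := fun i ↦ by simpa [U] using hl.one_mem
  have hP : ∀ i, ∀ x ∈ U i, HasLogDerivAt R (fun x ↦ (P i x : W →L[ℂ] W)) x := fun i x hx ↦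
    HasLogDerivAt.comp_mul_left (f := fun h ↦ exp (R (l h))) (hl.hasLogDerivAt hR hx)
  obtain ⟨r, hr1, hr⟩ := exists_glue_of_simplyConnected hU hmem P (fun i j x hx ↦ by
    have h1 := eventually_eq_of_mfderiv_eq_zero (x := x)
      (f := fun y ↦ (P i y : W →L[ℂ] W) * Ring.inverse (P j y : W →L[ℂ] W)) (by
      filter_upwards [(hU i).mem_nhds hx.1, (hU j).mem_nhds hx.2] with y hyi hyj
      exact (hP i y hyi).mul_inverse (hP j y hyj) (P j y).isUnit)
    filter_upwards [h1] with y hy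
    refine Units.ext ?_
    simpa only [Ring.inverse_unit, ← Units.val_mul] using hy) 1 1
  have hloc : ∀ i, ∀ x ∈ U i, (fun y ↦ (r y : W →L[ℂ] W)) =ᶠ[𝓝 x] fun y ↦
      ((r x * (P i x)⁻¹ : (W →L[ℂ] W)ˣ) : W →L[ℂ] W) * P i y := by
    intro i x hx
    filter_upwards [hr i x hx] with y hy
    rw [← hy, ← Units.val_mul, inv_mul_cancel_right]
  have hlog : ∀ g, HasLogDerivAt R (fun y ↦ (r y : W →L[ℂ] W)) g := fun g ↦
    ((hP g g (hmem g)).const_mul _).congr (hloc g g (hmem g))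
  -- As functions of x, r(g x) and r(x) have the same logarithmic derivative, so their ratio is
  -- constant on the connected group and equals its value r(g) at x = 1.
  have hmul : ∀ g x, r (g * x) = r g * r x := by
    intro g x
    have h1 := eq_of_mfderiv_eq_zero
      (f := fun y ↦ (r (g * y) : W →L[ℂ] W) * Ring.inverse (r y : W →L[ℂ] W))
      (fun y ↦ HasLogDerivAt.mul_inverse (HasLogDerivAt.comp_mul_left (k := g) (hlog (g * y)))
        (hlog y) (r y).isUnit) x 1
    simp only [Ring.inverse_unit, ← Units.val_mul, mul_one, hr1, inv_one] at h1
    rw [← Units.ext h1, inv_mul_cancel_right]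
  let ρ : G →* (W →L[ℂ] W) :=
    { toFun := fun g ↦ r g
      map_one' := by rw [hr1]; rfl
      map_mul' := fun g x ↦ by rw [hmul, Units.val_mul] }
  refine ⟨ρ, fun g ↦ ?_, hlog, ?_⟩
  · refine ContMDiffAt.congr_of_eventuallyEq ?_ (hloc g g (hmem g))
    refine contMDiffAt_const.clm_comp ?_
    have h1 : ContDiff ℂ ∞ (fun x : E ↦ exp (R x)) := contDiff_exp.comp R.contDiff
    have h2 : ContMDiffAt 𝓘(ℂ, E) 𝓘(ℂ, E) ∞ (fun x ↦ l (g⁻¹ * x)) g :=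
      ContMDiffAt.comp g (f := fun x ↦ g⁻¹ * x) (g := l)
        (hl.contMDiffOn.contMDiffAt (hl.isOpen.mem_nhds (hmem g)))
        (contMDiff_mul_left (n := ∞)).contMDiffAt
    exact ContMDiffAt.comp g (g := fun x : E ↦ exp (R x)) h1.contMDiff.contMDiffAt h2
  · filter_upwards [hloc 1 1 (hmem 1)] with y hy
    have h1 : P 1 1 = 1 := Units.ext (by simp [P, hl.map_one])
    rw [h1, hr1] at hy
    refine hy.trans ?_
    simp [P]

end Globalization

/-! ### Derivatives of orbit maps and of the action. -/

section Actions

set_option linter.unusedSectionVars false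

variable {E : Type*} [NormedAddCommGroup E] [NormedSpace ℂ E]
  {G : Type*} [TopologicalSpace G] [ChartedSpace E G] [Group G] [LieGroup 𝓘(ℂ, E) ∞ G]
  {F : Type*} [NormedAddCommGroup F] [NormedSpace ℂ F]
  {M : Type*} [TopologicalSpace M] [ChartedSpace F M] [MulAction G M]
  [ContMDiffSMul 𝓘(ℂ, E) 𝓘(ℂ, F) ∞ G M]

variable (E F) in
theorem contMDiff_smul_left (x : M) :
    ContMDiff 𝓘(ℂ, E) 𝓘(ℂ, F) ∞ (fun g : G ↦ g • x) :=
  (contMDiff_smul (I := 𝓘(ℂ, E)) (I' := 𝓘(ℂ, F)) (n := ∞) (G := G) (M := M)).comp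
    (contMDiff_id.prodMk contMDiff_const)

variable (F) in
theorem contMDiff_smul_right (E : Type*) [NormedAddCommGroup E] [NormedSpace ℂ E]
    [ChartedSpace E G] [ContMDiffSMul 𝓘(ℂ, E) 𝓘(ℂ, F) ∞ G M] (g : G) :
    ContMDiff 𝓘(ℂ, F) 𝓘(ℂ, F) ∞ (fun x : M ↦ g • x) :=
  (contMDiff_smul (I := 𝓘(ℂ, E)) (I' := 𝓘(ℂ, F)) (n := ∞) (G := G) (M := M)).comp
    (contMDiff_const.prodMk contMDiff_id)

variable (E F) in
theorem mdifferentiableAt_smul_left (x : M) (g : G) :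
    MDifferentiableAt 𝓘(ℂ, E) 𝓘(ℂ, F) (fun g : G ↦ g • x) g :=
  (contMDiff_smul_left E F x).mdifferentiable (by simp) g

variable (F) in
theorem mdifferentiableAt_smul_right (E : Type*) [NormedAddCommGroup E] [NormedSpace ℂ E]
    [ChartedSpace E G] [ContMDiffSMul 𝓘(ℂ, E) 𝓘(ℂ, F) ∞ G M] (g : G) (x : M) :
    MDifferentiableAt 𝓘(ℂ, F) 𝓘(ℂ, F) (fun x : M ↦ g • x) x :=
  (contMDiff_smul_right F E g).mdifferentiable (by simp) x

variable (E F G) in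
/-- The derivative of the orbit map of `x` at the identity. -/
def orbitDeriv (x : M) : E →L[ℂ] F := tderiv E F (fun g : G ↦ g • x) 1

/-- Derivative at h = 1 of g(h x) = (g h g⁻¹)(g x). -/
theorem tderiv_smul_comp_orbitDeriv (g : G) (x : M) (ξ : E) :
    tderiv F F (fun y : M ↦ g • y) x (orbitDeriv E G F x ξ) =
      orbitDeriv E G F (g • x) (AdM E g ξ) := by
  have h1 : (fun h : G ↦ g • (h • x)) = fun h ↦ (g * h * g⁻¹) • (g • x) := by
    ext h; simp [mul_smul]
  have h2 := tderiv_comp_of_eq (x := (1 : G)) (mdifferentiableAt_smul_right F E g x)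
    (mdifferentiableAt_smul_left E F x 1) (one_smul G x)
  rw [h1, tderiv_comp_of_eq (g := fun k : G ↦ k • (g • x))
    (mdifferentiableAt_smul_left E F (g • x) 1) (mdifferentiableAt_conj g 1) (by simp)] at h2
  exact (DFunLike.congr_fun h2 ξ).symm

theorem tderiv_smul_inv_smul (E : Type*) [NormedAddCommGroup E] [NormedSpace ℂ E]
    [ChartedSpace E G] [ContMDiffSMul 𝓘(ℂ, E) 𝓘(ℂ, F) ∞ G M] (g : G) (x : M) (w : F) :
    tderiv F F (fun y : M ↦ g⁻¹ • y) (g • x) (tderiv F F (fun y : M ↦ g • y) x w) = w := by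
  have h1 := tderiv_comp (x := x) (mdifferentiableAt_smul_right F E g⁻¹ (g • x))
    (mdifferentiableAt_smul_right F E g x)
  have h2 : (fun y : M ↦ g⁻¹ • g • y) = fun y ↦ y := by ext y; simp
  rw [h2, tderiv_id] at h1
  exact (DFunLike.congr_fun h1 w).symm

theorem tderiv_smul_smul_inv (E : Type*) [NormedAddCommGroup E] [NormedSpace ℂ E]
    [ChartedSpace E G] [ContMDiffSMul 𝓘(ℂ, E) 𝓘(ℂ, F) ∞ G M] (g : G) (x : M) (w : F) :
    tderiv F F (fun y : M ↦ g • y) x (tderiv F F (fun y : M ↦ g⁻¹ • y) (g • x) w) = w := by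
  have h1 := tderiv_comp_of_eq (x := g • x) (mdifferentiableAt_smul_right F E g x)
    (mdifferentiableAt_smul_right F E g⁻¹ (g • x)) (inv_smul_smul g x)
  have h2 : (fun y : M ↦ g • g⁻¹ • y) = fun y ↦ y := by ext y; simp
  rw [h2, tderiv_id] at h1
  exact (DFunLike.congr_fun h1 w).symm

/-- The derivative of the orbit map in the direction of a left invariant vector field. -/
theorem tderiv_orbit (x : M) (g : G) (ξ : E) :
    tderiv E F (fun h : G ↦ h • x) g (tderiv E E (fun h ↦ g * h) 1 ξ) =
      tderiv F F (fun y : M ↦ g • y) x (orbitDeriv E G F x ξ) := by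
  have h1 : (fun h : G ↦ (g * h) • x) = fun h ↦ g • (h • x) := by ext h; simp [mul_smul]
  have h2 := tderiv_comp_of_eq (x := (1 : G)) (mdifferentiableAt_smul_right F E g x)
    (mdifferentiableAt_smul_left E F x 1) (one_smul G x)
  rw [← h1, tderiv_comp_of_eq (g := fun k : G ↦ k • x)
    (mdifferentiableAt_smul_left E F x g) (mdifferentiableAt_mul_left g 1) (by simp)] at h2
  exact DFunLike.congr_fun h2 ξ

end Actions

/-! ### Local sections and tangent spaces of homogeneous spaces between G/H⁰ and G/H. -/

section HomogeneousSpace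

open NormedSpace

set_option linter.unusedSectionVars false

theorem exp_apply_eq_of_apply_eq_zero {W : Type*} [NormedAddCommGroup W] [NormedSpace ℂ W]
    [CompleteSpace W] {a : W →L[ℂ] W} {v : W} (h : a v = 0) : exp a v = v := by
  have h1 : ∀ t : ℂ, HasDerivAt (fun t : ℂ ↦ exp (t • a) v) 0 t := fun t ↦ by
    have := (hasDerivAt_exp_smul_const a t).clm_apply (hasDerivAt_const t v)
    refine this.congr_deriv ?_
    simp [h]
  simpa using eq_of_hasDerivAt_zero h1 1 0

variable {E : Type*} [NormedAddCommGroup E] [NormedSpace ℂ E] [FiniteDimensional ℂ E]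
  [CompleteSpace E]
  {G : Type*} [TopologicalSpace G] [ChartedSpace E G] [Group G] [LieGroup 𝓘(ℂ, E) ∞ G]
  {F : Type*} [NormedAddCommGroup F] [NormedSpace ℂ F] [FiniteDimensional ℂ F]
  {M : Type*} [TopologicalSpace M] [ChartedSpace F M] [IsManifold 𝓘(ℂ, F) ∞ M] [MulAction G M]
  {K : Set G} {e : E} {o : M}

theorem one_mem_centralizer : (1 : G) ∈ centralizer (E := E) (G := G) e :=
  DFunLike.congr_fun AdM_one e

theorem inv_mul_mem_centralizer {g h : G} (hg : g ∈ centralizer (E := E) (G := G) e)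
    (hh : h ∈ centralizer (E := E) (G := G) e) : g⁻¹ * h ∈ centralizer (E := E) (G := G) e := by
  change AdM E (g⁻¹ * h) e = e
  rw [AdM_mul]
  change AdM E g⁻¹ (AdM E h e) = e
  have hh' : AdM E h e = e := hh
  have hg' : AdM E g e = e := hg
  rw [hh']
  nth_rewrite 1 [← hg']
  exact DFunLike.congr_fun (AdM_inv_mul g) e

/-- The curve is the image of a disc, hence connected; it passes through 1 and fixes e since exp(t
ad x) does. -/
theorem mem_centralizerComponent_of_curve [LieAlgebra.IsKilling ℂ (GroupLieAlgebra 𝓘(ℂ, E) G)]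
    {c : ℂ → G} {δ : ℝ} (hδ : 0 < δ) (hc : ContinuousOn c (Metric.ball 0 δ)) (hc0 : c 0 = 1)
    {x : E} (hAd : ∀ t ∈ Metric.ball (0 : ℂ) δ, AdM E (c t) = exp (t • adM E G x))
    (hx : adM E G x e = 0) :
    ∀ t ∈ Metric.ball (0 : ℂ) δ, c t ∈ centralizerComponent (E := E) (G := G) e := by
  intro t ht
  refine IsPreconnected.subset_connectedComponentIn
    ((convex_ball (0 : ℂ) δ).isPreconnected.image c hc)
    ⟨0, Metric.mem_ball_self hδ, hc0⟩ ?_ ⟨t, ht, rfl⟩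
  rintro _ ⟨s, hs, rfl⟩
  change AdM E (c s) e = e
  rw [hAd s hs]
  exact exp_apply_eq_of_apply_eq_zero (by simp [hx])

theorem IsHomogeneousSpace.inv_mul_mem (hM : IsHomogeneousSpace (E := E) (F := F) K o) {g h : G}
    (hgh : g • o = h • o) : g⁻¹ * h ∈ K := by
  rw [← hM.stabilizer_eq]
  exact (by rw [mul_smul, ← hgh, inv_smul_smul] : (g⁻¹ * h) • o = o)

theorem IsHomogeneousSpace.smul_eq (hM : IsHomogeneousSpace (E := E) (F := F) K o) {g : G}
    (hg : g ∈ K) : g • o = o := by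
  rw [← hM.stabilizer_eq] at hg
  exact hg

theorem IsHomogeneousSpace.orbitDeriv_surjective
    (hM : IsHomogeneousSpace (E := E) (F := F) K o) :
    Function.Surjective (orbitDeriv E G F o) :=
  hM.submersion

theorem IsHomogeneousSpace.tderiv_surjective (hM : IsHomogeneousSpace (E := E) (F := F) K o)
    (g : G) : Function.Surjective (tderiv E F (fun h : G ↦ h • o) g) := by
  have := hM.smooth
  intro w
  obtain ⟨ξ, hξ⟩ := hM.orbitDeriv_surjective (tderiv F F (fun y : M ↦ g⁻¹ • y) (g • o) w)
  exact ⟨tderiv E E (fun h ↦ g * h) 1 ξ, by rw [tderiv_orbit, hξ, tderiv_smul_smul_inv E]⟩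

theorem IsHomogeneousSpace.exists_section (hM : IsHomogeneousSpace (E := E) (F := F) K o)
    (g : G) : ∃ (U : Set M) (s : M → G), IsOpen U ∧ g • o ∈ U ∧
      ContMDiffOn 𝓘(ℂ, F) 𝓘(ℂ, E) ∞ s U ∧ s (g • o) = g ∧ ∀ y ∈ U, s y • o = y := by
  have := hM.smooth
  exact exists_local_section (contMDiff_smul_left E F o) (hM.tderiv_surjective g)

/-- A local section, followed by a function that is invariant under the elements of `K` close
to `1`, is compatible with the action. -/
theorem IsHomogeneousSpace.eventually_section_smul
    (hM : IsHomogeneousSpace (E := E) (F := F) K o) {U : Set M} {s : M → G} (hU : IsOpen U)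
    (hs : ContMDiffOn 𝓘(ℂ, F) 𝓘(ℂ, E) ∞ s U) (hsU : ∀ y ∈ U, s y • o = y)
    {p : G → Prop} (hp : ∀ᶠ k in 𝓝 (1 : G), k ∈ K → p k) {y : M} (hy : y ∈ U) :
    ∀ᶠ g in 𝓝 (1 : G), p ((s (g • y))⁻¹ * (g * s y)) := by
  have := hM.smooth
  have h1 : ContinuousAt (fun g : G ↦ g • y) 1 :=
    (mdifferentiableAt_smul_left E F y 1).continuousAt
  have h1' : Filter.Tendsto (fun g : G ↦ g • y) (𝓝 1) (𝓝 y) := by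
    simpa [ContinuousAt] using h1
  have h2 : Filter.Tendsto (fun g : G ↦ s (g • y)) (𝓝 1) (𝓝 (s y)) :=
    (hs.continuousOn.continuousAt (hU.mem_nhds hy)).tendsto.comp h1'
  have hG : IsTopologicalGroup G := topologicalGroup_of_lieGroup 𝓘(ℂ, E) ∞
  -- For a section s the element s(g y)⁻¹ g s(y) stabilizes the base point and tends to 1 with g.
  have h3 : Filter.Tendsto (fun g : G ↦ (s (g • y))⁻¹ * (g * s y)) (𝓝 1) (𝓝 1) := by
    have := h2.inv.mul ((Filter.tendsto_id (x := 𝓝 (1 : G))).mul_const (s y))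
    simpa using this
  filter_upwards [h3.eventually hp, h1'.eventually (hU.mem_nhds hy)] with g hg hgU
  refine hg (hM.inv_mul_mem ?_)
  rw [hsU _ hgU, mul_smul, hsU _ hy]

variable [LieAlgebra.IsKilling ℂ (GroupLieAlgebra 𝓘(ℂ, E) G)]

theorem IsHomogeneousSpace.eventually_section_orbit
    (hM : IsHomogeneousSpace (E := E) (F := F) K o) {U : Set M} {s : M → G} (hU : IsOpen U)
    (hs : ContMDiffOn 𝓘(ℂ, F) 𝓘(ℂ, E) ∞ s U) (hsU : ∀ y ∈ U, s y • o = y)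
    {p : G → Prop} (hp : ∀ᶠ k in 𝓝 (1 : G), k ∈ K → p k) {g : G} (hg : g • o ∈ U)
    (hsg : s (g • o) = g) : ∀ᶠ h in 𝓝 g, p ((s (h • o))⁻¹ * h) := by
  have hG : IsTopologicalGroup G := topologicalGroup_of_lieGroup 𝓘(ℂ, E) ∞
  have h1 := hM.eventually_section_smul hU hs hsU hp hg
  have h2 : Filter.Tendsto (fun h : G ↦ h * g⁻¹) (𝓝 g) (𝓝 1) := by
    have : ContinuousAt (fun h : G ↦ h * g⁻¹) g := by fun_prop
    simpa [ContinuousAt] using this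
  filter_upwards [h2.eventually h1] with h hh
  simpa [hsg, ← mul_smul] using hh

/-- The kernel of the derivative of the orbit map is the centralizer of `e`. -/
theorem IsHomogeneousSpace.orbitDeriv_eq_zero_iff
    (hM : IsHomogeneousSpace (E := E) (F := F) K o)
    (hK : centralizerComponent (E := E) (G := G) e ⊆ K) (hK' : K ⊆ centralizer (E := E) (G := G) e)
    {ξ : E} : orbitDeriv E G F o ξ = 0 ↔ adM E G ξ e = 0 := by
  have := hM.smooth
  constructor
  · intro h
    obtain ⟨U, s, hU, hoU, hs, hs1, hsU⟩ := hM.exists_section 1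
    rw [one_smul] at hoU
    have h1 := hM.eventually_section_orbit (g := 1) hU hs hsU (p := fun k ↦ AdM E k e = e)
      (.of_forall fun k hk ↦ hK' hk) (by rwa [one_smul]) hs1
    -- As K fixes e, the function Ad(g)e factors near 1 through the orbit map. Its derivative [ξ, e]
    -- therefore vanishes whenever that of the orbit map does.
    have h2 : (fun g : G ↦ AdM E g e) =ᶠ[𝓝 1] fun g ↦ (fun y ↦ AdM E (s y) e) (g • o) := by
      filter_upwards [h1] with g hg
      have h3 := congrArg (AdM E (s (g • o))) hg
      rw [← ContinuousLinearMap.comp_apply] at h3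
      change (AdM E (s (g • o)) * AdM E ((s (g • o))⁻¹ * g)) e = _ at h3
      rwa [← AdM_mul, mul_inv_cancel_left] at h3
    have h4 : MDifferentiableAt 𝓘(ℂ, F) 𝓘(ℂ, E) (fun y ↦ AdM E (s y) e) o := by
      have hso : MDifferentiableAt 𝓘(ℂ, F) 𝓘(ℂ, E) s o :=
        (hs.contMDiffAt (hU.mem_nhds hoU)).mdifferentiableAt (by simp)
      have h5 : MDifferentiableAt 𝓘(ℂ, F) 𝓘(ℂ, E →L[ℂ] E) (fun y ↦ AdM E (s y)) o :=
        MDifferentiableAt.comp o (f := s) (mdifferentiable_AdM _) hso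
      exact h5.clm_apply mdifferentiableAt_const
    have h6 : vderiv E (fun g : G ↦ AdM E g e) 1 = _ := (vderiv_congr h2).trans
      (vderiv_comp_of_eq h4 (mdifferentiableAt_smul_left E F o 1) (one_smul G o))
    have h7 : vderiv E (fun g : G ↦ AdM E g e) 1 ξ = adM E G ξ e := by
      rw [vderiv_clm_apply (mdifferentiable_AdM 1) mdifferentiableAt_const, vderiv_AdM_one]
      have : vderiv E (fun _ : G ↦ e) 1 = 0 := mfderiv_const
      rw [this]
      simp
    rw [← h7, h6, ContinuousLinearMap.comp_apply]
    change vderiv F (fun y ↦ AdM E (s y) e) o (orbitDeriv E G F o ξ) = 0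
    rw [h, map_zero]
  · intro h
    -- Conversely, a curve with velocity ξ stays in H⁰, hence in the stabilizer of the base point.
    obtain ⟨c, δ, hδ, hc, hc0, hd, hAd⟩ := exists_curve (E := E) (G := G) ξ
    have h1 := mem_centralizerComponent_of_curve hδ hc hc0 hAd h
    have h2 : (fun t ↦ c t • o) =ᶠ[𝓝 0] fun _ ↦ o := by
      filter_upwards [Metric.ball_mem_nhds (0 : ℂ) hδ] with t ht
      exact hM.smul_eq (hK (h1 t ht))
    have h3 : tderiv ℂ F (fun t ↦ c t • o) 0 = 0 := (tderiv_congr h2).trans mfderiv_const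
    rw [tderiv_comp_of_eq (g := fun g : G ↦ g • o) (mdifferentiableAt_smul_left E F o 1)
      hd.mdifferentiableAt hc0] at h3
    have h4 : tderiv ℂ E c 0 = ContinuousLinearMap.toSpanSingleton ℂ ξ := hd.mfderiv
    rw [h4] at h3
    have h5 : tderiv E F (fun g : G ↦ g • o) 1 ξ = 0 := by
      simpa using DFunLike.congr_fun h3 (1 : ℂ)
    exact h5

end HomogeneousSpace

/-! ### Open orbits and the developing map. -/

section Developing

open NormedSpace

set_option linter.unusedSectionVars false

variable {E : Type*} [NormedAddCommGroup E] [NormedSpace ℂ E] [FiniteDimensional ℂ E]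
  [CompleteSpace E]
  {G : Type*} [TopologicalSpace G] [ChartedSpace E G] [Group G] [LieGroup 𝓘(ℂ, E) ∞ G]
  {W : Type*} [NormedAddCommGroup W] [NormedSpace ℂ W]

/-- The representation `ρ`, with differential `R`, has an open orbit of `v₀` whose stabilizer
agrees with the stabilizer of `e` near the identity. -/
structure IsOpenOrbitModel (e : E) (R : E →L[ℂ] (W →L[ℂ] W)) (ρ : G →* (W →L[ℂ] W)) (v₀ : W) :
    Prop where
  contMDiff : ContMDiff 𝓘(ℂ, E) 𝓘(ℂ, W →L[ℂ] W) ∞ ρ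
  hasLogDerivAt : ∀ g, HasLogDerivAt R ρ g
  apply_eq_zero : ∀ ξ, R ξ v₀ = 0 → adM E G ξ e = 0
  surjective : ∀ w, ∃ ξ, R ξ v₀ = w
  eventually_apply_eq : ∀ᶠ k in 𝓝 (1 : G), AdM E k e = e → ρ k v₀ = v₀

variable {e : E} {R : E →L[ℂ] (W →L[ℂ] W)} {ρ : G →* (W →L[ℂ] W)} {v₀ : W}

/-- If k is close to 1 and fixes e, then [l(k), e] = 0. Hence R(l(k)) kills v₀, and ρ(k) =
exp(R(l(k))) fixes it. -/
theorem exists_isOpenOrbitModel [LieAlgebra.IsKilling ℂ (GroupLieAlgebra 𝓘(ℂ, E) G)]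
    [FiniteDimensional ℂ W] [SimplyConnectedSpace G]
    (hR : ∀ x y, R (adM E G x y) = R x * R y - R y * R x)
    (h0 : ∀ ξ, R ξ v₀ = 0 ↔ adM E G ξ e = 0) (hsurj : ∀ w, ∃ ξ, R ξ v₀ = w) :
    ∃ ρ : G →* (W →L[ℂ] W), IsOpenOrbitModel e R ρ v₀ := by
  have := FiniteDimensional.complete ℂ W
  obtain ⟨N, l, hl⟩ := exists_isLogChart (E := E) (G := G)
  obtain ⟨ρ, hρ, hlog, hexp⟩ := hl.exists_representation hR
  refine ⟨ρ, hρ, hlog, fun ξ ↦ (h0 ξ).1, hsurj, ?_⟩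
  filter_upwards [hexp, hl.eventually_adM_eq_zero] with k hk hk' hke
  rw [hk]
  exact exp_apply_eq_of_apply_eq_zero ((h0 _).2 (hk' _ hke))

theorem map_mul_apply (ρ : G →* (W →L[ℂ] W)) (g h : G) (v : W) : ρ (g * h) v = ρ g (ρ h v) := by
  rw [map_mul]
  rfl

theorem map_apply_eq_of_inv_mul {g h : G} {v : W} (H : ρ (g⁻¹ * h) v = v) : ρ h v = ρ g v := by
  have h1 := congrArg (ρ g) H
  rwa [← map_mul_apply, mul_inv_cancel_left] at h1

/-- Elements of H near 1 fix v₀, so k ↦ ρ(k)v₀ is locally constant on H⁰, which is connected. -/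
theorem IsOpenOrbitModel.apply_eq_of_mem (hρ : IsOpenOrbitModel e R ρ v₀) {g : G}
    (hg : g ∈ centralizerComponent (E := E) (G := G) e) : ρ g v₀ = v₀ := by
  have hG : IsTopologicalGroup G := topologicalGroup_of_lieGroup 𝓘(ℂ, E) ∞
  set C := centralizerComponent (E := E) (G := G) e with hC
  have hCs : C ⊆ centralizer (E := E) (G := G) e := connectedComponentIn_subset _ _
  have : PreconnectedSpace C := Subtype.preconnectedSpace isPreconnected_connectedComponentIn
  have h1 : IsLocallyConstant fun k : C ↦ ρ k v₀ := by
    refine (IsLocallyConstant.iff_eventually_eq _).2 fun k ↦ ?_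
    have h2 : Filter.Tendsto (fun k' : C ↦ (k : G)⁻¹ * k') (𝓝 k) (𝓝 1) := by
      have : ContinuousAt (fun k' : C ↦ (k : G)⁻¹ * k') k := by fun_prop
      simpa [ContinuousAt] using this
    filter_upwards [h2.eventually hρ.eventually_apply_eq] with k' hk'
    exact map_apply_eq_of_inv_mul (hk' (inv_mul_mem_centralizer (hCs k.2) (hCs k'.2)))
  have h3 := h1.apply_eq_of_preconnectedSpace ⟨g, hg⟩
    ⟨1, mem_connectedComponentIn one_mem_centralizer⟩
  simpa using h3

theorem bijective_map (ρ : G →* (W →L[ℂ] W)) (g : G) :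
    Function.Bijective (ρ g) := by
  refine Function.bijective_iff_has_inverse.2 ⟨ρ g⁻¹, fun v ↦ ?_, fun v ↦ ?_⟩
  · rw [← map_mul_apply, inv_mul_cancel, map_one, one_apply_eq_self]
  · rw [← map_mul_apply, mul_inv_cancel, map_one, one_apply_eq_self]

theorem IsOpenOrbitModel.vderiv_apply (hρ : IsOpenOrbitModel e R ρ v₀) (g : G) (v : W) (ξ : E) :
    vderiv E (fun h ↦ ρ h v) g (tderiv E E (fun h ↦ g * h) 1 ξ) = ρ g (R ξ v) := by
  have h1 := (hρ.hasLogDerivAt g).lderiv_eq ξ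
  have h2 := (hρ.hasLogDerivAt g).mdifferentiableAt
  rw [lderiv_eq_comp h2] at h1
  rw [vderiv_clm_apply h2 mdifferentiableAt_const]
  have : vderiv E (fun _ : G ↦ v) g = 0 := mfderiv_const
  rw [this]
  simp only [zero_apply, map_zero, zero_add]
  exact DFunLike.congr_fun h1 v

variable {F : Type*} [NormedAddCommGroup F] [NormedSpace ℂ F] [FiniteDimensional ℂ F]
  {M : Type*} [TopologicalSpace M] [ChartedSpace F M] [IsManifold 𝓘(ℂ, F) ∞ M] [MulAction G M]
  {K : Set G} {o : M}

/-- By the chain rule the derivative sends the translate by g of ξ*(o) to ρ(g) R_ξ v₀, and R_ξ v₀ =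
0 forces ξ ∈ 𝔷(e). Any K between H⁰ and H is allowed, which covers both the orbit and its universal
covering. -/
theorem IsOpenOrbitModel.bijective_vderiv [LieAlgebra.IsKilling ℂ (GroupLieAlgebra 𝓘(ℂ, E) G)]
    (hρ : IsOpenOrbitModel e R ρ v₀)
    (hM : IsHomogeneousSpace (E := E) (F := F) K o)
    (hK : centralizerComponent (E := E) (G := G) e ⊆ K) (hK' : K ⊆ centralizer (E := E) (G := G) e)
    {f : M → W} {g : G} (hf : MDifferentiableAt 𝓘(ℂ, F) 𝓘(ℂ, W) f (g • o))
    (hfg : (fun h : G ↦ f (h • o)) =ᶠ[𝓝 g] fun h ↦ ρ h v₀) :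
    Function.Bijective (vderiv F f (g • o)) := by
  have := hM.smooth
  have h1 : ∀ ξ, vderiv F f (g • o) (tderiv F F (fun y : M ↦ g • y) o (orbitDeriv E G F o ξ)) =
      ρ g (R ξ v₀) := by
    intro ξ
    rw [← hρ.vderiv_apply, ← vderiv_congr hfg,
      vderiv_comp (f := fun h : G ↦ h • o) hf (mdifferentiableAt_smul_left E F o g),
      ContinuousLinearMap.comp_apply, tderiv_orbit]
  constructor
  · refine (injective_iff_map_eq_zero _).2 fun w hw ↦ ?_
    obtain ⟨ξ, hξ⟩ := hM.orbitDeriv_surjective (tderiv F F (fun y : M ↦ g⁻¹ • y) (g • o) w)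
    have h2 : tderiv F F (fun y : M ↦ g • y) o (orbitDeriv E G F o ξ) = w := by
      rw [hξ, tderiv_smul_smul_inv E]
    have h3 := h1 ξ
    rw [h2, hw] at h3
    have h4 : R ξ v₀ = 0 := (bijective_map ρ g).1 (by rw [← h3, map_zero])
    rw [← h2, (hM.orbitDeriv_eq_zero_iff hK hK').2 (hρ.apply_eq_zero _ h4), map_zero]
  · intro w
    obtain ⟨w', rfl⟩ := (bijective_map ρ g).2 w
    obtain ⟨ξ, rfl⟩ := hρ.surjective w'
    exact ⟨_, h1 ξ⟩

/-- The map is y ↦ ρ(s(y)) v₀ for a local section s. Only elements of K near 1 are known to fix v₀,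
whence equivariance for g near 1. -/
theorem IsOpenOrbitModel.exists_partialDiffeomorph
    [LieAlgebra.IsKilling ℂ (GroupLieAlgebra 𝓘(ℂ, E) G)] (hρ : IsOpenOrbitModel e R ρ v₀)
    (hM : IsHomogeneousSpace (E := E) (F := F) K o)
    (hK : centralizerComponent (E := E) (G := G) e ⊆ K) (hK' : K ⊆ centralizer (E := E) (G := G) e)
    (g : G) : ∃ Φ : PartialDiffeomorph 𝓘(ℂ, F) 𝓘(ℂ, W) M W ∞, g • o ∈ Φ.source ∧
      Φ (g • o) = ρ g v₀ ∧ Φ.target ⊆ Set.range (fun g : G ↦ ρ g v₀) ∧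
        ∀ y ∈ Φ.source, ∀ᶠ g in 𝓝 (1 : G), Φ (g • y) = ρ g (Φ y) := by
  have := hM.smooth
  obtain ⟨U, s, hU, hgU, hs, hsg, hsU⟩ := hM.exists_section g
  have hp : ∀ᶠ k in 𝓝 (1 : G), k ∈ K → ρ k v₀ = v₀ := by
    filter_upwards [hρ.eventually_apply_eq] with k hk hkK using hk (hK' hkK)
  have hcd : ContMDiffOn 𝓘(ℂ, F) 𝓘(ℂ, W) ∞ (fun y ↦ ρ (s y) v₀) U :=
    (hρ.contMDiff.comp_contMDiffOn hs).clm_apply contMDiffOn_const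
  have hbij : Function.Bijective (vderiv F (fun y ↦ ρ (s y) v₀) (g • o)) := by
    refine hρ.bijective_vderiv hM hK hK'
      ((hcd.contMDiffAt (hU.mem_nhds hgU)).mdifferentiableAt (by simp)) ?_
    filter_upwards [hM.eventually_section_orbit hU hs hsU hp hgU hsg] with h hh
    exact (map_apply_eq_of_inv_mul hh).symm
  obtain ⟨Φ, hgΦ, hΦU, hΦ⟩ := InvConn.exists_partialDiffeomorph hU hcd hgU hbij
  refine ⟨Φ, hgΦ, ?_, ?_, fun y hy ↦ ?_⟩
  · rw [hΦ _ hgΦ, hsg]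
  · intro w hw
    have h1 := hΦ _ (Φ.map_target hw)
    exact ⟨_, h1.symm.trans (Φ.right_inv hw)⟩
  · have h1 : ∀ᶠ h in 𝓝 (1 : G), h • y ∈ Φ.source := by
      have h2 : ContinuousAt (fun h : G ↦ h • y) 1 :=
        (mdifferentiableAt_smul_left E F y 1).continuousAt
      exact h2 (Φ.open_source.mem_nhds (by simpa using hy))
    filter_upwards [h1, hM.eventually_section_smul hU hs hsU hp (hΦU hy)] with h hh hh'
    rw [hΦ _ hh, hΦ _ hy, ← map_mul_apply]
    exact (map_apply_eq_of_inv_mul hh').symm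

theorem IsOpenOrbitModel.isLocallyOpenOrbit
    [LieAlgebra.IsKilling ℂ (GroupLieAlgebra 𝓘(ℂ, E) G)] (hρ : IsOpenOrbitModel e R ρ v₀)
    (hM : IsHomogeneousSpace (E := E) (F := F) K o)
    (hK : centralizerComponent (E := E) (G := G) e ⊆ K)
    (hK' : K ⊆ centralizer (E := E) (G := G) e) : IsLocallyOpenOrbit (F' := F) M ρ v₀ := by
  have := hM.transitive
  refine ⟨isOpen_iff_mem_nhds.2 ?_, fun x ↦ ?_⟩
  · rintro _ ⟨g, rfl⟩
    obtain ⟨Φ, hgΦ, hΦg, hΦ, -⟩ := hρ.exists_partialDiffeomorph hM hK hK' g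
    refine Filter.mem_of_superset (Φ.open_target.mem_nhds ?_) hΦ
    change ρ g v₀ ∈ Φ.target
    rw [← hΦg]
    exact Φ.map_source hgΦ
  · obtain ⟨g, rfl⟩ := MulAction.exists_smul_eq G o x
    obtain ⟨Φ, hgΦ, -, hΦ⟩ := hρ.exists_partialDiffeomorph hM hK hK' g
    exact ⟨Φ, hgΦ, hΦ⟩

/-- The developing map of the universal covering of the orbit. -/
theorem IsOpenOrbitModel.exists_dev
    [LieAlgebra.IsKilling ℂ (GroupLieAlgebra 𝓘(ℂ, E) G)] (hρ : IsOpenOrbitModel e R ρ v₀)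
    (hM : IsHomogeneousSpace (E := E) (F := F) (centralizerComponent (E := E) (G := G) e) o) :
    ∃ dev : M → W, ContMDiff 𝓘(ℂ, F) 𝓘(ℂ, W) ∞ dev ∧ dev o = v₀ ∧
      (∀ (g : G) (y : M), dev (g • y) = ρ g (dev y)) ∧
      (∀ y, Function.Bijective (vderiv F dev y)) ∧
      ∀ y ξ, vderiv F dev y (orbitDeriv E G F y ξ) = R ξ (dev y) := by
  have := hM.smooth
  have := hM.transitive
  choose t ht using fun y : M ↦ MulAction.exists_smul_eq G o y
  let dev : M → W := fun y ↦ ρ (t y) v₀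
  -- The arbitrary choice of `t` is harmless: the stabilizer of `o` is H⁰, all of which fixes v₀.
  have hdev : ∀ g : G, dev (g • o) = ρ g v₀ := fun g ↦
    map_apply_eq_of_inv_mul (hρ.apply_eq_of_mem (hM.inv_mul_mem (ht (g • o)).symm))
  have hequiv : ∀ (g : G) (y : M), dev (g • y) = ρ g (dev y) := fun g y ↦ by
    rw [← map_mul_apply, ← hdev, mul_smul, ht]
  have hcd : ContMDiff 𝓘(ℂ, F) 𝓘(ℂ, W) ∞ dev := by
    intro y
    obtain ⟨U, s, hU, hgU, hs, hsg, hsU⟩ := hM.exists_section (t y)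
    rw [ht] at hgU
    refine (((hρ.contMDiff.comp_contMDiffOn hs).clm_apply
      (contMDiffOn_const (c := v₀))).contMDiffAt (hU.mem_nhds hgU)).congr_of_eventuallyEq ?_
    filter_upwards [hU.mem_nhds hgU] with z hz
    nth_rewrite 1 [← hsU z hz]
    exact hdev _
  refine ⟨dev, hcd, ?_, hequiv, fun y ↦ ?_, fun y ξ ↦ ?_⟩
  · have := hdev 1
    rwa [one_smul, map_one] at this
  · rw [← ht y]
    exact hρ.bijective_vderiv hM subset_rfl (connectedComponentIn_subset _ _)
      (hcd.mdifferentiable (by simp) _) (.of_forall hdev)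
  · have h1 := hρ.vderiv_apply 1 (dev y) ξ
    have h2 : tderiv E E (fun h : G ↦ 1 * h) 1 = ContinuousLinearMap.id ℂ E := by
      simp only [one_mul]
      exact tderiv_id 1
    rw [h2, map_one, one_apply_eq_self] at h1
    rw [← h1]
    have h3 : (fun h ↦ ρ h (dev y)) = fun h : G ↦ dev (h • y) := funext fun h ↦ (hequiv h y).symm
    rw [h3, vderiv_comp_of_eq (f := fun h : G ↦ h • y) (hcd.mdifferentiable (by simp) y)
      (mdifferentiableAt_smul_left E F y 1) (one_smul G y)]
    rfl

end Developing

/-! ### The pullback of the flat connection under the developing map. -/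

section FlatConnection

open VectorField

set_option linter.unusedSectionVars false

variable {F : Type*} [NormedAddCommGroup F] [NormedSpace ℂ F] [FiniteDimensional ℂ F]
  [CompleteSpace F]
  {M : Type*} [TopologicalSpace M] [ChartedSpace F M] [IsManifold 𝓘(ℂ, F) ∞ M]
  {dev : M → F}

/-- The vector field `Y`, as a function into the vector space in which `M` is developed. -/
def devField (dev : M → F) (Y : Π y : M, TangentSpace 𝓘(ℂ, F) y) (y : M) : F :=
  vderiv F dev y (Y y)

/-- The pullback of the flat connection under the developing map. -/
def pullbackNabla (dev : M → F) (Y : Π y : M, TangentSpace 𝓘(ℂ, F) y) (x : M) : F →L[ℂ] F :=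
  Ring.inverse (vderiv F dev x) * vderiv F (devField dev Y) x

theorem vderiv_pullbackNabla (hbij : ∀ y, Function.Bijective (vderiv F dev y))
    (Y : Π y : M, TangentSpace 𝓘(ℂ, F) y) (x : M) (v : F) :
    vderiv F dev x (pullbackNabla dev Y x v) = vderiv F (devField dev Y) x v := by
  have h1 : IsUnit (vderiv F dev x) := ContinuousLinearMap.isUnit_iff_bijective.2 (hbij x)
  have h2 : vderiv F dev x * pullbackNabla dev Y x = vderiv F (devField dev Y) x := by
    rw [pullbackNabla, ← mul_assoc, Ring.mul_inverse_cancel _ h1, one_mul]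
  exact DFunLike.congr_fun h2 v

theorem mdifferentiableAt_devField (hdev : ContMDiff 𝓘(ℂ, F) 𝓘(ℂ, F) ∞ dev) {x : M}
    {Y : Π y : M, TangentSpace 𝓘(ℂ, F) y} (hY : MDiffAt (T% Y) x) :
    MDifferentiableAt 𝓘(ℂ, F) 𝓘(ℂ, F) (devField dev Y) x :=
  mdifferentiableAt_mvfderiv_apply hdev.contMDiffAt hY

theorem contMDiffAt_devField (hdev : ContMDiff 𝓘(ℂ, F) 𝓘(ℂ, F) ∞ dev) {x : M}
    {Y : Π y : M, TangentSpace 𝓘(ℂ, F) y} (hY : CMDiffAt ∞ (T% Y) x) :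
    ContMDiffAt 𝓘(ℂ, F) 𝓘(ℂ, F) ∞ (devField dev Y) x :=
  contMDiffAt_mvfderiv_apply hdev.contMDiffAt hY

theorem vderiv_add' {u u' : M → F} {x : M} (hu : MDiffAt u x) (hu' : MDiffAt u' x) :
    vderiv F (u + u') x = vderiv F u x + vderiv F u' x :=
  mvfderiv_add hu hu'

theorem vderiv_smul' {a : M → ℂ} {u : M → F} {x : M} (ha : MDiffAt a x) (hu : MDiffAt u x) :
    vderiv F (a • u) x = a x • vderiv F u x + (vderiv F a x).smulRight (u x) :=
  mvfderiv_smul ha hu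

variable (dev) in
/-- The flat connection on a manifold with a locally biholomorphic map to a vector space. -/
def flatConnection (hdev : ContMDiff 𝓘(ℂ, F) 𝓘(ℂ, F) ∞ dev)
    (hbij : ∀ y, Function.Bijective (vderiv F dev y)) : LinearConnection F M where
  toFun Y x := pullbackNabla (F := F) dev Y x
  isCovariantDerivativeOnUniv :=
    { add := by
        intro Y Y' x hY hY' _
        have h1 : devField dev (Y + Y') = devField dev Y + devField dev Y' := by
          ext y
          exact map_add (vderiv F dev y) _ _
        have h2 : pullbackNabla dev (Y + Y') x = pullbackNabla dev Y x + pullbackNabla dev Y' x := by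
          rw [pullbackNabla, h1, vderiv_add' (mdifferentiableAt_devField hdev hY)
            (mdifferentiableAt_devField hdev hY'), mul_add]
          rfl
        exact h2
      leibniz := by
        intro Y a x hY ha _
        have h1 : devField dev (a • Y) = a • devField dev Y := by
          ext y
          exact map_smul (vderiv F dev y) _ _
        have h2 : pullbackNabla dev (a • Y) x = a x • pullbackNabla dev Y x +
            ContinuousLinearMap.smulRight (vderiv F a x) (@id F (Y x)) := by
          refine ContinuousLinearMap.ext fun v ↦ (hbij x).1 ?_
          rw [vderiv_pullbackNabla hbij, h1,
            vderiv_smul' ha (mdifferentiableAt_devField hdev hY)]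
          simp only [add_apply, smul_apply, map_add, map_smul, vderiv_pullbackNabla hbij,
            ContinuousLinearMap.smulRight_apply]
          rfl
        exact h2 }

variable (hdev : ContMDiff 𝓘(ℂ, F) 𝓘(ℂ, F) ∞ dev)
  (hbij : ∀ y, Function.Bijective (vderiv F dev y))

theorem vderiv_flatConnection (Y : Π y : M, TangentSpace 𝓘(ℂ, F) y) (x : M) (v : F) :
    vderiv F dev x (flatConnection dev hdev hbij Y x v) = vderiv F (devField dev Y) x v :=
  vderiv_pullbackNabla hbij Y x v

/-- The derivative of a function, in the coordinates around a point `x₀`. -/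
theorem contMDiffAt_vderiv_coordChange {u : M → F} {x₀ : M} (hu : CMDiffAt ∞ u x₀) :
    ContMDiffAt 𝓘(ℂ, F) 𝓘(ℂ, F →L[ℂ] F) ∞ (fun x ↦ vderiv F u x *
      (tangentBundleCore 𝓘(ℂ, F) M).coordChange (achart F x₀) (achart F x) x) x₀ := by
  refine (hu.mfderiv_const (m := ∞) le_rfl).congr_of_eventuallyEq ?_
  filter_upwards [(chartAt F x₀).open_source.mem_nhds (mem_chart_source F x₀)] with x hx
  have h1 := inTangentCoordinates_eq (I := 𝓘(ℂ, F)) (I' := 𝓘(ℂ, F)) (f := id) (g := u)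
    (fun x ↦ vderiv F u x) (x₀ := x₀) (x := x) hx
    (by rw [chartAt_self_eq]; exact Set.mem_univ _)
  rw [tangentBundleCore_coordChange_model_space, ContinuousLinearMap.id_comp] at h1
  exact h1.symm

/-- The operators `vderiv` refer to the preferred chart at each point and need not vary
continuously. With the coordinate change C from the chart at x₀, the connection reads (D C)⁻¹ (D_Y
C), where D and D_Y are the derivatives of `dev` and `devField dev Y`; both D C and D_Y C are
holomorphic. -/
theorem isHolomorphic_flatConnection : IsHolomorphic (flatConnection dev hdev hbij) := by
  have : IsManifold 𝓘(ℂ, F) 1 M := IsManifold.of_le (n := ∞) ENat.LEInfty.out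
  intro U hU
  refine ⟨fun {Y} hY ↦ fun x₀ hx₀ ↦ ContMDiffAt.contMDiffWithinAt ?_⟩
  have hY₀ : CMDiffAt ∞ (T% Y) x₀ := hY.contMDiffAt (hU.mem_nhds hx₀)
  refine (contMDiffAt_hom_bundle _).2 ⟨contMDiffAt_id, ?_⟩
  let C : M → F →L[ℂ] F := fun x ↦
    (tangentBundleCore 𝓘(ℂ, F) M).coordChange (achart F x₀) (achart F x) x
  let C' : M → F →L[ℂ] F := fun x ↦
    (tangentBundleCore 𝓘(ℂ, F) M).coordChange (achart F x) (achart F x₀) x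
  have hCC' : ∀ x ∈ (chartAt F x₀).source, C x * C' x = 1 := fun x hx ↦ by
    ext v
    exact ((tangentBundleCore 𝓘(ℂ, F) M).coordChange_comp (achart F x) (achart F x₀) (achart F x) x
      ⟨⟨mem_chart_source F x, hx⟩, mem_chart_source F x⟩ v).trans
      ((tangentBundleCore 𝓘(ℂ, F) M).coordChange_self (achart F x) x (mem_chart_source F x) v)
  have hC'C : ∀ x ∈ (chartAt F x₀).source, C' x * C x = 1 := fun x hx ↦ by
    ext v
    exact ((tangentBundleCore 𝓘(ℂ, F) M).coordChange_comp (achart F x₀) (achart F x) (achart F x₀) x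
      ⟨⟨hx, mem_chart_source F x⟩, hx⟩ v).trans
      ((tangentBundleCore 𝓘(ℂ, F) M).coordChange_self (achart F x₀) x hx v)
  have hA := contMDiffAt_vderiv_coordChange (hdev.contMDiffAt (x := x₀))
  have hB := contMDiffAt_vderiv_coordChange (contMDiffAt_devField hdev hY₀)
  have hD : ∀ x, IsUnit (vderiv F dev x) := fun x ↦
    ContinuousLinearMap.isUnit_iff_bijective.2 (hbij x)
  have hC : ∀ x ∈ (chartAt F x₀).source, IsUnit (C x) := fun x hx ↦
    ⟨⟨C x, C' x, hCC' x hx, hC'C x hx⟩, rfl⟩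
  have hinv : ContMDiffAt 𝓘(ℂ, F) 𝓘(ℂ, F →L[ℂ] F) ∞
      (fun x ↦ Ring.inverse (vderiv F dev x * C x)) x₀ := by
    obtain ⟨u, hu⟩ := (hD x₀).mul (hC x₀ (mem_chart_source F x₀))
    refine ContMDiffAt.comp x₀ (g := (Ring.inverse : (F →L[ℂ] F) → F →L[ℂ] F)) ?_ hA
    rw [← hu]
    exact (contDiffAt_ringInverse ℂ u).contMDiffAt
  refine (hinv.clm_comp hB).congr_of_eventuallyEq ?_
  filter_upwards [(chartAt F x₀).open_source.mem_nhds (mem_chart_source F x₀)] with x hx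
  have h1 := inTangentCoordinates_eq (I := 𝓘(ℂ, F)) (I' := 𝓘(ℂ, F)) (f := id) (g := id)
    (fun x ↦ pullbackNabla dev Y x) (x₀ := x₀) (x := x) hx hx
  refine h1.trans ?_
  have h2 : C' x * (pullbackNabla dev Y x * C x) =
      Ring.inverse (vderiv F dev x * C x) * (vderiv F (devField dev Y) x * C x) := by
    refine ((Ring.inverse_mul_eq_iff_eq_mul _ _ _ ((hD x).mul (hC x hx))).2 ?_).symm
    calc vderiv F (devField dev Y) x * C x
        = vderiv F dev x * Ring.inverse (vderiv F dev x) *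
            (vderiv F (devField dev Y) x * C x) := by
          rw [Ring.mul_inverse_cancel _ (hD x), one_mul]
      _ = vderiv F dev x * (C x * C' x) * (pullbackNabla dev Y x * C x) := by
          rw [hCC' x hx, mul_one, pullbackNabla]
          simp only [mul_assoc]
      _ = _ := by simp only [mul_assoc]
  exact h2

/-- Developing turns ∇ into the ordinary derivative of vector-valued functions. Both tensors then
vanish by `mvfderiv_mlieBracket`, applied to `dev` for the torsion and to `devField dev Z` for the
curvature. -/
theorem isLocallyFlat_flatConnection : IsLocallyFlat (flatConnection dev hdev hbij) := by
  have : IsManifold 𝓘(ℂ, F) 2 M := IsManifold.of_le (n := ∞) ENat.LEInfty.out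
  constructor
  · rw [CovariantDerivative.torsion_eq_zero_iff]
    intro X Y x hX hY
    refine (hbij x).1 ?_
    have h1 := mvfderiv_mlieBracket (hdev.contMDiffAt (x := x)) hX hY
    refine Eq.trans ?_ h1.symm
    refine (map_sub (vderiv F dev x) _ _).trans ?_
    exact congrArg₂ (· - ·) (vderiv_flatConnection hdev hbij Y x (X x))
      (vderiv_flatConnection hdev hbij X x (Y x))
  · intro U hU X Y Z hX hY hZ x hx
    have hUx := hU.mem_nhds hx
    have hX' : MDiffAt (T% X) x := (hX.contMDiffAt hUx).mdifferentiableAt (by simp)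
    have hY' : MDiffAt (T% Y) x := (hY.contMDiffAt hUx).mdifferentiableAt (by simp)
    have h1 := mvfderiv_mlieBracket
      (contMDiffAt_devField hdev (hZ.contMDiffAt hUx)) hX' hY'
    have h2 : ∀ T : Π y : M, TangentSpace 𝓘(ℂ, F) y,
        devField dev (fun y ↦ flatConnection dev hdev hbij Z y (T y)) =
          fun y ↦ vderiv F (devField dev Z) y (T y) := fun T ↦ funext fun y ↦
      vderiv_flatConnection hdev hbij Z y (T y)
    refine (hbij x).1 (Eq.trans ?_ (map_zero (vderiv F dev x)).symm)
    have hsub : ∀ a b c : F, vderiv F dev x (a - b - c) =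
        vderiv F dev x a - vderiv F dev x b - vderiv F dev x c := fun a b c ↦ by
      rw [map_sub, map_sub]
    refine (hsub _ _ _).trans ?_
    have h3 := fun S T : Π y : M, TangentSpace 𝓘(ℂ, F) y ↦ vderiv_flatConnection hdev hbij
      (fun y ↦ flatConnection dev hdev hbij Z y (T y)) x (S x)
    simp only [h2] at h3
    have h4 := vderiv_flatConnection hdev hbij Z x (mlieBracket 𝓘(ℂ, F) X Y x)
    exact (congrArg₂ (· - ·) (congrArg₂ (· - ·) (h3 X Y) (h3 Y X)) (h4.trans h1)).trans
      (sub_self _)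

end FlatConnection

/-! ### Invariance of the flat connection and its values on induced fields. -/

section Invariance

open VectorField

set_option linter.unusedSectionVars false

variable {E : Type*} [NormedAddCommGroup E] [NormedSpace ℂ E]
  {G : Type*} [TopologicalSpace G] [ChartedSpace E G] [Group G] [LieGroup 𝓘(ℂ, E) ∞ G]
  {F : Type*} [NormedAddCommGroup F] [NormedSpace ℂ F] [FiniteDimensional ℂ F]
  [CompleteSpace F]
  {M : Type*} [TopologicalSpace M] [ChartedSpace F M] [IsManifold 𝓘(ℂ, F) ∞ M] [MulAction G M]
  {dev : M → F}

theorem tderiv_smul_mpullback (E : Type*) [NormedAddCommGroup E] [NormedSpace ℂ E]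
    [ChartedSpace E G] [ContMDiffSMul 𝓘(ℂ, E) 𝓘(ℂ, F) ∞ G M] (g : G)
    (Y : Π y : M, TangentSpace 𝓘(ℂ, F) y) (y : M) :
    tderiv F F (fun z : M ↦ g • z) y
      (mpullback 𝓘(ℂ, F) 𝓘(ℂ, F) (fun z : M ↦ g • z) Y y) = Y (g • y) := by
  let A : F ≃L[ℂ] F := ContinuousLinearEquiv.equivOfInverse (tderiv F F (fun z : M ↦ g • z) y)
    (tderiv F F (fun z : M ↦ g⁻¹ • z) (g • y)) (tderiv_smul_inv_smul E g y)
    (tderiv_smul_smul_inv E g y)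
  have h1 : (tderiv F F (fun z : M ↦ g • z) y).inverse = A.symm.toContinuousLinearMap :=
    ContinuousLinearMap.inverse_equiv A
  have h2 : (mpullback 𝓘(ℂ, F) 𝓘(ℂ, F) (fun z : M ↦ g • z) Y y : F) =
      (tderiv F F (fun z : M ↦ g • z) y).inverse (Y (g • y)) := rfl
  rw [h2, h1]
  exact A.apply_symm_apply _

/-- In the development g acts by the linear map ρ(g), which commutes with differentiation of
vector-valued functions. -/
theorem isInvariant_flatConnection [ContMDiffSMul 𝓘(ℂ, E) 𝓘(ℂ, F) ∞ G M]
    (hdev : ContMDiff 𝓘(ℂ, F) 𝓘(ℂ, F) ∞ dev)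
    (hbij : ∀ y, Function.Bijective (vderiv F dev y)) (ρ : G →* (F →L[ℂ] F))
    (hequiv : ∀ (g : G) (y : M), dev (g • y) = ρ g (dev y)) :
    IsInvariant G (flatConnection dev hdev hbij) := by
  intro g x Y v hY
  have hd : ∀ y, MDifferentiableAt 𝓘(ℂ, F) 𝓘(ℂ, F) dev y := hdev.mdifferentiable (by simp)
  have h1 : ∀ (y : M) (w : F), vderiv F dev (g • y) (tderiv F F (fun z : M ↦ g • z) y w) =
      ρ g (vderiv F dev y w) := by
    intro y w
    have h2 := vderiv_comp (f := fun z : M ↦ g • z) (x := y) (hd (g • y))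
      (mdifferentiableAt_smul_right F E g y)
    have h3 : (fun z : M ↦ dev (g • z)) = fun z ↦ ρ g (dev z) := funext (hequiv g)
    rw [h3, vderiv_clm_comp _ (hd y)] at h2
    exact (DFunLike.congr_fun h2 w).symm
  set Y' := mpullback 𝓘(ℂ, F) 𝓘(ℂ, F) (fun z : M ↦ g • z) Y with hY'
  have h4 : ∀ y, devField dev Y (g • y) = ρ g (devField dev Y' y) := fun y ↦
    (congrArg (vderiv F dev (g • y)) (tderiv_smul_mpullback E g Y y).symm).trans (h1 y _)
  have h5 : MDifferentiableAt 𝓘(ℂ, F) 𝓘(ℂ, F) (fun y : M ↦ devField dev Y (g • y)) x :=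
    MDifferentiableAt.comp x (f := fun y : M ↦ g • y) (mdifferentiableAt_devField hdev hY)
      (mdifferentiableAt_smul_right F E g x)
  have h6 : MDifferentiableAt 𝓘(ℂ, F) 𝓘(ℂ, F) (devField dev Y') x := by
    have h7 : devField dev Y' = fun y ↦ ρ g⁻¹ (devField dev Y (g • y)) := funext fun y ↦ by
      rw [h4, ← map_mul_apply, inv_mul_cancel, map_one, one_apply_eq_self]
    rw [h7]
    exact mdifferentiableAt_const.clm_apply h5
  have h8 := vderiv_comp (f := fun z : M ↦ g • z) (x := x) (mdifferentiableAt_devField hdev hY)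
    (mdifferentiableAt_smul_right F E g x)
  have h9 : (fun y : M ↦ devField dev Y (g • y)) = fun y ↦ ρ g (devField dev Y' y) := funext h4
  rw [h9, vderiv_clm_comp _ h6] at h8
  refine (hbij (g • x)).1 ?_
  refine (h1 x _).trans (Eq.trans ?_ (vderiv_flatConnection hdev hbij Y (g • x) _).symm)
  rw [vderiv_flatConnection hdev hbij Y' x v]
  exact DFunLike.congr_fun h8 v

/-- The field η* develops to the linear vector field v ↦ R_η v; its derivative along R_ξ v is R_η
R_ξ v, hence the order of the factors. -/
theorem vderiv_flatConnection_fundField (hdev : ContMDiff 𝓘(ℂ, F) 𝓘(ℂ, F) ∞ dev)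
    (hbij : ∀ y, Function.Bijective (vderiv F dev y)) {R : E →L[ℂ] (F →L[ℂ] F)}
    (hR : ∀ y ξ, vderiv F dev y (orbitDeriv E G F y ξ) = R ξ (dev y)) (x : M)
    (ξ η : GroupLieAlgebra 𝓘(ℂ, E) G) :
    vderiv F dev x (flatConnection dev hdev hbij (fundField η) x (fundField ξ x)) =
      R η (R ξ (dev x)) := by
  have h1 : devField dev (fundField η) = fun y ↦ R η (dev y) := funext fun y ↦ hR y η
  refine (vderiv_flatConnection hdev hbij _ x _).trans ?_
  rw [h1, vderiv_clm_comp _ (hdev.mdifferentiable (by simp) x)]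
  exact congrArg (R η) (hR x ξ)

end Invariance

/-! ### From a bilinear map on 𝔤 to an equivariant extension. -/

section Extension

open Module

variable {L : Type*} [LieRing L] [LieAlgebra ℂ L] {F : Type*} [AddCommGroup F] [Module ℂ F]

/-- Here q(ξ, η) stands for θ(Λ_ξ η̄), and ζ for a representative of Λ_ξ η̄, on which γ acts by the
bracket. The three hypotheses give descent to 𝔤/𝔷(e), the isotropy condition and equivariance. -/
theorem exists_isEquivariantExtension {e : L} (θ : (L ⧸ adKer e) ≃ₗ[ℂ] F) (q : L →ₗ[ℂ] L →ₗ[ℂ] F)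
    (hq : ∀ ξ γ : L, ⁅e, γ⁆ = 0 → q ξ γ = 0)
    (hγ : ∀ γ ξ : L, ⁅e, γ⁆ = 0 → q γ ξ = θ (Submodule.Quotient.mk ⁅γ, ξ⁆))
    (hγq : ∀ γ ξ η ζ : L, ⁅e, γ⁆ = 0 → θ (Submodule.Quotient.mk ζ) = q ξ η →
      q ⁅γ, ξ⁆ η + q ξ ⁅γ, η⁆ = θ (Submodule.Quotient.mk ⁅γ, ζ⁆)) :
    ∃ Λ : L →ₗ[ℂ] End ℂ (L ⧸ adKer e), IsEquivariantExtension e Λ := by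
  let Λ : L →ₗ[ℂ] End ℂ (L ⧸ adKer e) :=
    { toFun := fun ξ ↦ θ.symm.toLinearMap ∘ₗ (adKer e).liftQ (q ξ) (hq ξ)
      map_add' := fun ξ ξ' ↦ by
        refine Submodule.linearMap_qext _ (LinearMap.ext fun η ↦ ?_)
        change θ.symm (q (ξ + ξ') η) = θ.symm (q ξ η) + θ.symm (q ξ' η)
        simp
      map_smul' := fun c ξ ↦ by
        refine Submodule.linearMap_qext _ (LinearMap.ext fun η ↦ ?_)
        change θ.symm (q (c • ξ) η) = c • θ.symm (q ξ η)
        simp }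
  have hΛ : ∀ ξ η, Λ ξ (Submodule.Quotient.mk η) = θ.symm (q ξ η) := fun ξ η ↦ rfl
  have hiso : ∀ γ, ⁅e, γ⁆ = 0 → ∀ ξ : L,
      Λ γ (Submodule.Quotient.mk ξ) = Submodule.Quotient.mk ⁅γ, ξ⁆ := fun γ h ξ ↦ by
    rw [hΛ, hγ γ ξ h, LinearEquiv.symm_apply_apply]
  refine ⟨Λ, hiso, fun γ h ξ ↦ Submodule.linearMap_qext _ (LinearMap.ext fun η ↦ ?_)⟩
  obtain ⟨ζ, hζ⟩ := Submodule.Quotient.mk_surjective _ (Λ ξ (Submodule.Quotient.mk η))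
  change Λ γ (Λ ξ (Submodule.Quotient.mk η)) - Λ ξ (Λ γ (Submodule.Quotient.mk η)) =
    Λ ⁅γ, ξ⁆ (Submodule.Quotient.mk η)
  have h1 := hγq γ ξ η ζ h (by rw [hζ, hΛ, LinearEquiv.apply_symm_apply])
  rw [← hζ, hiso γ h, hiso γ h, hΛ, hΛ, sub_eq_iff_eq_add, ← map_add, h1,
    LinearEquiv.symm_apply_apply]

end Extension

/-! ### Induced vector fields: differentiability and brackets. -/

section FundamentalFields

open VectorField

set_option linter.unusedSectionVars false

variable {E : Type*} [NormedAddCommGroup E] [NormedSpace ℂ E] [FiniteDimensional ℂ E]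
  [CompleteSpace E]
  {G : Type*} [TopologicalSpace G] [ChartedSpace E G] [Group G] [LieGroup 𝓘(ℂ, E) ∞ G]
  {F : Type*} [NormedAddCommGroup F] [NormedSpace ℂ F] [FiniteDimensional ℂ F]
  [CompleteSpace F]
  {M : Type*} [TopologicalSpace M] [ChartedSpace F M] [IsManifold 𝓘(ℂ, F) ∞ M] [MulAction G M]
  [ContMDiffSMul 𝓘(ℂ, E) 𝓘(ℂ, F) ∞ G M]

theorem contMDiffAt_extChartAt_smul (o : M) :
    ContMDiffAt (𝓘(ℂ, F).prod 𝓘(ℂ, E)) 𝓘(ℂ, F) ∞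
      (fun p : M × G ↦ extChartAt 𝓘(ℂ, F) o (p.2 • p.1)) (o, 1) := by
  have h1 : ContMDiffAt (𝓘(ℂ, F).prod 𝓘(ℂ, E)) 𝓘(ℂ, F) ∞ (fun p : M × G ↦ p.2 • p.1) (o, 1) :=
    ContMDiffAt.comp (o, (1 : G)) (I' := 𝓘(ℂ, E).prod 𝓘(ℂ, F)) (g := fun p : G × M ↦ p.1 • p.2)
      (f := fun p : M × G ↦ (p.2, p.1))
      (contMDiff_smul (I := 𝓘(ℂ, E)) (I' := 𝓘(ℂ, F)) (n := ∞)).contMDiffAt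
      (contMDiffAt_snd.prodMk contMDiffAt_fst)
  refine ContMDiffAt.comp (o, (1 : G)) (f := fun p : M × G ↦ p.2 • p.1) ?_ h1
  rw [one_smul]
  exact contMDiffAt_extChartAt

theorem vderiv_extChartAt_fundField (o : M) :
    ∀ᶠ y in 𝓝 o, ∀ ξ : E, vderiv F (extChartAt 𝓘(ℂ, F) o) y (orbitDeriv E G F y ξ) =
      vderiv E (fun g : G ↦ extChartAt 𝓘(ℂ, F) o (g • y)) 1 ξ := by
  have h1 : CMDiffAt ∞ (extChartAt 𝓘(ℂ, F) o) o := contMDiffAt_extChartAt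
  filter_upwards [eventually_mdifferentiableAt h1] with y hy ξ
  rw [vderiv_comp_of_eq hy (mdifferentiableAt_smul_left E F y 1) (one_smul G y)]
  rfl

/-- In the chart κ at o, the induced field is the partial derivative in g at 1 of κ(g y). -/
theorem mdifferentiableAt_fundField (ξ : GroupLieAlgebra 𝓘(ℂ, E) G) (o : M) :
    MDiffAt (T% (fundField ξ : Π y : M, TangentSpace 𝓘(ℂ, F) y)) o := by
  have : IsManifold 𝓘(ℂ, F) 1 M := IsManifold.of_le (n := ∞) ENat.LEInfty.out
  rw [mdifferentiableAt_section]
  have h1 := contMDiffAt_vderiv_partial (Q := fun (y : M) (g : G) ↦ extChartAt 𝓘(ℂ, F) o (g • y))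
    (contMDiffAt_extChartAt_smul (E := E) o)
  have h2 : MDifferentiableAt 𝓘(ℂ, F) 𝓘(ℂ, F)
      (fun y ↦ vderiv E (fun g : G ↦ extChartAt 𝓘(ℂ, F) o (g • y)) 1 ξ) o :=
    (h1.mdifferentiableAt (by simp)).clm_apply mdifferentiableAt_const
  refine h2.congr_of_eventuallyEq ?_
  filter_upwards [vderiv_extChartAt_fundField (E := E) (G := G) (F := F) o,
    (chartAt F o).open_source.mem_nhds (mem_chart_source F o)] with y hy hys
  rw [← hy ξ]
  have h3 := TangentBundle.continuousLinearMapAt_trivializationAt (I := 𝓘(ℂ, F)) hys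
  have h4 := DFunLike.congr_fun h3 (fundField ξ y)
  refine Eq.trans ?_ h4
  exact (Bundle.Trivialization.continuousLinearMapAt_apply_of_mem
    (trivializationAt F (TangentSpace 𝓘(ℂ, F)) o) (R := ℂ) hys _).symm

/-- The bracket of two induced vector fields. -/
theorem mlieBracket_fundField (ξ η : GroupLieAlgebra 𝓘(ℂ, E) G) (o : M) :
    (mlieBracket 𝓘(ℂ, F) (fundField ξ) (fundField η) o : F) =
      -orbitDeriv E G F o (adM E G ξ η) := by
  set κ := extChartAt 𝓘(ℂ, F) o with hκ
  have hκs : CMDiffAt ∞ κ o := contMDiffAt_extChartAt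
  have h1 := mvfderiv_mlieBracket hκs (mdifferentiableAt_fundField ξ o)
    (mdifferentiableAt_fundField η o)
  let f : G → F := fun g ↦ κ (g • o)
  have hf : ContMDiffAt 𝓘(ℂ, E) 𝓘(ℂ, F) ∞ f 1 :=
    ContMDiffAt.comp (1 : G) (f := fun g : G ↦ g • o) (by rw [one_smul]; exact hκs)
      (contMDiff_smul_left E F o).contMDiffAt
  have hfm : ContMDiffAt (𝓘(ℂ, E).prod 𝓘(ℂ, E)) 𝓘(ℂ, F) ∞
      (fun p : G × G ↦ (fun h g ↦ f (g * h)) p.1 p.2) (1, 1) := by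
    refine ContMDiffAt.comp ((1 : G), (1 : G)) (f := fun p : G × G ↦ p.2 * p.1) (g := f) ?_
      (contMDiffAt_snd.mul contMDiffAt_fst)
    rw [mul_one]
    exact hf
  -- Moving o by h and then by g gives `f (g * h)`. The order is opposite to that of differentiation
  -- along left invariant fields, which causes the minus sign.
  have h2 : ∀ x y : GroupLieAlgebra 𝓘(ℂ, E) G,
      vderiv F (fun z ↦ vderiv F κ z (fundField y z)) o (fundField x o) =
        vderiv E (fun g ↦ lderiv E f g x) 1 y := by
    intro x y
    let w : M → F := fun z ↦ vderiv F κ z (fundField y z)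
    have hw : MDifferentiableAt 𝓘(ℂ, F) 𝓘(ℂ, F) w o :=
      mdifferentiableAt_mvfderiv_apply hκs (mdifferentiableAt_fundField y o)
    have h3 : vderiv F w o (fundField x o) = vderiv E (fun h : G ↦ w (h • o)) 1 x := by
      rw [vderiv_comp_of_eq hw (mdifferentiableAt_smul_left E F o 1) (one_smul G o)]
      rfl
    have h4 : (fun h : G ↦ w (h • o)) =ᶠ[𝓝 1] fun h ↦ vderiv E (fun g ↦ f (g * h)) 1 y := by
      have h5 : Filter.Tendsto (fun h : G ↦ h • o) (𝓝 1) (𝓝 o) := by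
        have := (mdifferentiableAt_smul_left E F o (1 : G)).continuousAt
        simpa [ContinuousAt] using this
      filter_upwards [h5.eventually (vderiv_extChartAt_fundField (E := E) (G := G) (F := F) o)] with h hh
      refine (hh y).trans ?_
      simp only [f, mul_smul]
      rfl
    rw [vderiv_congr h4] at h3
    exact h3.trans (vderiv_vderiv_comm (Q := fun h g : G ↦ f (g * h)) hfm x y)
  have h6 := vderiv_adM hf ξ η
  have h7 : vderiv E f 1 = orbitDeriv E G F o := by
    have h8 := vderiv_comp_of_eq (hκs.mdifferentiableAt (by simp))
      (mdifferentiableAt_smul_left E F o (1 : G)) (one_smul G o)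
    rw [vderiv_extChartAt] at h8
    exact h8
  have h9 : vderiv F κ o (mlieBracket 𝓘(ℂ, F) (fundField ξ) (fundField η) o) = _ := h1
  rw [vderiv_extChartAt] at h9
  rw [← h7, h6, neg_sub]
  exact h9.trans (congrArg₂ (· - ·) (h2 ξ η) (h2 η ξ))

end FundamentalFields

/-! ### The equivariant bilinear map of an invariant connection. -/

section Extraction

open VectorField NormedSpace

set_option linter.unusedSectionVars false

variable {E : Type*} [NormedAddCommGroup E] [NormedSpace ℂ E] [FiniteDimensional ℂ E]
  [CompleteSpace E]
  {G : Type*} [TopologicalSpace G] [ChartedSpace E G] [Group G] [LieGroup 𝓘(ℂ, E) ∞ G]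
  {F : Type*} [NormedAddCommGroup F] [NormedSpace ℂ F] [FiniteDimensional ℂ F]
  [CompleteSpace F]
  {M : Type*} [TopologicalSpace M] [ChartedSpace F M] [IsManifold 𝓘(ℂ, F) ∞ M] [MulAction G M]

/-- The covariant derivative of the field induced by `η` at `x`, as an operator on the model
space. -/
def nablaFund (nabla : LinearConnection F M) (x : M) (η : GroupLieAlgebra 𝓘(ℂ, E) G) :
    F →L[ℂ] F :=
  nabla (fundField η) x

theorem fundField_add (η η' : GroupLieAlgebra 𝓘(ℂ, E) G) :
    (fundField (η + η') : Π y : M, TangentSpace 𝓘(ℂ, F) y) = fundField η + fundField η' :=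
  funext fun y ↦ map_add (orbitDeriv E G F y) η η'

theorem fundField_smul (c : ℂ) (η : GroupLieAlgebra 𝓘(ℂ, E) G) :
    (fundField (c • η) : Π y : M, TangentSpace 𝓘(ℂ, F) y) = c • fundField η :=
  funext fun y ↦ map_smul (orbitDeriv E G F y) c η

variable [ContMDiffSMul 𝓘(ℂ, E) 𝓘(ℂ, F) ∞ G M] (nabla : LinearConnection F M)

theorem nablaFund_add (x : M) (η η' : GroupLieAlgebra 𝓘(ℂ, E) G) :
    nablaFund nabla x (η + η') = nablaFund nabla x η + nablaFund nabla x η' := by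
  have h := nabla.isCovariantDerivativeOnUniv.add
    (mdifferentiableAt_fundField (E := E) (G := G) (F := F) η x)
    (mdifferentiableAt_fundField η' x)
  rw [← fundField_add] at h
  exact h

theorem nablaFund_smul (x : M) (c : ℂ) (η : GroupLieAlgebra 𝓘(ℂ, E) G) :
    nablaFund nabla x (c • η) = c • nablaFund nabla x η := by
  have h := nabla.isCovariantDerivativeOnUniv.smul_const c
    (mdifferentiableAt_fundField (E := E) (G := G) (F := F) η x)
  rw [← fundField_smul] at h
  exact h

/-- The bilinear map `(ξ, η) ↦ ∇_{ξ*} η* + [ξ, η]*` at the point `x`. -/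
def connMap (x : M) : E →L[ℂ] E →L[ℂ] F :=
  LinearMap.toContinuousBilinearMap (LinearMap.mk₂ ℂ
    (fun ξ η : E ↦ nablaFund (E := E) (G := G) nabla x η (orbitDeriv E G F x ξ) +
      orbitDeriv E G F x (adM E G ξ η))
    (fun ξ ξ' η ↦ by
      simp only [map_add, add_apply]
      abel)
    (fun c ξ η ↦ by simp only [map_smul, smul_apply, smul_add])
    (fun ξ η η' ↦ by
      have h := nablaFund_add (E := E) (G := G) nabla x η η'
      simp only [map_add]
      refine (congrArg (· + _) (DFunLike.congr_fun h _)).trans ?_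
      simp only [add_apply]
      abel)
    (fun c ξ η ↦ by
      have h := nablaFund_smul (E := E) (G := G) nabla x c η
      simp only [map_smul]
      refine (congrArg (· + _) (DFunLike.congr_fun h _)).trans ?_
      simp only [smul_apply, smul_add]))

theorem connMap_apply (x : M) (ξ η : E) :
    connMap (E := E) (G := G) nabla x ξ η =
      nablaFund (E := E) (G := G) nabla x η (orbitDeriv E G F x ξ) +
        orbitDeriv E G F x (adM E G ξ η) := rfl

/-- By the tensoriality of the torsion, `∇_X Y = [X, Y]` at the zeros of `Y`. -/
theorem connMap_apply_of_eq_zero {x : M} {γ : E} (hγ : orbitDeriv E G F x γ = 0) (ξ : E) :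
    connMap (E := E) (G := G) nabla x ξ γ = 0 := by
  have : IsManifold 𝓘(ℂ, F) 2 M := IsManifold.of_le (n := ∞) ENat.LEInfty.out
  have h1 := nabla.torsion_apply (x := x)
    (mdifferentiableAt_fundField (E := E) (G := G) (F := F) ξ x)
    (mdifferentiableAt_fundField (E := E) (G := G) (F := F) γ x)
  have h0 : (fundField (E := E) (G := G) γ x : TangentSpace 𝓘(ℂ, F) x) = 0 := hγ
  rw [h0, map_zero, map_zero, sub_zero, eq_comm, sub_eq_zero] at h1
  have h2 : nablaFund (E := E) (G := G) nabla x γ (orbitDeriv E G F x ξ) =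
      -orbitDeriv E G F x (adM E G ξ γ) := h1.trans (mlieBracket_fundField ξ γ x)
  rw [connMap_apply, h2, neg_add_cancel]

theorem mpullback_fundField (g : G) (η : E) :
    mpullback 𝓘(ℂ, F) 𝓘(ℂ, F) (fun z : M ↦ g • z) (fundField (E := E) (G := G) (AdM E g η)) =
      fundField (E := E) (G := G) η := by
  funext y
  have hinj : Function.Injective (tderiv F F (fun z : M ↦ g • z) y) :=
    Function.LeftInverse.injective (tderiv_smul_inv_smul E g y)
  exact hinj ((tderiv_smul_mpullback E g _ y).trans (tderiv_smul_comp_orbitDeriv g y η).symm)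

/-- Follows from the invariance of ∇, as g fixes x and carries η* to (Ad(g)η)*, and from Ad(g) being
an automorphism. The element ζ lifts the value of the bilinear map, so that Ad(g) can act on it. -/
theorem connMap_AdM (hinv : IsInvariant G nabla) {x : M} {g : G} (hg : g • x = x) {ξ η ζ : E}
    (hζ : orbitDeriv E G F x ζ = connMap (E := E) (G := G) nabla x ξ η) :
    connMap (E := E) (G := G) nabla x (AdM E g ξ) (AdM E g η) =
      orbitDeriv E G F x (AdM E g ζ) := by
  have hd : ∀ z, tderiv F F (fun y : M ↦ g • y) x (orbitDeriv E G F x z) =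
      orbitDeriv E G F x (AdM E g z) := fun z ↦ by
    rw [tderiv_smul_comp_orbitDeriv, hg]
  have h1 := hinv g x (fundField (E := E) (G := G) (AdM E g η)) (fundField (E := E) (G := G) ξ x)
    (mdifferentiableAt_fundField _ _)
  rw [mpullback_fundField] at h1
  have h2 : ∀ (x' : M) (w : F), x' = x →
      nablaFund (E := E) (G := G) nabla x' (AdM E g η) w =
        nablaFund (E := E) (G := G) nabla x (AdM E g η) w := by
    rintro x' w rfl
    rfl
  have h3 : tderiv F F (fun y : M ↦ g • y) x
      (nablaFund (E := E) (G := G) nabla x η (orbitDeriv E G F x ξ)) =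
      nablaFund (E := E) (G := G) nabla x (AdM E g η) (orbitDeriv E G F x (AdM E g ξ)) := by
    rw [← hd]
    exact h1.trans (h2 _ _ hg)
  rw [connMap_apply, ← h3, ← AdM_adM, ← hd, ← hd, hζ, connMap_apply, map_add]

/-- The infinitesimal equivariance of the map that corresponds to an invariant connection. -/
theorem connMap_adM [LieAlgebra.IsKilling ℂ (GroupLieAlgebra 𝓘(ℂ, E) G)] {e : E} {o : M}
    (hM : IsHomogeneousSpace (E := E) (F := F) (centralizerComponent (E := E) (G := G) e) o)
    (hinv : IsInvariant G nabla) {γ ξ η ζ : E} (hγ : adM E G γ e = 0)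
    (hζ : orbitDeriv E G F o ζ = connMap (E := E) (G := G) nabla o ξ η) :
    connMap (E := E) (G := G) nabla o (adM E G γ ξ) η +
      connMap (E := E) (G := G) nabla o ξ (adM E G γ η) =
        orbitDeriv E G F o (adM E G γ ζ) := by
  obtain ⟨c, δ, hδ, hc, hc0, -, hAd⟩ := exists_curve (E := E) (G := G) γ
  have hmem := mem_centralizerComponent_of_curve hδ hc hc0 hAd hγ
  have hexp : ∀ z : E, HasDerivAt (fun t : ℂ ↦ exp (t • adM E G γ) z) (adM E G γ z) 0 := by
    intro z
    have h := (hasDerivAt_exp_smul_const (adM E G γ) (0 : ℂ)).clm_apply (hasDerivAt_const 0 z)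
    refine h.congr_deriv ?_
    simp
  set q := connMap (E := E) (G := G) nabla o with hq
  have h1 : HasDerivAt (fun t : ℂ ↦ q (exp (t • adM E G γ) ξ) (exp (t • adM E G γ) η))
      (q (adM E G γ ξ) η + q ξ (adM E G γ η)) 0 := by
    have h := (q.hasFDerivAt.comp_hasDerivAt (0 : ℂ) (hexp ξ)).clm_apply (hexp η)
    refine h.congr_deriv ?_
    simp
  have h2 : HasDerivAt (fun t : ℂ ↦ orbitDeriv E G F o (exp (t • adM E G γ) ζ))
      (orbitDeriv E G F o (adM E G γ ζ)) 0 :=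
    (orbitDeriv E G F o).hasFDerivAt.comp_hasDerivAt (0 : ℂ) (hexp ζ)
  refine (h1.congr_of_eventuallyEq ?_).unique h2
  -- For each small t the identity is `connMap_AdM` for an element of H⁰ with Ad = exp(t ad γ); the
  -- claim is its derivative at t = 0.
  filter_upwards [Metric.ball_mem_nhds (0 : ℂ) hδ] with t ht
  have h3 := connMap_AdM nabla hinv (hM.smul_eq (hmem t ht)) hζ
  rw [hAd t ht] at h3
  exact h3.symm

end Extraction

/-! ### Transfer between 𝔤/𝔷(e), the tangent space at o and the model space. -/

section Transport

open Module

set_option linter.unusedSectionVars false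

variable {E : Type*} [NormedAddCommGroup E] [NormedSpace ℂ E] [FiniteDimensional ℂ E]
  [CompleteSpace E]
  {G : Type*} [TopologicalSpace G] [ChartedSpace E G] [Group G] [LieGroup 𝓘(ℂ, E) ∞ G]
  [LieAlgebra.IsKilling ℂ (GroupLieAlgebra 𝓘(ℂ, E) G)]
  {F : Type*} [NormedAddCommGroup F] [NormedSpace ℂ F] [FiniteDimensional ℂ F]
  {M : Type*} [TopologicalSpace M] [ChartedSpace F M] [IsManifold 𝓘(ℂ, F) ∞ M] [MulAction G M]
  {e : GroupLieAlgebra 𝓘(ℂ, E) G} {o : M}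

theorem adM_eq_zero_iff {e ξ : GroupLieAlgebra 𝓘(ℂ, E) G} : adM E G ξ e = 0 ↔ ⁅e, ξ⁆ = 0 := by
  have h : ⁅ξ, e⁆ = 0 ↔ ⁅e, ξ⁆ = 0 := by rw [← lie_skew, neg_eq_zero]
  exact h

/-- The tangent space at the base point is `𝔤/𝔷(e)`. -/
theorem IsHomogeneousSpace.exists_tangentEquiv
    (hM : IsHomogeneousSpace (E := E) (F := F) (centralizerComponent e) o) :
    ∃ θ : (GroupLieAlgebra 𝓘(ℂ, E) G ⧸ adKer e) ≃ₗ[ℂ] F,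
      ∀ ξ : GroupLieAlgebra 𝓘(ℂ, E) G, θ (Submodule.Quotient.mk ξ) = orbitDeriv E G F o ξ := by
  let φ : GroupLieAlgebra 𝓘(ℂ, E) G →ₗ[ℂ] F := (orbitDeriv E G F o).toLinearMap
  have hφ : ∀ ξ, φ ξ = 0 ↔ ξ ∈ adKer e := fun ξ ↦
    (hM.orbitDeriv_eq_zero_iff subset_rfl (connectedComponentIn_subset _ _)).trans
      adM_eq_zero_iff
  refine ⟨LinearEquiv.ofBijective ((adKer e).liftQ φ fun ξ hξ ↦ (hφ ξ).2 hξ) ⟨?_, ?_⟩,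
    fun ξ ↦ rfl⟩
  · rw [← LinearMap.ker_eq_bot, LinearMap.ker_eq_bot']
    intro w hw
    obtain ⟨ξ, rfl⟩ := Submodule.Quotient.mk_surjective _ w
    exact (Submodule.Quotient.mk_eq_zero _).2 ((hφ ξ).1 hw)
  · intro v
    obtain ⟨ξ, hξ⟩ := hM.orbitDeriv_surjective v
    exact ⟨Submodule.Quotient.mk ξ, hξ⟩

/-- An invariant connection gives an equivariant extension of the isotropy representation. -/
theorem IsHomogeneousSpace.exists_isEquivariantExtension [CompleteSpace F]
    (hM : IsHomogeneousSpace (E := E) (F := F) (centralizerComponent e) o)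
    {nabla : LinearConnection F M} (hinv : IsInvariant G nabla) :
    ∃ Λ : GroupLieAlgebra 𝓘(ℂ, E) G →ₗ[ℂ] End ℂ (GroupLieAlgebra 𝓘(ℂ, E) G ⧸ adKer e),
      IsEquivariantExtension e Λ := by
  have := hM.smooth
  obtain ⟨θ, hθ⟩ := hM.exists_tangentEquiv
  let q₀ := connMap (E := E) (G := G) nabla o
  let q : GroupLieAlgebra 𝓘(ℂ, E) G →ₗ[ℂ] GroupLieAlgebra 𝓘(ℂ, E) G →ₗ[ℂ] F :=
    LinearMap.mk₂ ℂ (fun ξ η ↦ q₀ ξ η)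
      (fun ξ ξ' η ↦ DFunLike.congr_fun (map_add q₀ ξ ξ') η)
      (fun c ξ η ↦ DFunLike.congr_fun (map_smul q₀ c ξ) η)
      (fun ξ η η' ↦ map_add (q₀ ξ) η η') (fun c ξ η ↦ map_smul (q₀ ξ) c η)
  have h0 : ∀ γ : GroupLieAlgebra 𝓘(ℂ, E) G, ⁅e, γ⁆ = 0 → orbitDeriv E G F o γ = 0 := fun γ h ↦
    (hM.orbitDeriv_eq_zero_iff subset_rfl (connectedComponentIn_subset _ _)).2
      (adM_eq_zero_iff.2 h)
  refine InvConn.exists_isEquivariantExtension θ q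
    (fun ξ γ h ↦ connMap_apply_of_eq_zero nabla (h0 γ h) ξ) (fun γ ξ h ↦ ?_)
    (fun γ ξ η ζ h hζ ↦ ?_)
  · refine (connMap_apply (E := E) (G := G) nabla o γ ξ).trans (Eq.trans ?_ (hθ _).symm)
    rw [h0 γ h, map_zero, zero_add]
    rfl
  · exact (connMap_adM nabla hM hinv (adM_eq_zero_iff.2 h) ((hθ ζ).symm.trans hζ)).trans
      (hθ ⁅γ, ζ⁆).symm

theorem exists_conj_representation {L V : Type*} [LieRing L] [LieAlgebra ℂ L]
    [AddCommGroup V] [Module ℂ V] (ψ : V ≃ₗ[ℂ] F)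
    (Γ : L →ₗ[ℂ] End ℂ V) : ∃ R : L →ₗ[ℂ] (F →L[ℂ] F), ∀ ξ w, R ξ (ψ w) = ψ (Γ ξ w) :=
  ⟨LinearMap.toContinuousLinearMap.toLinearMap ∘ₗ ψ.conj.toLinearMap ∘ₗ Γ, fun ξ w ↦ by
    simp [LinearEquiv.conj_apply]⟩

end Transport

end InvConn

end

/-! ### Assembly of the theorem. -/

theorem mainTheorem2
    -- `G` is a simply connected semisimple complex Lie group
    {E : Type*} [NormedAddCommGroup E] [NormedSpace ℂ E] [FiniteDimensional ℂ E] [CompleteSpace E]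
    {G : Type*} [TopologicalSpace G] [T2Space G] [ChartedSpace E G] [Group G]
    [LieGroup 𝓘(ℂ, E) ∞ G] [SimplyConnectedSpace G]
    [LieAlgebra.IsSemisimple ℂ (GroupLieAlgebra 𝓘(ℂ, E) G)]
    -- `e` is a nilpotent element of the Lie algebra
    (e : GroupLieAlgebra 𝓘(ℂ, E) G)
    (he : IsNilpotent (LieAlgebra.ad ℂ (GroupLieAlgebra 𝓘(ℂ, E) G) e))
    -- `M = G/H⁰` is the universal covering of the orbit of `e`
    {F : Type*} [NormedAddCommGroup F] [NormedSpace ℂ F] [FiniteDimensional ℂ F] [CompleteSpace F]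
    {M : Type*} [TopologicalSpace M] [T2Space M] [ChartedSpace F M] [IsManifold 𝓘(ℂ, F) ∞ M]
    [MulAction G M] (o : M)
    (hM : InvConn.IsHomogeneousSpace (E := E) (F := F) (InvConn.centralizerComponent e) o)
    -- `M` admits an invariant linear connection
    (hconn : ∃ nabla : InvConn.LinearConnection F M,
      InvConn.IsHolomorphic nabla ∧ InvConn.IsInvariant G nabla) :
    (∃ f h : GroupLieAlgebra 𝓘(ℂ, E) G, InvConn.IsTriple f h e) ∧
    ∀ f h : GroupLieAlgebra 𝓘(ℂ, E) G, InvConn.IsTriple f h e →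
      -- the identification of `𝔤/𝔥` with the tangent space at the base point
      ∃ θ : (GroupLieAlgebra 𝓘(ℂ, E) G ⧸ InvConn.stabAlg e) ≃ₗ[ℂ] TangentSpace 𝓘(ℂ, F) o,
        (∀ ξ : GroupLieAlgebra 𝓘(ℂ, E) G,
          θ (Submodule.Quotient.mk ξ) = InvConn.fundField ξ o) ∧
      ∃ nabla : InvConn.LinearConnection F M,
        InvConn.IsHolomorphic nabla ∧ InvConn.IsInvariant G nabla ∧
        InvConn.IsLocallyFlat nabla ∧
      ∃ Γ : GroupLieAlgebra 𝓘(ℂ, E) G →ₗ[ℂ]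
          Module.End ℂ (GroupLieAlgebra 𝓘(ℂ, E) G ⧸ InvConn.stabAlg e),
        -- `Γ` is the map that corresponds to the connection
        (∀ ξ η : GroupLieAlgebra 𝓘(ℂ, E) G,
          θ (Γ ξ (Submodule.Quotient.mk η)) =
            nabla (InvConn.fundField η) o (InvConn.fundField ξ o) +
              InvConn.fundField ⁅ξ, η⁆ o) ∧
        InvConn.IsTransitiveRep Γ ∧
        (∀ ξ : GroupLieAlgebra 𝓘(ℂ, E) G,
          Γ ξ (Submodule.Quotient.mk h) = Submodule.Quotient.mk ξ) ∧
        -- `Γ` integrates to a `G`-module, in which the orbit of `h̄` is open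
        ∃ (ρ : G →* (F →L[ℂ] F))
          (ψ : (GroupLieAlgebra 𝓘(ℂ, E) G ⧸ InvConn.stabAlg e) ≃ₗ[ℂ] F),
          ContMDiff 𝓘(ℂ, E) 𝓘(ℂ, F →L[ℂ] F) ∞ ρ ∧
          (∀ (ξ : GroupLieAlgebra 𝓘(ℂ, E) G)
            (w : GroupLieAlgebra 𝓘(ℂ, E) G ⧸ InvConn.stabAlg e),
            mvfderiv 𝓘(ℂ, E) ρ 1 ξ (ψ w) = ψ (Γ ξ w)) ∧
          -- the covering `M` is locally `G`-equivariantly this orbit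
          InvConn.IsLocallyOpenOrbit (F' := F) M ρ (ψ (Submodule.Quotient.mk h)) ∧
          -- and so is the orbit `X = G/H` of `e`
          ∀ (F' : Type*) [NormedAddCommGroup F'] [NormedSpace ℂ F'] [FiniteDimensional ℂ F']
            (X : Type*) [TopologicalSpace X] [T2Space X] [ChartedSpace F' X]
            [IsManifold 𝓘(ℂ, F') ∞ X] [MulAction G X] (x₀ : X),
            InvConn.IsHomogeneousSpace (E := E) (F := F') (InvConn.centralizer e) x₀ →
            InvConn.IsLocallyOpenOrbit (F' := F') X ρ (ψ (Submodule.Quotient.mk h)) := by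
  have : FiniteDimensional ℂ (GroupLieAlgebra 𝓘(ℂ, E) G) :=
    inferInstanceAs (FiniteDimensional ℂ E)
  have hkill : LieAlgebra.IsKilling ℂ (GroupLieAlgebra 𝓘(ℂ, E) G) := inferInstance
  have := hM.smooth
  refine ⟨?_, fun f h ht ↦ ?_⟩
  · obtain ⟨f, h, h1, h2, h3⟩ := InvConn.exists_triple_of_isNilpotent he
    exact ⟨f, h, h1, h2, h3⟩
  obtain ⟨nabla₀, -, hinv₀⟩ := hconn
  obtain ⟨Λ, hΛ⟩ := hM.exists_isEquivariantExtension hinv₀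
  obtain ⟨Γ, hΓlie, -, hΓh⟩ := hΛ.exists_representation ht.lie_e_f ht.lie_h_e ht.lie_h_f
  obtain ⟨θ, hθ⟩ := hM.exists_tangentEquiv
  -- Transported to the tangent space at o, the representation acts on the model space of `M`, where
  -- the developing map takes its values.
  obtain ⟨R₀, hR₀⟩ := InvConn.exists_conj_representation θ Γ
  have hR₀h : ∀ ξ, R₀ ξ (θ (Submodule.Quotient.mk h)) = θ (Submodule.Quotient.mk ξ) := fun ξ ↦ by
    rw [hR₀, hΓh]
  have hR₀lie : ∀ ξ η, R₀ ⁅ξ, η⁆ = R₀ ξ * R₀ η - R₀ η * R₀ ξ := fun ξ η ↦ by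
    refine ContinuousLinearMap.ext fun v ↦ ?_
    obtain ⟨w, rfl⟩ := θ.surjective v
    change _ = R₀ ξ (R₀ η (θ w)) - R₀ η (R₀ ξ (θ w))
    simp only [hR₀, hΓlie, ← map_sub]
    rfl
  have hR₀0 : ∀ ξ, R₀ ξ (θ (Submodule.Quotient.mk h)) = 0 ↔ InvConn.adM E G ξ e = 0 := fun ξ ↦ by
    rw [hR₀h, LinearEquiv.map_eq_zero_iff, Submodule.Quotient.mk_eq_zero]
    exact InvConn.adM_eq_zero_iff.symm
  have hR₀s : ∀ w, ∃ ξ, R₀ ξ (θ (Submodule.Quotient.mk h)) = w := fun w ↦ by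
    obtain ⟨v, rfl⟩ := θ.surjective w
    obtain ⟨ξ, rfl⟩ := Submodule.Quotient.mk_surjective _ v
    exact ⟨ξ, hR₀h ξ⟩
  let R₁ : E →ₗ[ℂ] (F →L[ℂ] F) := R₀
  let R : E →L[ℂ] (F →L[ℂ] F) := LinearMap.toContinuousLinearMap R₁
  obtain ⟨ρ, hρ⟩ := InvConn.exists_isOpenOrbitModel (G := G) (R := R) hR₀lie hR₀0 hR₀s
  obtain ⟨dev, hdev, hdevo, hequiv, hbij, horb⟩ := hρ.exists_dev hM
  refine ⟨θ, hθ, InvConn.flatConnection dev hdev hbij,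
    InvConn.isHolomorphic_flatConnection hdev hbij,
    InvConn.isInvariant_flatConnection (E := E) hdev hbij ρ hequiv,
    InvConn.isLocallyFlat_flatConnection hdev hbij, Γ, fun ξ η ↦ ?_,
    ⟨hΓlie, Submodule.Quotient.mk h, fun w ↦ ?_⟩, hΓh, ρ, θ, hρ.contMDiff, fun ξ w ↦ ?_,
    hρ.isLocallyOpenOrbit hM subset_rfl (connectedComponentIn_subset _ _), ?_⟩
  -- The derivative of `dev` at o is the identity under θ: it sends ξ*(o) to R_ξ h̄ = ξ̄.
  · have hD : ∀ w, InvConn.vderiv F dev o (θ w) = θ w := by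
      intro w
      obtain ⟨ζ, rfl⟩ := Submodule.Quotient.mk_surjective _ w
      rw [← hR₀h ζ, ← hdevo]
      refine Eq.trans ?_ (horb o ζ)
      rw [hdevo, hR₀h ζ, hθ]
    refine (hbij o).1 ?_
    refine Eq.trans ?_ (map_add (InvConn.vderiv F dev o) _ _).symm
    -- Developed at o, with v = θ h̄, the right side is R_η R_ξ v + R_[ξ,η] v = R_ξ R_η v = R_ξ(θ
    -- η̄), the image of Γ_ξ η̄.
    have h1 := InvConn.vderiv_flatConnection_fundField (G := G) hdev hbij horb o ξ η
    have h2 := horb o (InvConn.adM E G ξ η)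
    refine Eq.trans ?_ (congrArg₂ (· + ·) h1 h2).symm
    refine (hD (Γ ξ (Submodule.Quotient.mk η))).trans ?_
    rw [hdevo]
    change θ (Γ ξ (Submodule.Quotient.mk η)) = R₀ η (R₀ ξ (θ (Submodule.Quotient.mk h))) +
      R₀ ⁅ξ, η⁆ (θ (Submodule.Quotient.mk h))
    rw [hR₀lie]
    change θ (Γ ξ (Submodule.Quotient.mk η)) = R₀ η (R₀ ξ (θ (Submodule.Quotient.mk h))) +
      (R₀ ξ (R₀ η (θ (Submodule.Quotient.mk h))) - R₀ η (R₀ ξ (θ (Submodule.Quotient.mk h))))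
    rw [add_sub_cancel, hR₀h η, hR₀]
  · obtain ⟨ξ, rfl⟩ := Submodule.Quotient.mk_surjective _ w
    exact ⟨ξ, hΓh ξ⟩
  · have h1 := (hρ.hasLogDerivAt 1).lderiv_eq ξ
    rw [InvConn.lderiv_one, map_one, one_mul] at h1
    exact (DFunLike.congr_fun h1 (θ w)).trans (hR₀ ξ w)
  · intro F' _ _ _ X _ _ _ _ _ x₀ hX
    exact hρ.isLocallyOpenOrbit hX (connectedComponentIn_subset _ _) subset_rfl
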